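/- Let $\mathbb K$ be an algebraically closed field of characteristic $0$, let $V=\mathbb K^{N+1}$, and let $B\subset\mathbb G(k,N)$ be an irreducible closed subvariety of dimension $n$ of the Grassmannian of $k$-dimensional linear subspaces of $\mathbb P^N=\mathbb P(V)$. Suppose that the union of the $k$-spaces belonging to $B$ is an (irreducible, closed) algebraic variety $X\subset\mathbb P^N$ of dimension $n+k<N$. For a nonsingular point $\Lambda=\mathbb P(\hat\Lambda)$ of $B$, regard $T_\Lambda B$ as a subspace of $T_\Lambda\mathbb G(k,N)=\operatorname{Hom}(\hat\Lambda,V/\hat\Lambda)$. The characteristic map of $B$ relative to $\Lambda$ is the map $\chi(\Lambda):T_\Lambda B\otimes\mathcal O_\Lambda\to\mathcal N_{\Lambda|\mathbb P^N}$ given at $[v]\in\Lambda$ by $\eta\mapsto\eta(v)\in V/\hat\Lambda$. A point of $\Lambda$ is focal if $\chi(\Lambda)$ does not have maximal rank there; the focal subscheme of $\Lambda$ is the closed subscheme defined by the minors of maximal order of the matrix of linear forms that represents $\chi(\Lambda)$. Then the following are equivalent: (i) the tangent space to $X$ is constant along general elements of $B$, that is, there is a nonempty open subset of $B$ such that every $\Lambda$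 in it contains nonsingular points of $X$, and the embedded tangent space $\mathbb T_xX$ is the same for all nonsingular points $x$ of $X$ lying on $\Lambda$; (ii) there is an open subset $U$ of $B$, containing nonsingular points of $B$, such that for every nonsingular point $\Lambda$ of $B$: if $\Lambda\in U$, then the focal subscheme of $\Lambda$ is a hypersurface of degree $n$ of $\Lambda$; if $\Lambda\notin U$, then all points of $\Lambda$ are focal. (Here a hypersurface of degree $d$ of $\Lambda\cong\mathbb P^k$ is the closed subscheme defined by a nonzero form of degree $d$ in $k+1$ variables; it is empty if $d=0$ or $k=0$.) -/

import Mathlib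

open scoped LinearAlgebra.Projectivization

noncomputable section

namespace RuledVariety

section Affine

variable {K : Type*} [Field K] {σ : Type*}

/-- The Zariski topology on the affine space `K^σ`: the closed sets are the common zero sets of
families of polynomials. -/
abbrev zariskiTopology (K : Type*) [Field K] (σ : Type*) : TopologicalSpace (σ → K) :=
  TopologicalSpace.induced
    (MvPolynomial.pointToPoint : (σ → K) → PrimeSpectrum (MvPolynomial σ K)) inferInstance

theorem isClosed_zariski_iff (Z : Set (σ → K)) :
    @IsClosed _ (zariskiTopology K σ) Z ↔
      ∃ S : Set (MvPolynomial σ K), Z = {x | ∀ P ∈ S, MvPolynomial.eval x P = 0} := by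
  have key : ∀ S : Set (MvPolynomial σ K),
      (MvPolynomial.pointToPoint : (σ → K) → PrimeSpectrum (MvPolynomial σ K)) ⁻¹'
        PrimeSpectrum.zeroLocus S = {x | ∀ P ∈ S, MvPolynomial.eval x P = 0} := by
    intro S
    ext x
    simp [MvPolynomial.pointToPoint, PrimeSpectrum.mem_zeroLocus, Set.subset_def,
      MvPolynomial.aeval_eq_eval]
  rw [isClosed_induced_iff]
  constructor
  · rintro ⟨t, ht, rfl⟩
    obtain ⟨S, rfl⟩ := (PrimeSpectrum.isClosed_iff_zeroLocus t).1 ht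
    exact ⟨S, key S⟩
  · rintro ⟨S, rfl⟩
    exact ⟨_, PrimeSpectrum.isClosed_zeroLocus S, key S⟩

/-- The Zariski tangent space at `x` of the (reduced) closure of `C ⊆ K^σ`: the vectors `w` killed
by the differentials at `x` of all polynomials vanishing on `C`. -/
def tangentSpace [Fintype σ] (C : Set (σ → K)) (x : σ → K) : Submodule K (σ → K) where
  carrier := {w | ∀ P : MvPolynomial σ K, (∀ y ∈ C, MvPolynomial.eval y P = 0) →
    ∑ i, MvPolynomial.eval x (MvPolynomial.pderiv i P) * w i = 0}
  add_mem' := by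
    intro a b ha hb P hP
    simp [mul_add, Finset.sum_add_distrib, ha P hP, hb P hP]
  zero_mem' := by
    intro P _
    simp
  smul_mem' := by
    intro c a ha P hP
    have h : ∀ i, MvPolynomial.eval x (MvPolynomial.pderiv i P) * (c • a) i
        = c * (MvPolynomial.eval x (MvPolynomial.pderiv i P) * a i) := by
      intro i
      simp only [Pi.smul_apply, smul_eq_mul]
      ring
    simp only [h, ← Finset.mul_sum, ha P hP, mul_zero]

end Affine

/-- The underlying vector space `V` of `ℙ^N`. -/
abbrev Vec (K : Type*) (N : ℕ) : Type _ := Fin (N + 1) → K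

/-- The projective space `ℙ^N` over `K`. -/
abbrev PSpace (K : Type*) [Field K] (N : ℕ) : Type _ := ℙ K (Vec K N)

/-- The Grassmannian `𝔾(k, N) = G(k + 1, V)` of projective `k`-spaces in `ℙ^N`. -/
def Gr (K : Type*) [Field K] (N k : ℕ) : Type _ :=
  {L : Submodule K (Vec K N) // Module.finrank K L = k + 1}

variable {K : Type*} [Field K] {N k : ℕ}

/-- The linear subspace `Λ̂ ⊆ V` with `Λ = ℙ(Λ̂)`. -/
def Gr.toSub (L : Gr K N k) : Submodule K (Vec K N) := L.1

/-! ### Projective varieties -/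

/-- The Zariski topology of `ℙ^N`, as the quotient of `V ∖ {0}`. -/
instance : TopologicalSpace (PSpace K N) :=
  TopologicalSpace.coinduced (Projectivization.mk' K)
    (TopologicalSpace.induced (Subtype.val : {v : Vec K N // v ≠ 0} → Vec K N)
      (zariskiTopology K (Fin (N + 1))))

/-- The affine cone (without the origin) over `X ⊆ ℙ^N`. -/
def cone (X : Set (PSpace K N)) : Set (Vec K N) :=
  {v | ∃ h : v ≠ 0, Projectivization.mk K v h ∈ X}

/-- The embedded tangent space `𝕋_x X ⊆ ℙ^N`, given as a linear subspace of `V`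
(so its projective dimension is `finrank - 1`). -/
def embeddedTangentSpace (X : Set (PSpace K N)) (x : PSpace K N) : Submodule K (Vec K N) :=
  tangentSpace (cone X) x.rep

/-- `x` is a nonsingular point of the irreducible projective variety `X`:
`dim 𝕋_x X = dim X` as projective spaces. -/
def IsSmoothPoint (X : Set (PSpace K N)) (x : PSpace K N) : Prop :=
  x ∈ X ∧ ((Module.finrank K (embeddedTangentSpace X x) : ℕ) : WithBot ℕ∞)
    = topologicalKrullDim X + 1

/-! ### Subvarieties of the Grassmannian -/

/-- The frames of the members of `B ⊆ 𝔾(k, N)`: the matrices whose `k + 1` rows form a basis of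
`Λ̂` for some `Λ ∈ B`. -/
def frames (B : Set (Gr K N k)) : Set (Fin (k + 1) × Fin (N + 1) → K) :=
  {M | ∃ L ∈ B, ∃ b : Module.Basis (Fin (k + 1)) K L.toSub, ∀ i j, M (i, j) = (b i : Vec K N) j}

/-- The `k`-space spanned by the rows of a matrix of rank `k + 1`. -/
def spanGr (M : {M : Fin (k + 1) × Fin (N + 1) → K //
    LinearIndependent K (fun i j => M (i, j) : Fin (k + 1) → Vec K N)}) : Gr K N k :=
  ⟨Submodule.span K (Set.range (fun i j => M.1 (i, j) : Fin (k + 1) → Vec K N)), by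
    rw [finrank_span_eq_card M.2, Fintype.card_fin]⟩

/-- The Zariski topology of the Grassmannian, as the quotient by `GL_{k+1}` of the open set of
matrices of rank `k + 1` in the affine space of `(k + 1) × (N + 1)` matrices. For `k = 0` this is
the topology of `ℙ^N` above. -/
instance : TopologicalSpace (Gr K N k) :=
  TopologicalSpace.coinduced spanGr
    (TopologicalSpace.induced Subtype.val (zariskiTopology K (Fin (k + 1) × Fin (N + 1))))

/-- The tangent space `T_Λ B`, as a subspace of `T_Λ 𝔾(k, N) = Hom(Λ̂, V / Λ̂)`. The differential
at a frame `b` of `Λ` of the quotient map from frames to the Grassmannian sends a matrix `M'` to the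
homomorphism `b i ↦ (i-th row of M') mod Λ̂`; `T_Λ B` is the image under it of the tangent space at
`b` to the set of frames of members of `B` (it does not depend on `b`). -/
def tangentSpaceGr (B : Set (Gr K N k)) (L : Gr K N k) :
    Submodule K (L.toSub →ₗ[K] (Vec K N ⧸ L.toSub)) where
  carrier := {η | ∀ b : Module.Basis (Fin (k + 1)) K L.toSub,
    ∃ M' ∈ tangentSpace (frames B) (fun p => (b p.1 : Vec K N) p.2),
      ∀ i, η (b i) = Submodule.Quotient.mk (fun j => M' (i, j))}
  add_mem' := by
    intro η θ hη hθ b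
    obtain ⟨M, hM, h⟩ := hη b
    obtain ⟨M', hM', h'⟩ := hθ b
    refine ⟨M + M', Submodule.add_mem _ hM hM', fun i => ?_⟩
    rw [LinearMap.add_apply, h, h', ← Submodule.Quotient.mk_add]
    rfl
  zero_mem' := by
    intro b
    refine ⟨0, Submodule.zero_mem _, fun i => ?_⟩
    rw [LinearMap.zero_apply]
    exact (Submodule.Quotient.mk_zero _).symm
  smul_mem' := by
    intro c η hη b
    obtain ⟨M, hM, h⟩ := hη b
    refine ⟨c • M, Submodule.smul_mem _ c hM, fun i => ?_⟩
    rw [LinearMap.smul_apply, h, ← Submodule.Quotient.mk_smul]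
    rfl

/-- `Λ` is a nonsingular point of the irreducible variety `B ⊆ 𝔾(k, N)`:
`dim T_Λ B = dim B`. -/
def IsSmoothMember (B : Set (Gr K N k)) (L : Gr K N k) : Prop :=
  L ∈ B ∧ ((Module.finrank K (tangentSpaceGr B L) : ℕ) : WithBot ℕ∞) = topologicalKrullDim B

/-- The union `X ⊆ ℙ^N` of the `k`-spaces of the family `B`. -/
def unionOf (B : Set (Gr K N k)) : Set (PSpace K N) :=
  {x | ∃ L ∈ B, x.submodule ≤ L.toSub}

/-! ### Focal points -/

/-- The fibre at `v ∈ Λ̂` of the characteristic map of `B` relative to `Λ`. Here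
`T_Λ B → N_{Λ̂ | V, v} = V / Λ̂` sends a tangent vector `η ∈ Hom(Λ̂, V / Λ̂)` to `η v`. -/
def characteristicMap (B : Set (Gr K N k)) (L : Gr K N k) (v : L.toSub) :
    tangentSpaceGr B L →ₗ[K] (Vec K N ⧸ L.toSub) :=
  (LinearMap.applyₗ v).comp (tangentSpaceGr B L).subtype

/-- The maximal possible rank of the characteristic map relative to `Λ`. -/
def maxRank (B : Set (Gr K N k)) (L : Gr K N k) : ℕ :=
  min (Module.finrank K (tangentSpaceGr B L)) (Module.finrank K (Vec K N ⧸ L.toSub))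

/-- `[v] ∈ Λ` is a focal point: the characteristic map relative to `Λ` does not have maximal rank
at `v`. -/
def IsFocalAt (B : Set (Gr K N k)) (L : Gr K N k) (v : L.toSub) : Prop :=
  Module.finrank K (LinearMap.range (characteristicMap B L v)) < maxRank B L

/-- All points of `Λ` are focal. -/
def AllFocal (B : Set (Gr K N k)) (L : Gr K N k) : Prop :=
  ∀ v : L.toSub, v ≠ 0 → IsFocalAt B L v

/-- The entry, with respect to a tangent vector `η` and a functional `φ` on `V / Λ̂`, of the matrix
of the characteristic map: the linear form `v ↦ φ (η v)` on `Λ̂`, written in the homogeneous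
coordinates of `Λ` given by a basis `b` of `Λ̂`. -/
def charEntry (L : Gr K N k) (b : Module.Basis (Fin (k + 1)) K L.toSub)
    (η : L.toSub →ₗ[K] (Vec K N ⧸ L.toSub)) (φ : Module.Dual K (Vec K N ⧸ L.toSub)) :
    MvPolynomial (Fin (k + 1)) K :=
  ∑ l, MvPolynomial.C (φ (η (b l))) * MvPolynomial.X l

/-- The homogeneous ideal of the focal subscheme of `Λ`, in the coordinates given by `b`: it is
generated by the minors of maximal order of the matrix of the characteristic map. -/
def focalIdeal (B : Set (Gr K N k)) (L : Gr K N k) (b : Module.Basis (Fin (k + 1)) K L.toSub) :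
    Ideal (MvPolynomial (Fin (k + 1)) K) :=
  Ideal.span {P | ∃ (η : Fin (maxRank B L) → tangentSpaceGr B L)
    (φ : Fin (maxRank B L) → Module.Dual K (Vec K N ⧸ L.toSub)),
    P = (Matrix.of fun i j => charEntry L b (η i).1 (φ j)).det}

/-- Two homogeneous ideals of `K[x_0, …, x_k]` define the same closed subscheme of `ℙ^k`, i.e. their
saturations with respect to the irrelevant ideal `(x_0, …, x_k)` agree. -/
def SameSubscheme (I J : Ideal (MvPolynomial (Fin (k + 1)) K)) : Prop :=
  ∀ P, (∃ m : ℕ, ∀ Q ∈ Ideal.span (Set.range (MvPolynomial.X (R := K) (σ := Fin (k + 1)))) ^ m,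
      Q * P ∈ I) ↔
    (∃ m : ℕ, ∀ Q ∈ Ideal.span (Set.range (MvPolynomial.X (R := K) (σ := Fin (k + 1)))) ^ m,
      Q * P ∈ J)

/-- The focal subscheme of `Λ` is a hypersurface of degree `d` of `Λ`. -/
def FocalHypersurface (B : Set (Gr K N k)) (L : Gr K N k) (d : ℕ) : Prop :=
  ∀ b : Module.Basis (Fin (k + 1)) K L.toSub, ∃ F : MvPolynomial (Fin (k + 1)) K,
    F ≠ 0 ∧ F.IsHomogeneous d ∧ SameSubscheme (focalIdeal B L b) (Ideal.span {F})

/-! ### The two properties -/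

/-- The tangent space to `X` is constant along `Λ`: `Λ` contains nonsingular points of `X`, and `X`
has the same embedded tangent space at all of them. -/
def TangentConstantAlong (X : Set (PSpace K N)) (L : Gr K N k) : Prop :=
  (∃ x : PSpace K N, x.submodule ≤ L.toSub ∧ IsSmoothPoint X x) ∧
  ∃ T : Submodule K (Vec K N), ∀ x : PSpace K N, x.submodule ≤ L.toSub → IsSmoothPoint X x →
    embeddedTangentSpace X x = T

end RuledVariety

end

/-! Let `Λ` be a nonsingular member of `B` and `v ∈ Λ̂` nonzero. The preimage in `V` of the image of
`χ(Λ)` at `v` (`tangentHull`) has dimension at most `n + k + 1`, with equality exactly when `v` is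
not focal. It lies in the tangent space at `v` of the cone over `X`, because points of the members
trace out `X` (`tangentHull_le`). So both properties are compared with a third one: for a nonfocal
`v₀`, the images of `χ(Λ)` at all `v` lie in the image at `v₀`.

Constant tangent space and fixed image. If the tangent space along a general `Λ` is a fixed `T`,
then `T` contains all the hulls along `Λ`, by density of the smooth points. A vector outside the
image at `v₀` would give `n + k + 2` independent vectors. These persist on nearby members, hence on
a general one, where `T` has only dimension `n + k + 1` (`range_le_of_tangentConstantAlong`).
Conversely, if the image is fixed, the hull at `v₀` is tangent to the cone at every nonfocal point
of `Λ`, hence by density at every point of `Λ`, and it fills the tangent space at smooth points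
(`tangentConstantAlong_of_range_le`).

Fixed image and hypersurface. If the image is fixed, `χ(Λ)` is an `n × n` matrix of linear forms
followed by a constant map, so all maximal minors are multiples of one determinant
(`focalHypersurface_of_range_le`). Conversely, if the focal scheme is given by a form `F` of degree
`n` and `k > 0`, each maximal minor is a scalar times `F`. Replacing one functional by some `ψ` that
kills the image at `v₀` gives a minor vanishing at `v₀`, where `F` does not vanish, so this minor is
zero. Cramer's rule then shows that `ψ` kills every image (`range_le_of_focalHypersurface`). For `k
= 0` constancy along a point is trivial.

A nonsingular member with a nonfocal point exists by generic smoothness of the map from frames to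
the cone (`exists_not_allFocal`). This, and the comparison of Krull dimensions with tangent
dimensions, use characteristic zero: derivations extend along finitely generated field extensions.
-/

noncomputable section

namespace RuledVariety

open MvPolynomial Matrix

/-! ### Rank conditions expressed by nonvanishing determinants -/

section LinearAlgebra

variable {F : Type*} [Field F] {σ ι : Type*} [Fintype σ]

/-- The vectors orthogonal to all members of `S` for the dot product. -/
def perp (S : Set (σ → F)) : Submodule F (σ → F) where
  carrier := {w | ∀ a ∈ S, a ⬝ᵥ w = 0}
  add_mem' := by
    intro v w hv hw a ha
    rw [dotProduct_add, hv a ha, hw a ha, add_zero]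
  zero_mem' := fun a _ => dotProduct_zero a
  smul_mem' := by
    intro c w hw a ha
    rw [dotProduct_smul, hw a ha, smul_zero]

theorem mem_perp {S : Set (σ → F)} {w : σ → F} : w ∈ perp S ↔ ∀ a ∈ S, a ⬝ᵥ w = 0 := Iff.rfl

theorem perp_anti {S T : Set (σ → F)} (h : S ⊆ T) : perp T ≤ perp S :=
  fun _ hw a ha => hw a (h ha)

theorem perp_span (S : Set (σ → F)) : perp (Submodule.span F S : Set (σ → F)) = perp S := by
  refine le_antisymm (perp_anti Submodule.subset_span) fun w hw a ha => ?_
  induction ha using Submodule.span_induction with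
  | mem a ha => exact hw a ha
  | zero => exact zero_dotProduct w
  | add a b _ _ ha hb => rw [add_dotProduct, ha, hb, add_zero]
  | smul c a _ ha => rw [smul_dotProduct, ha, smul_zero]

theorem finrank_perp_range [Fintype ι] (f : ι → σ → F) (hf : LinearIndependent F f) :
    Fintype.card ι + Module.finrank F (perp (Set.range f)) = Fintype.card σ := by
  have h1 : perp (Set.range f) = LinearMap.ker (Matrix.of f).mulVecLin := by
    ext w
    simp only [mem_perp, Set.forall_mem_range, LinearMap.mem_ker, Matrix.mulVecLin_apply]
    exact ⟨fun h => funext h, fun h i => congrFun h i⟩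
  have h2 := LinearMap.finrank_range_add_finrank_ker (Matrix.of f).mulVecLin
  have h3 : (Matrix.of f).rank = Fintype.card ι := LinearIndependent.rank_matrix (M := Matrix.of f) hf
  rw [Module.finrank_fintype_fun_eq_card] at h2
  rw [h1, ← h3, Matrix.rank]
  exact h2

/-- A family with independent members among `S` that cuts out the same subspace as `S`. -/
theorem exists_linearIndependent_perp (S : Set (σ → F)) :
    ∃ (r : ℕ) (f : Fin r → σ → F), (∀ i, f i ∈ S) ∧ LinearIndependent F f ∧
      perp (Set.range f) = perp S := by
  obtain ⟨f, hfS, hspan, hf⟩ := Submodule.exists_fun_fin_finrank_span_eq F S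
  exact ⟨_, f, hfS, hf, by rw [← perp_span (Set.range f), hspan, perp_span]⟩

/-- Independence of rows is recorded throughout by a matrix `R` with `det (J * R) ≠ 0`, rather than
by a chosen minor. When `J` varies with a point, this determinant defines the open set on which
independence persists, by the converse lemma that follows. -/
theorem exists_mul_eq_one_of_linearIndependent_rows [Fintype ι] [DecidableEq ι]
    (J : Matrix ι σ F) (hJ : LinearIndependent F J.row) :
    ∃ R : Matrix σ ι F, J * R = 1 := by
  classical
  have h : Function.Surjective J.mulVec := by
    have hr : J.rank = Fintype.card ι := LinearIndependent.rank_matrix hJ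
    have : LinearMap.range J.mulVecLin = ⊤ := by
      apply Submodule.eq_top_of_finrank_eq
      rw [Module.finrank_fintype_fun_eq_card, ← hr, Matrix.rank]
    exact LinearMap.range_eq_top.1 this
  exact Matrix.mulVec_surjective_iff_exists_right_inverse.1 h

theorem linearIndependent_rows_of_det_mul_ne_zero [Fintype ι] [DecidableEq ι]
    (J : Matrix ι σ F) (R : Matrix σ ι F) (h : (J * R).det ≠ 0) :
    LinearIndependent F J.row := by
  rw [← Matrix.vecMul_injective_iff]
  intro v w hvw
  have : v ᵥ* (J * R) = w ᵥ* (J * R) := by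
    rw [← Matrix.vecMul_vecMul, ← Matrix.vecMul_vecMul]
    exact congrArg (· ᵥ* R) hvw
  exact Matrix.vecMul_injective_of_isUnit ((Matrix.isUnit_iff_isUnit_det _).2 (isUnit_iff_ne_zero.2 h)) this

end LinearAlgebra

/-! ### Gradients, tangent spaces and their semicontinuity -/

section Differential

variable {K : Type*} [Field K] {σ τ : Type*}

/-- The gradient at an `L`-valued point `x` of a polynomial with coefficients in `K`. -/
def grad {L : Type*} [Field L] [Algebra K L] (x : σ → L) (P : MvPolynomial σ K) : σ → L :=
  fun i => aeval x (pderiv i P)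

variable {L : Type*} [Field L] [Algebra K L]

open TrivSqZeroExt in
/-- First order Taylor expansion. -/
theorem aeval_inl_add_inr [Fintype σ] (x w : σ → L) (P : MvPolynomial σ K) :
    aeval (fun i => (inl (x i) + inr (w i) : TrivSqZeroExt L L)) P
      = inl (aeval x P) + inr (grad x P ⬝ᵥ w) := by
  classical
  induction P using MvPolynomial.induction_on with
  | C a =>
    simp only [MvPolynomial.aeval_C, grad, pderiv_C, map_zero, dotProduct, zero_mul,
      Finset.sum_const_zero, inr_zero, add_zero]
    rfl
  | add P Q hP hQ =>
    have : grad x (P + Q) = grad x P + grad x Q := by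
      funext i
      simp [grad]
    rw [map_add, hP, hQ, this, add_dotProduct, map_add, inl_add, inr_add]
    abel
  | mul_X P j hP =>
    have : grad x (P * X j) ⬝ᵥ w = aeval x P * w j + x j * (grad x P ⬝ᵥ w) := by
      have h : grad x (P * X j) = aeval x P • Pi.single j 1 + x j • grad x P := by
        funext i
        simp only [grad, Derivation.leibniz, pderiv_X, smul_eq_mul, map_add, map_mul,
          MvPolynomial.aeval_X, Pi.add_apply, Pi.smul_apply, Pi.single_apply]
        congr 2
        rcases eq_or_ne i j with h | h
        · subst h; simp
        · simp [h, h.symm]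
      rw [h, add_dotProduct, smul_dotProduct, smul_dotProduct, single_dotProduct, one_mul]
      rfl
    rw [map_mul, hP, this, MvPolynomial.aeval_X]
    ext <;> simp [mul_comm]
    ring

/-- The linearised zeros at an `L`-valued point of a set of polynomials. -/
def tangentAt [Fintype σ] (I : Set (MvPolynomial σ K)) (x : σ → L) : Submodule L (σ → L) :=
  perp (grad x '' I)

theorem mem_tangentAt [Fintype σ] {I : Set (MvPolynomial σ K)} {x w : σ → L} :
    w ∈ tangentAt I x ↔ ∀ P ∈ I, grad x P ⬝ᵥ w = 0 := by
  simp [tangentAt, mem_perp]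

theorem tangentSpace_eq_tangentAt [Fintype σ] (C : Set (σ → K)) (x : σ → K) :
    tangentSpace C x = tangentAt (vanishingIdeal K C : Set (MvPolynomial σ K)) x := by
  ext w
  rw [mem_tangentAt]
  rfl

theorem mem_tangentSpace [Fintype σ] {C : Set (σ → K)} {x w : σ → K} :
    w ∈ tangentSpace C x ↔ ∀ P ∈ vanishingIdeal K C, grad x P ⬝ᵥ w = 0 := by
  rw [tangentSpace_eq_tangentAt, mem_tangentAt]
  rfl

theorem mem_vanishingIdeal_iff_eval {C : Set (σ → K)} {P : MvPolynomial σ K} :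
    P ∈ vanishingIdeal K C ↔ ∀ x ∈ C, eval x P = 0 := by
  rfl

/-- The differential at `x` of the polynomial map with components `φ`. -/
def diffMap [Fintype σ] (φ : τ → MvPolynomial σ K) (x : σ → L) : (σ → L) →ₗ[L] (τ → L) where
  toFun w := fun j => grad x (φ j) ⬝ᵥ w
  map_add' _ _ := funext fun _ => dotProduct_add _ _ _
  map_smul' _ _ := funext fun _ => dotProduct_smul _ _ _

theorem diffMap_apply [Fintype σ] (φ : τ → MvPolynomial σ K) (x w : σ → L) (j : τ) :
    diffMap φ x w j = grad x (φ j) ⬝ᵥ w := rfl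

/-- The chain rule. -/
theorem grad_bind₁ [Fintype σ] [Fintype τ] (φ : τ → MvPolynomial σ K) (x w : σ → L)
    (Q : MvPolynomial τ K) :
    grad x (bind₁ φ Q) ⬝ᵥ w = grad (fun j => aeval x (φ j)) Q ⬝ᵥ diffMap φ x w := by
  -- Evaluate the composite at `x + εw` in two ways and compare the coefficients of `ε`.
  have h := aeval_inl_add_inr x w (bind₁ φ Q)
  rw [aeval_bind₁] at h
  simp only [aeval_inl_add_inr] at h
  have h2 := congrArg TrivSqZeroExt.snd h
  have h3 : (diffMap φ x w) = fun j => grad x (φ j) ⬝ᵥ w := rfl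
  rw [h3]
  simpa using h2.symm

/-- Differentials of polynomial maps preserve tangent vectors. -/
theorem diffMap_mem_tangentSpace [Fintype σ] [Fintype τ] {C : Set (σ → K)} {D : Set (τ → K)}
    (φ : τ → MvPolynomial σ K) (hφ : ∀ x ∈ C, (fun j => eval x (φ j)) ∈ D) {x w : σ → K}
    (hw : w ∈ tangentSpace C x) :
    diffMap φ x w ∈ tangentSpace D (fun j => eval x (φ j)) := by
  rw [mem_tangentSpace] at hw ⊢
  intro Q hQ
  refine (grad_bind₁ φ x w Q).symm.trans ?_
  refine hw _ fun y hy => ?_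
  have h' := hQ _ (hφ y hy)
  rwa [aeval_bind₁]

/-- Polynomials which agree along a line have the same derivative along it. -/
theorem grad_dotProduct_congr [Fintype σ] [Infinite K] {P Q : MvPolynomial σ K} {x w : σ → K}
    (h : ∀ t : K, eval (x + t • w) P = eval (x + t • w) Q) :
    grad x P ⬝ᵥ w = grad x Q ⬝ᵥ w := by
  let φ : σ → MvPolynomial Unit K := fun i => C (x i) + C (w i) * X ()
  have hφ : ∀ s : Unit → K, (fun j => eval s (φ j)) = x + s () • w := by
    intro s
    funext j
    simp [φ, mul_comm]
  have hPQ : bind₁ φ P = bind₁ φ Q := by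
    apply MvPolynomial.funext
    intro s
    have e : ∀ R : MvPolynomial σ K, eval s (bind₁ φ R) = eval (fun j => eval s (φ j)) R := by
      intro R
      have := aeval_bind₁ (R := K) (f := s) φ R
      simpa [MvPolynomial.coe_aeval_eq_eval] using this
    rw [e, e, hφ]
    exact h _
  have hd : diffMap φ (0 : Unit → K) (fun _ => 1) = w := by
    funext j
    simp [diffMap_apply, grad, φ, dotProduct]
  have h0 : (fun j => aeval (0 : Unit → K) (φ j)) = x := by
    funext j
    simp [φ]
  have hP := grad_bind₁ φ (0 : Unit → K) (fun _ => 1) P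
  have hQ := grad_bind₁ φ (0 : Unit → K) (fun _ => 1) Q
  rw [hd, h0] at hP hQ
  rw [← hP, ← hQ, hPQ]

/-- Semicontinuity of the dimension of the tangent space, and local extension of tangent vectors to
tangent polynomial vector fields. -/
theorem exists_local_extension [Fintype σ] (C : Set (σ → K)) (x₀ : σ → K) :
    ∃ D : MvPolynomial σ K, eval x₀ D ≠ 0 ∧
      (∀ x, eval x D ≠ 0 →
        Module.finrank K (tangentSpace C x) ≤ Module.finrank K (tangentSpace C x₀)) ∧
      ∀ w ∈ tangentSpace C x₀, ∃ W : σ → MvPolynomial σ K, (∀ i, eval x₀ (W i) = w i) ∧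
        ∀ x, eval x D ≠ 0 →
          Module.finrank K (tangentSpace C x₀) ≤ Module.finrank K (tangentSpace C x) →
          (fun i => eval x (W i)) ∈ tangentSpace C x := by
  classical
  obtain ⟨r, f, hfS, hf, hperp⟩ := exists_linearIndependent_perp
    (grad x₀ '' (vanishingIdeal K C : Set (MvPolynomial σ K)))
  choose P hP hPf using hfS
  let J : Matrix (Fin r) σ (MvPolynomial σ K) := Matrix.of fun i j => pderiv j (P i)
  have hJ : ∀ x : σ → K, J.map (eval x) = Matrix.of fun i => grad x (P i) := fun x => rfl
  have hJ₀ : J.map (eval x₀) = Matrix.of f := by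
    rw [hJ]
    ext i j
    exact congrFun (hPf i) j
  have hle : ∀ x : σ → K, tangentSpace C x ≤ perp (Set.range fun i => grad x (P i)) := by
    intro x
    rw [tangentSpace_eq_tangentAt]
    apply perp_anti
    rintro _ ⟨i, rfl⟩
    exact ⟨P i, hP i, rfl⟩
  obtain ⟨R, hR⟩ := exists_mul_eq_one_of_linearIndependent_rows (Matrix.of f) hf
  let R' : Matrix σ (Fin r) (MvPolynomial σ K) := R.map MvPolynomial.C
  have hR' : ∀ x : σ → K, R'.map (eval x) = R := by
    intro x
    ext i j
    simp [R']
  -- Where `D` does not vanish, the `r` chosen gradients stay independent, which bounds the tangent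
  -- space from above.
  let D := (J * R').det
  have hD : ∀ x, eval x D = (Matrix.of (fun i => grad x (P i)) * R).det := by
    intro x
    rw [← hJ, ← hR' x, ← Matrix.map_mul, RingHom.map_det]
    rfl
  have hfin₀ : r + Module.finrank K (tangentSpace C x₀) = Fintype.card σ := by
    have := finrank_perp_range f hf
    rw [Fintype.card_fin, hperp] at this
    rw [tangentSpace_eq_tangentAt]
    exact this
  have hfin : ∀ x, eval x D ≠ 0 →
      r + Module.finrank K (perp (Set.range fun i => grad x (P i))) = Fintype.card σ := by
    intro x hx
    rw [hD] at hx
    have := finrank_perp_range _ (linearIndependent_rows_of_det_mul_ne_zero _ _ hx)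
    rwa [Fintype.card_fin] at this
  refine ⟨D, ?_, fun x hx => ?_, fun w hw => ?_⟩
  · rw [hD, ← hJ, hJ₀, hR, det_one]
    exact one_ne_zero
  · have h1 := hfin x hx
    have h2 := Submodule.finrank_mono (hle x)
    omega
  · let w' : σ → MvPolynomial σ K := fun i => MvPolynomial.C (w i)
    -- The projection of `w'` to the kernel of `J` along the columns of `R'`, multiplied by `D` to
    -- make it polynomial. At `x₀` the correction vanishes and `D` is `1`.
    let W : σ → MvPolynomial σ K := D • w' - R' *ᵥ ((J * R').adjugate *ᵥ (J *ᵥ w'))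
    have hJW : J *ᵥ W = 0 := by
      simp only [W]
      rw [Matrix.mulVec_sub, Matrix.mulVec_smul, Matrix.mulVec_mulVec, Matrix.mulVec_mulVec,
        Matrix.mul_adjugate, Matrix.smul_mulVec, Matrix.one_mulVec, sub_self]
    refine ⟨W, fun i => ?_, fun x hx hge => ?_⟩
    · have hw' : (eval x₀) ∘ w' = w := by
        funext i
        simp [w']
      have h1 : (eval x₀) ∘ (J *ᵥ w') = 0 := by
        funext i
        rw [Function.comp_apply, RingHom.map_mulVec, hJ₀, hw']
        rw [tangentSpace_eq_tangentAt, tangentAt, ← hperp] at hw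
        exact hw _ ⟨i, rfl⟩
      have h2 : eval x₀ ((R' *ᵥ ((J * R').adjugate *ᵥ (J *ᵥ w'))) i) = 0 := by
        rw [Matrix.mulVec_mulVec, RingHom.map_mulVec, h1, Matrix.mulVec_zero]
        rfl
      have h3 : eval x₀ D = 1 := by rw [hD, ← hJ, hJ₀, hR, det_one]
      simp only [W, Pi.sub_apply, map_sub, h2, Pi.smul_apply, smul_eq_mul, map_mul, h3, w', eval_C,
        one_mul, sub_zero]
    · have heq : tangentSpace C x = perp (Set.range fun i => grad x (P i)) := by
        apply Submodule.eq_of_le_of_finrank_le (hle x)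
        have h1 := hfin x hx
        omega
      rw [heq]
      rintro _ ⟨i, rfl⟩
      have := congrArg (eval x) (congrFun hJW i)
      rw [RingHom.map_mulVec, hJ] at this
      exact this.trans (map_zero _)

end Differential

/-! ### First order deformations of field-valued points in characteristic zero -/

section Derivations

open TrivSqZeroExt

/-- A first order deformation of an `L`-valued point of a variety over a field `K` of characteristic
zero extends to a first order automorphism of `L` over `K`. -/
theorem exists_algHom_trivSqZeroExt {K L τ : Type*} [Field K] [CharZero K] [Field L] [Algebra K L]
    [Algebra.EssFiniteType K L] [Fintype τ] (ψ u : τ → L)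
    (hu : ∀ Q : MvPolynomial τ K, aeval ψ Q = 0 → grad ψ Q ⬝ᵥ u = 0) :
    ∃ Φ : L →ₐ[K] TrivSqZeroExt L L, (∀ a, (Φ a).fst = a) ∧
      ∀ j, Φ (ψ j) = inl (ψ j) + inr (u j) := by
  let q : Ideal (MvPolynomial τ K) := RingHom.ker (aeval ψ : MvPolynomial τ K →ₐ[K] L)
  let A := MvPolynomial τ K ⧸ q
  have hqp : q.IsPrime := RingHom.ker_isPrime _
  let E := FractionRing A
  let f : A →ₐ[K] TrivSqZeroExt L L := Ideal.Quotient.liftₐ q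
    (aeval fun i => (inl (ψ i) + inr (u i) : TrivSqZeroExt L L)) (by
      intro P hP
      have hP' : aeval ψ P = 0 := hP
      rw [aeval_inl_add_inr, hP', hu P hP', inl_zero, inr_zero, add_zero])
  have hfst : ∀ P : MvPolynomial τ K, (f (Ideal.Quotient.mk q P)).fst = aeval ψ P := by
    intro P
    have : f (Ideal.Quotient.mk q P)
        = aeval (fun i => (inl (ψ i) + inr (u i) : TrivSqZeroExt L L)) P := rfl
    rw [this, aeval_inl_add_inr]
    simp
  have hunit : ∀ y : nonZeroDivisors A, IsUnit ((f : A →+* TrivSqZeroExt L L) y) := by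
    rintro ⟨y, hy⟩
    obtain ⟨P, rfl⟩ := Ideal.Quotient.mk_surjective y
    rw [isUnit_iff_isUnit_fst]
    change IsUnit (f (Ideal.Quotient.mk q P)).fst
    rw [hfst, isUnit_iff_ne_zero]
    intro h
    exact nonZeroDivisors.ne_zero hy (Ideal.Quotient.eq_zero_iff_mem.2 h)
  -- The deformation sends nonzero elements of the coordinate ring to dual numbers with nonzero
  -- first component, that is to units, so it extends to the fraction field.
  let g : E →+* TrivSqZeroExt L L := IsLocalization.lift hunit
  have hg : ∀ a : A, g (algebraMap A E a) = f a := fun a => IsLocalization.lift_eq hunit a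
  let fstHom : TrivSqZeroExt L L →+* L := (TrivSqZeroExt.fstHom L L L : _ →ₐ[L] L)
  let _ : Algebra E L := (fstHom.comp g).toAlgebra
  let _ : Algebra E (TrivSqZeroExt L L) := g.toAlgebra
  have hK : ∀ c : K, g (algebraMap K E c) = algebraMap K (TrivSqZeroExt L L) c := by
    intro c
    rw [IsScalarTower.algebraMap_apply K A E, hg, AlgHom.commutes]
  have : IsScalarTower K E L := IsScalarTower.of_algebraMap_eq fun c => by
    change _ = fstHom (g (algebraMap K E c))
    rw [hK]
    rfl
  have : CharZero E := charZero_of_injective_algebraMap (algebraMap K E).injective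
  have : Algebra.EssFiniteType E L := Algebra.EssFiniteType.of_comp K E L
  let π : TrivSqZeroExt L L →ₐ[E] L := { fstHom with commutes' := fun _ => rfl }
  have hπ : ∀ x, π x = x.fst := fun _ => rfl
  have hsurj : Function.Surjective π := fun x => ⟨inl x, by rw [hπ, fst_inl]⟩
  have hnil : IsNilpotent (RingHom.ker (π : TrivSqZeroExt L L →+* L)) := by
    refine ⟨2, (pow_two (RingHom.ker (π : TrivSqZeroExt L L →+* L))).trans ?_⟩
    rw [Ideal.zero_eq_bot, eq_bot_iff, Ideal.mul_le]
    intro x hx y hy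
    have hx' : x.fst = 0 := hx
    have hy' : y.fst = 0 := hy
    rw [Ideal.mem_bot]
    ext <;> simp [hx', hy']
  -- `L` is essentially of finite type over the field `E` of characteristic zero, hence formally
  -- smooth. The identity of `L` therefore lifts through the square-zero extension, on which `E`
  -- acts by `g`.
  let Φ := Algebra.FormallySmooth.liftOfSurjective (AlgHom.id E L) π hsurj hnil
  have hΦfst : ∀ a, (Φ a).fst = a := fun a =>
    Algebra.FormallySmooth.liftOfSurjective_apply (AlgHom.id E L) π hsurj hnil a
  have hΦ : ∀ P : MvPolynomial τ K, Φ (aeval ψ P) = f (Ideal.Quotient.mk q P) := by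
    intro P
    have h1 : aeval ψ P = algebraMap E L (algebraMap A E (Ideal.Quotient.mk q P)) := by
      change _ = fstHom (g _)
      rw [hg]
      exact (hfst P).symm
    rw [h1, Φ.commutes]
    exact hg _
  refine ⟨{ (Φ : L →+* TrivSqZeroExt L L) with commutes' := fun c => ?_ }, hΦfst, fun j => ?_⟩
  · have := hΦ (C c)
    rw [MvPolynomial.aeval_C] at this
    change Φ (algebraMap K L c) = _
    rw [this]
    exact f.commutes c
  · have := hΦ (X j)
    rw [MvPolynomial.aeval_X] at this
    change Φ (ψ j) = _
    rw [this]
    exact MvPolynomial.aeval_X _ _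

/-- In characteristic zero a first order deformation which is trivial on a subring is trivial on its
integral closure. -/
theorem snd_eq_zero_of_isIntegral {S A L : Type*} [CommRing S] [IsDomain S] [CommRing A]
    [Field L] [CharZero L] (g : S →+* A) (ι : A →+* L) (hg : Function.Injective g)
    (hι : Function.Injective ι) (f : A →+* TrivSqZeroExt L L)
    (hfst : ∀ a, (f a).fst = ι a) (hf : ∀ s, f (g s) = inl (ι (g s))) (a : A)
    (ha : g.IsIntegralElem a) : (f a).snd = 0 := by
  classical
  let _ : Algebra S L := (ι.comp g).toAlgebra
  have hinj : Function.Injective (algebraMap S L) := hι.comp hg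
  obtain ⟨m₀, hm₀, hm₀a⟩ := ha
  -- Take `m` of least degree among the nonzero polynomials killing `a`, monic or not. By minimality
  -- the derivative of `m` does not vanish at `a`, and the `ε`-part of `m (f a) = 0` is that
  -- derivative times `(f a).snd`.
  let T : Set (Polynomial S) := {m | m ≠ 0 ∧ m.eval₂ g a = 0}
  have hT : ∃ d, ∃ m ∈ T, m.natDegree = d := by
    refine ⟨_, m₀, ⟨?_, hm₀a⟩, rfl⟩
    rintro rfl
    have h0 := hm₀.leadingCoeff
    rw [Polynomial.leadingCoeff_zero] at h0
    exact zero_ne_one h0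
  obtain ⟨m, ⟨hm, hma⟩, hmd⟩ := Nat.find_spec hT
  have hmin : ∀ m' ∈ T, m.natDegree ≤ m'.natDegree := fun m' hm' => by
    rw [hmd]
    exact Nat.find_min' hT ⟨m', hm', rfl⟩
  have hS : CharZero S := by
    refine ⟨fun x y hxy => ?_⟩
    have := congrArg (algebraMap S L) hxy
    simpa using this
  have hdeg : m.natDegree ≠ 0 := by
    intro h0
    rw [Polynomial.eq_C_of_natDegree_eq_zero h0, Polynomial.eval₂_C] at hma
    have h1 : m.coeff 0 = 0 := (map_eq_zero_iff _ hg).1 hma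
    rw [Polynomial.eq_C_of_natDegree_eq_zero h0, h1] at hm
    simp at hm
  have hd : m.derivative.eval₂ g a ≠ 0 := by
    intro h0
    have hne : m.derivative ≠ 0 := fun h => hdeg (Polynomial.derivative_eq_zero.1 h)
    have := hmin _ ⟨hne, h0⟩
    have := Polynomial.natDegree_derivative_lt hdeg
    omega
  have hd' : Polynomial.aeval (ι a) m.derivative ≠ 0 := by
    intro h0
    apply hd
    apply hι
    rw [Polynomial.hom_eval₂, map_zero]
    exact h0
  have hring : f.comp g = algebraMap S (TrivSqZeroExt L L) := by
    ext1 s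
    rw [RingHom.comp_apply, hf]
    rfl
  have hzero : Polynomial.aeval (f a) m = 0 := by
    rw [Polynomial.aeval_def, ← hring, ← Polynomial.hom_eval₂, hma, map_zero]
  have hfa : f a = inl (ι a) + inr (f a).snd := by
    ext <;> simp [hfst]
  have hin : ∀ p : Polynomial S, Polynomial.aeval (inl (ι a) : TrivSqZeroExt L L) p
      = inl (Polynomial.aeval (ι a) p) := fun p =>
    Polynomial.aeval_algebraMap_apply (TrivSqZeroExt L L) (ι a) p
  rw [hfa, Polynomial.aeval_add_of_sq_eq_zero _ _ _ (by rw [pow_two, inr_mul_inr]), hin, hin]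
    at hzero
  have h2 := congrArg TrivSqZeroExt.snd hzero
  simp only [snd_add, snd_inl, zero_add, snd_mul, fst_inl, snd_inr, smul_eq_mul, fst_inr,
    MulOpposite.op_zero, snd_zero, smul_zero, add_zero] at h2
  exact (mul_eq_zero.1 h2).resolve_left hd'

end Derivations

/-! ### Krull dimension as the dimension of the tangent space at the generic point -/

theorem ringKrullDim_eq_of_isIntegral {S A : Type*} [CommRing S] [CommRing A] [IsDomain A]
    [Algebra S A] [Algebra.IsIntegral S A] (h : Function.Injective (algebraMap S A)) :
    ringKrullDim A = ringKrullDim S := by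
  apply le_antisymm
  -- Incomparability of primes with the same contraction.
  · refine Order.krullDim_le_of_strictMono (PrimeSpectrum.comap (algebraMap S A)) fun P Q hPQ => ?_
    exact Ideal.IsIntegral.comap_lt_comap (I := P.asIdeal) (J := Q.asIdeal) hPQ
  -- Lying over for the smallest prime of the chain, then going up.
  · refine iSup_le fun l => ?_
    obtain ⟨P, hP, hPl⟩ := Ideal.exists_ideal_over_prime_of_isIntegral_of_isDomain (S := A)
      l.head.asIdeal (by rw [(RingHom.injective_iff_ker_eq_bot _).1 h]; exact bot_le)
    have : P.LiesOver l.head.asIdeal := ⟨hPl.symm⟩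
    obtain ⟨l', hl', -⟩ := Ideal.exists_ltSeries_of_hasGoingUp l P
    rw [← hl']
    exact Order.LTSeries.length_le_krullDim l'

/-- The Krull dimension of an affine variety in characteristic zero is the dimension of the tangent
space at the generic point. -/
theorem exists_ringKrullDim_eq_finrank_tangentAt {K σ : Type*} [Field K] [CharZero K] [Fintype σ]
    (p : Ideal (MvPolynomial σ K)) [hp : p.IsPrime] :
    ∃ e : ℕ, ringKrullDim (MvPolynomial σ K ⧸ p) = e ∧
      ∀ (L : Type*) [Field L] [Algebra K L] [Algebra.EssFiniteType K L] (ψ : σ → L),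
        (∀ P : MvPolynomial σ K, aeval ψ P = 0 ↔ P ∈ p) →
          Module.finrank L (tangentAt (p : Set (MvPolynomial σ K)) ψ) = e := by
  obtain ⟨e, g, hg, hint⟩ := exists_integral_inj_algHom_of_fg K (MvPolynomial σ K ⧸ p)
  refine ⟨e, ?_, ?_⟩
  · let _ : Algebra (MvPolynomial (Fin e) K) (MvPolynomial σ K ⧸ p) := g.toRingHom.toAlgebra
    have : Algebra.IsIntegral (MvPolynomial (Fin e) K) (MvPolynomial σ K ⧸ p) := ⟨hint⟩
    rw [ringKrullDim_eq_of_isIntegral (S := MvPolynomial (Fin e) K) (A := MvPolynomial σ K ⧸ p) hg,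
      MvPolynomial.ringKrullDim_of_isNoetherianRing, ringKrullDim_eq_zero_of_field]
    simp
  intro L _ _ _ ψ hψ
  have : CharZero L := charZero_of_injective_algebraMap (algebraMap K L).injective
  let ι : (MvPolynomial σ K ⧸ p) →ₐ[K] L := Ideal.Quotient.liftₐ p (aeval ψ) fun P hP =>
    (hψ P).2 hP
  have hιmk : ∀ P, ι (Ideal.Quotient.mk p P) = aeval ψ P := fun P => rfl
  have hι : Function.Injective ι := by
    rw [injective_iff_map_eq_zero]
    intro a ha
    obtain ⟨P, rfl⟩ := Ideal.Quotient.mk_surjective a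
    exact Ideal.Quotient.eq_zero_iff_mem.2 ((hψ P).1 ha)
  choose G hG using fun j : Fin e => Ideal.Quotient.mk_surjective (g (X j))
  have hy : ∀ Q : MvPolynomial (Fin e) K, aeval (fun j => aeval ψ (G j)) Q = ι (g Q) := by
    intro Q
    have : (aeval (fun j => aeval ψ (G j)) : MvPolynomial (Fin e) K →ₐ[K] L) = ι.comp g := by
      ext j
      rw [MvPolynomial.aeval_X, AlgHom.comp_apply, ← hG, hιmk]
    rw [this]
    rfl
  -- The differential of the Noether normalisation at the generic point. It is injective because a
  -- deformation trivial on the polynomial subring is trivial on its integral extension. It is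
  -- surjective because the `e` coordinates are algebraically independent, so every direction in
  -- `L^e` is admissible and extends to a derivation of `L`.
  let T : tangentAt (p : Set (MvPolynomial σ K)) ψ →ₗ[L] (Fin e → L) :=
    (diffMap G ψ).comp (Submodule.subtype _)
  have hT : Function.Bijective T := by
    constructor
    · rw [← LinearMap.ker_eq_bot, LinearMap.ker_eq_bot']
      rintro ⟨w, hw⟩ hw0
      rw [mem_tangentAt] at hw
      have hw0' : ∀ j, grad ψ (G j) ⬝ᵥ w = 0 := fun j => congrFun hw0 j
      let f : (MvPolynomial σ K ⧸ p) →ₐ[K] TrivSqZeroExt L L := Ideal.Quotient.liftₐ p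
        (aeval fun i => (TrivSqZeroExt.inl (ψ i) + TrivSqZeroExt.inr (w i) : TrivSqZeroExt L L))
        fun P hP => by
          rw [aeval_inl_add_inr, hw P hP, (hψ P).2 hP]
          simp
      have hfmk : ∀ P, f (Ideal.Quotient.mk p P)
          = TrivSqZeroExt.inl (aeval ψ P) + TrivSqZeroExt.inr (grad ψ P ⬝ᵥ w) := fun P =>
        aeval_inl_add_inr ψ w P
      have hfg : f.comp g = (TrivSqZeroExt.inlAlgHom K L L).comp (ι.comp g) := by
        ext1 j
        simp only [AlgHom.comp_apply]
        rw [← hG, hfmk, hw0', hιmk]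
        simp
      have h0 : ∀ a, (f a).snd = 0 := fun a =>
        snd_eq_zero_of_isIntegral (g : _ →+* _) (ι : _ →+* L) hg hι (f : _ →+* _)
          (fun a => by
            obtain ⟨P, rfl⟩ := Ideal.Quotient.mk_surjective a
            change (f (Ideal.Quotient.mk p P)).fst = ι (Ideal.Quotient.mk p P)
            rw [hfmk, hιmk]
            simp)
          (fun s => DFunLike.congr_fun hfg s) a (hint a)
      ext i
      have h1 : f (Ideal.Quotient.mk p (X i))
          = TrivSqZeroExt.inl (ψ i) + TrivSqZeroExt.inr (w i) := MvPolynomial.aeval_X _ _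
      have h2 := h0 (Ideal.Quotient.mk p (X i))
      rw [h1] at h2
      simpa using h2
    · intro u
      obtain ⟨Φ, hΦ, hΦu⟩ := exists_algHom_trivSqZeroExt (K := K) (fun j => aeval ψ (G j)) u
        fun Q hQ => by
          rw [hy] at hQ
          have hQ0 : Q = 0 := hg ((map_eq_zero_iff _ hι).1 hQ |>.trans (map_zero g).symm)
          subst hQ0
          have : grad (fun j => aeval ψ (G j)) (0 : MvPolynomial (Fin e) K) = 0 := by
            funext i
            simp [grad]
          rw [this, zero_dotProduct]
      let w : σ → L := fun i => (Φ (ψ i)).snd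
      have hsnd : ∀ P : MvPolynomial σ K, (Φ (aeval ψ P)).snd = grad ψ P ⬝ᵥ w := by
        intro P
        have h1 : ∀ i, Φ (ψ i) = TrivSqZeroExt.inl (ψ i) + TrivSqZeroExt.inr (w i) := by
          intro i
          ext <;> simp [hΦ, w]
        have h2 : Φ (aeval ψ P) = aeval (fun i => Φ (ψ i)) P := by
          rw [← AlgHom.comp_apply, MvPolynomial.comp_aeval]
        rw [h2]
        simp only [h1]
        rw [aeval_inl_add_inr]
        simp
      refine ⟨⟨w, ?_⟩, ?_⟩
      · rw [mem_tangentAt]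
        intro P hP
        rw [← hsnd, (hψ P).2 hP, map_zero, TrivSqZeroExt.snd_zero]
      · funext j
        change grad ψ (G j) ⬝ᵥ w = u j
        rw [← hsnd, hΦu]
        simp
  rw [(LinearEquiv.ofBijective T hT).finrank_eq, Module.finrank_fintype_fun_eq_card,
    Fintype.card_fin]

/-! ### The generic point of an affine variety -/

section Generic

variable {K σ τ : Type*} [Field K]

/-- The generic point of the affine variety with prime ideal `p`. -/
def genericPoint (p : Ideal (MvPolynomial σ K)) (i : σ) : FractionRing (MvPolynomial σ K ⧸ p) :=
  algebraMap _ _ (Ideal.Quotient.mk p (X i))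

variable (p : Ideal (MvPolynomial σ K))

theorem aeval_genericPoint (P : MvPolynomial σ K) :
    aeval (genericPoint p) P = algebraMap (MvPolynomial σ K ⧸ p)
      (FractionRing (MvPolynomial σ K ⧸ p)) (Ideal.Quotient.mk p P) := by
  have : (aeval (genericPoint p) : MvPolynomial σ K →ₐ[K] FractionRing (MvPolynomial σ K ⧸ p))
      = (IsScalarTower.toAlgHom K _ _).comp (Ideal.Quotient.mkₐ K p) := by
    ext i
    rw [MvPolynomial.aeval_X]
    rfl
  rw [this]
  rfl

theorem aeval_genericPoint_eq_zero_iff (P : MvPolynomial σ K) :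
    aeval (genericPoint p) P = 0 ↔ P ∈ p := by
  rw [aeval_genericPoint, map_eq_zero_iff _ (IsFractionRing.injective _ _),
    Ideal.Quotient.eq_zero_iff_mem]

variable [hp : p.IsPrime]

/-- Common denominators at the generic point. -/
theorem exists_common_denominator {ι : Type*} [Finite ι]
    (v : ι → FractionRing (MvPolynomial σ K ⧸ p)) :
    ∃ c : MvPolynomial σ K, c ∉ p ∧ ∃ V : ι → MvPolynomial σ K,
      ∀ i, aeval (genericPoint p) (V i) = aeval (genericPoint p) c * v i := by
  obtain ⟨⟨b, hb⟩, hbv⟩ := IsLocalization.exist_integer_multiples_of_finite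
    (nonZeroDivisors (MvPolynomial σ K ⧸ p)) v
  obtain ⟨c, rfl⟩ := Ideal.Quotient.mk_surjective b
  choose a ha using hbv
  choose V hV using fun i => Ideal.Quotient.mk_surjective (a i)
  refine ⟨c, fun hc => nonZeroDivisors.ne_zero hb (Ideal.Quotient.eq_zero_iff_mem.2 hc), V,
    fun i => ?_⟩
  rw [aeval_genericPoint, hV, ha, aeval_genericPoint, Algebra.smul_def]

/-- If the rows of a polynomial matrix are independent at the generic point, then they are
independent at all points of an open set. -/
theorem exists_linearIndependent_rows_eval [Fintype σ] [Fintype τ] {r : ℕ}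
    (N : Matrix (Fin r) τ (MvPolynomial σ K))
    (hN : LinearIndependent (FractionRing (MvPolynomial σ K ⧸ p))
      (N.map (aeval (genericPoint p))).row) :
    ∃ Q ∉ p, ∀ x : σ → K, eval x Q ≠ 0 → LinearIndependent K (N.map (eval x)).row := by
  classical
  obtain ⟨R, hR⟩ := exists_mul_eq_one_of_linearIndependent_rows _ hN
  obtain ⟨c, hc, V, hV⟩ := exists_common_denominator p fun i : τ × Fin r => R i.1 i.2
  let R' : Matrix τ (Fin r) (MvPolynomial σ K) := Matrix.of fun i j => V (i, j)
  -- At the generic point `N * R'` is the scalar matrix `c`, so its determinant is a power of `c`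
  -- and not zero.
  refine ⟨(N * R').det, ?_, fun x hx => ?_⟩
  · rw [← aeval_genericPoint_eq_zero_iff, AlgHom.map_det, AlgHom.mapMatrix_apply, Matrix.map_mul]
    have h1 : R'.map (aeval (genericPoint p)) = aeval (genericPoint p) c • R := by
      ext i j
      exact hV (i, j)
    rw [h1, Matrix.mul_smul, hR, Matrix.det_smul, det_one, mul_one]
    exact pow_ne_zero _ (mt (aeval_genericPoint_eq_zero_iff p c).1 hc)
  · rw [RingHom.map_det, RingHom.mapMatrix_apply, Matrix.map_mul] at hx
    exact linearIndependent_rows_of_det_mul_ne_zero _ _ hx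

/-- The `ε`-part of `Φ` is a derivation of `L`, determined on polynomial expressions by its values
on the coordinates. -/
theorem snd_algHom_aeval [Fintype σ] {L : Type*} [Field L] [Algebra K L]
    (Φ : L →ₐ[K] TrivSqZeroExt L L) (hΦ : ∀ a, (Φ a).fst = a) (ψ : σ → L) (P : MvPolynomial σ K) :
    (Φ (aeval ψ P)).snd = grad ψ P ⬝ᵥ fun i => (Φ (ψ i)).snd := by
  have h1 : ∀ i, Φ (ψ i) = TrivSqZeroExt.inl (ψ i) + TrivSqZeroExt.inr (Φ (ψ i)).snd := by
    intro i
    ext <;> simp [hΦ]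
  have h2 : Φ (aeval ψ P) = aeval (fun i => Φ (ψ i)) P := by
    rw [← AlgHom.comp_apply, MvPolynomial.comp_aeval]
  rw [h2]
  conv_lhs => enter [1, 1, 1, i]; rw [h1]
  rw [aeval_inl_add_inr]
  simp

end Generic

/-! ### Dimension, tangent dimension and generic smoothness -/

section Dimension

variable {K σ τ : Type*} [Field K]

/-- The closure of `C ⊆ K^σ` is an irreducible variety of dimension `e`. -/
def HasDim (C : Set (σ → K)) (e : ℕ) : Prop :=
  (vanishingIdeal K C).IsPrime ∧ ringKrullDim (MvPolynomial σ K ⧸ vanishingIdeal K C) = e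

variable [CharZero K] [Fintype σ] [Fintype τ]

theorem exists_hasDim {C : Set (σ → K)} (hC : (vanishingIdeal K C).IsPrime) :
    ∃ e, HasDim C e := by
  obtain ⟨e, he, -⟩ := exists_ringKrullDim_eq_finrank_tangentAt.{_, _, 0} (vanishingIdeal K C)
  exact ⟨e, hC, he⟩

/-- The field `L` is arbitrary because generic smoothness uses a generic point of the target with
values in the function field of the source. -/
theorem HasDim.finrank_tangentAt {C : Set (σ → K)} {e : ℕ} (hC : HasDim C e)
    {L : Type*} [Field L] [Algebra K L] [Algebra.EssFiniteType K L] (ψ : σ → L)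
    (hψ : ∀ P : MvPolynomial σ K, aeval ψ P = 0 ↔ P ∈ vanishingIdeal K C) :
    Module.finrank L (tangentAt (vanishingIdeal K C : Set (MvPolynomial σ K)) ψ) = e := by
  have := hC.1
  obtain ⟨e', he', h⟩ := exists_ringKrullDim_eq_finrank_tangentAt (vanishingIdeal K C)
  have : e' = e := by
    have h2 := he'.symm.trans hC.2
    exact_mod_cast h2
  rw [h L ψ hψ, this]

/-- Finitely many equations with independent gradients cut out the tangent space at the generic
point, and their gradients remain independent on an open set. -/
theorem HasDim.exists_finrank_le {C : Set (σ → K)} {e : ℕ} (hC : HasDim C e) :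
    ∃ Q ∉ vanishingIdeal K C, ∀ x, eval x Q ≠ 0 →
      Module.finrank K (tangentSpace C x) ≤ e := by
  have hp := hC.1
  set p := vanishingIdeal K C with hpdef
  have hfin := hC.finrank_tangentAt (genericPoint p) (aeval_genericPoint_eq_zero_iff p)
  obtain ⟨r, f, hfS, hf, hperp⟩ := exists_linearIndependent_perp
    (grad (genericPoint p) '' (p : Set (MvPolynomial σ K)))
  choose P hP hPf using hfS
  let J : Matrix (Fin r) σ (MvPolynomial σ K) := Matrix.of fun i j => pderiv j (P i)
  obtain ⟨Q, hQ, hQx⟩ := exists_linearIndependent_rows_eval p J (by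
    have : (J.map (aeval (genericPoint p))).row = f := by
      funext i
      rw [← hPf]
      rfl
    rw [this]
    exact hf)
  refine ⟨Q, hQ, fun x hx => ?_⟩
  have h1 := finrank_perp_range _ (hQx x hx)
  have h2 := finrank_perp_range f hf
  rw [hperp] at h2
  rw [tangentAt, ← hpdef] at hfin
  rw [hfin] at h2
  have hle : tangentSpace C x ≤ perp (Set.range (J.map (eval x)).row) := by
    rw [tangentSpace_eq_tangentAt]
    apply perp_anti
    rintro _ ⟨i, rfl⟩
    exact ⟨P i, hP i, rfl⟩
  have h3 := Submodule.finrank_mono hle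
  omega

/-- Generic smoothness: over a general point of `C`, the differential of a dominant map `C → D` has
rank at least `dim D`. -/
theorem HasDim.exists_linearIndependent_diffMap {C : Set (σ → K)} {D : Set (τ → K)} {d : ℕ}
    (hC : (vanishingIdeal K C).IsPrime) (hD : HasDim D d) (φ : τ → MvPolynomial σ K)
    (hφ : ∀ Q, Q ∈ vanishingIdeal K D ↔ bind₁ φ Q ∈ vanishingIdeal K C) :
    ∃ Q ∉ vanishingIdeal K C, ∀ x ∈ C, eval x Q ≠ 0 →
      ∃ W : Fin d → σ → K, (∀ i, W i ∈ tangentSpace C x) ∧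
        LinearIndependent K fun i => diffMap φ x (W i) := by
  set p := vanishingIdeal K C with hpdef
  let ψ := genericPoint p
  have hψ : ∀ P, aeval ψ P = 0 ↔ P ∈ p := aeval_genericPoint_eq_zero_iff p
  let η := fun j => aeval ψ (φ j)
  -- Dominance of `φ`: the generic point of `C` maps to a generic point of `D`.
  have hη : ∀ Q, aeval η Q = 0 ↔ Q ∈ vanishingIdeal K D := by
    intro Q
    rw [hφ, ← hψ, aeval_bind₁]
  have hfin := hD.finrank_tangentAt η hη
  let u := Module.finBasisOfFinrankEq _ _ hfin
  have hu : LinearIndependent _ fun i => (u i).1 :=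
    u.linearIndependent.map' (Submodule.subtype _) (Submodule.ker_subtype _)
  have hut : ∀ i, ∀ Q : MvPolynomial τ K, aeval η Q = 0 → grad η Q ⬝ᵥ (u i).1 = 0 :=
    fun i Q hQ => mem_tangentAt.1 (u i).2 Q ((hη Q).1 hQ)
  -- Each tangent vector `u i` of `D` at `η` extends to a derivation of the function field of `C`.
  -- Its values `w i` on the coordinates are, after clearing denominators, a polynomial vector field
  -- tangent to `C` which maps to a multiple of `u i`.
  choose Φ hΦ hΦu using fun i => exists_algHom_trivSqZeroExt η (u i).1 (hut i)
  let w := fun i s => (Φ i (ψ s)).snd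
  have hw : ∀ i P, grad ψ P ⬝ᵥ w i = (Φ i (aeval ψ P)).snd := fun i P =>
    (snd_algHom_aeval (Φ i) (hΦ i) ψ P).symm
  have hwu : ∀ i j, grad ψ (φ j) ⬝ᵥ w i = (u i).1 j := by
    intro i j
    rw [hw]
    change (Φ i (η j)).snd = _
    rw [hΦu]
    simp
  obtain ⟨c, hc, V, hV⟩ := exists_common_denominator p fun i : Fin d × σ => w i.1 i.2
  let N : Matrix (Fin d) τ (MvPolynomial σ K) :=
    Matrix.of fun i j => ∑ s, pderiv s (φ j) * V (i, s)
  have hsum : ∀ (i : Fin d) (P : MvPolynomial σ K),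
      aeval ψ (∑ s, pderiv s P * V (i, s)) = aeval ψ c * (grad ψ P ⬝ᵥ w i) := by
    intro i P
    rw [map_sum, dotProduct, Finset.mul_sum]
    refine Finset.sum_congr rfl fun s _ => ?_
    rw [map_mul, hV (i, s), grad]
    ring
  have hc0 : aeval ψ c ≠ 0 := mt (hψ c).1 hc
  obtain ⟨Q, hQ, hQx⟩ := exists_linearIndependent_rows_eval p N (by
    have : (N.map (aeval (genericPoint p))).row
        = fun i => (Units.mk0 _ hc0) • (u i).1 := by
      funext i j
      change aeval ψ (∑ s, pderiv s (φ j) * V (i, s)) = aeval ψ c * (u i).1 j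
      rw [hsum, hwu]
    rw [this]
    exact hu.units_smul fun _ => Units.mk0 _ hc0)
  refine ⟨Q, hQ, fun x hx hQ0 => ⟨fun i s => eval x (V (i, s)), fun i => ?_, ?_⟩⟩
  · rw [mem_tangentSpace]
    intro P hP
    have h1 : (∑ s, pderiv s P * V (i, s)) ∈ p := by
      rw [← hψ, hsum, hw, (hψ P).2 hP, map_zero, TrivSqZeroExt.snd_zero, mul_zero]
    have h2 : eval x (∑ s, pderiv s P * V (i, s)) = 0 := h1 x hx
    rw [map_sum] at h2
    simp only [map_mul] at h2
    exact h2
  · convert! hQx x hQ0 using 1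
    funext i j
    change _ = eval x (∑ s, pderiv s (φ j) * V (i, s))
    rw [map_sum]
    simp only [map_mul]
    rfl

/-- The tangent dimension can only drop near `x`, and a general nearby point of `C` has `e`
independent tangent vectors, by generic smoothness of the identity map. -/
theorem HasDim.le_finrank {C : Set (σ → K)} {e : ℕ} (hC : HasDim C e) (x : σ → K) (hx : x ∈ C) :
    e ≤ Module.finrank K (tangentSpace C x) := by
  obtain ⟨D, hD, hDle, -⟩ := exists_local_extension C x
  obtain ⟨Q, hQ, hQx⟩ := HasDim.exists_linearIndependent_diffMap hC.1 hC X fun P => by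
    rw [bind₁_X_left, AlgHom.id_apply]
  have hDI : D ∉ vanishingIdeal K C := fun h => hD (h x hx)
  have hDQ : D * Q ∉ vanishingIdeal K C := fun h => (hC.1.mem_or_mem h).elim hDI hQ
  obtain ⟨y, hy, hyDQ⟩ : ∃ y ∈ C, eval y (D * Q) ≠ 0 := by
    by_contra! h
    exact hDQ fun y hy => h y hy
  rw [map_mul] at hyDQ
  obtain ⟨W, hW, hWind⟩ := hQx y hy (right_ne_zero_of_mul hyDQ)
  refine le_trans ?_ (hDle y (left_ne_zero_of_mul hyDQ))
  have h2 : LinearIndependent K W := LinearIndependent.of_comp (diffMap X y) hWind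
  have h3 : LinearIndependent K fun i => (⟨W i, hW i⟩ : tangentSpace C y) :=
    LinearIndependent.of_comp (Submodule.subtype _) h2
  simpa using h3.fintype_card_le_finrank

theorem HasDim.exists_finrank_eq {C : Set (σ → K)} {e : ℕ} (hC : HasDim C e) :
    ∃ Q ∉ vanishingIdeal K C, ∀ x ∈ C, eval x Q ≠ 0 →
      Module.finrank K (tangentSpace C x) = e := by
  obtain ⟨Q, hQ, hQx⟩ := hC.exists_finrank_le
  exact ⟨Q, hQ, fun x hx hx0 => le_antisymm (hQx x hx0) (hC.le_finrank x hx)⟩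

end Dimension

theorem exists_eval_ne_zero {K σ : Type*} [Field K] {C : Set (σ → K)}
    {P : MvPolynomial σ K}
    (h : P ∉ vanishingIdeal K C) : ∃ x ∈ C, eval x P ≠ 0 := by
  by_contra! h'
  exact h fun x hx => h' x hx

attribute [local instance] zariskiTopology

/-! ### The Zariski topology of affine space and Krull dimension -/

section Zariski

variable {K σ : Type*} [Field K]

theorem isOpen_zariski_iff (O : Set (σ → K)) :
    IsOpen O ↔ ∃ S : Set (MvPolynomial σ K), O = {x | ∃ P ∈ S, eval x P ≠ 0} := by
  rw [← isClosed_compl_iff, isClosed_zariski_iff]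
  refine exists_congr fun S => ?_
  rw [compl_eq_comm, eq_comm]
  have : {x : σ → K | ∀ P ∈ S, eval x P = 0}ᶜ = {x | ∃ P ∈ S, eval x P ≠ 0} := by
    ext x
    simp
  rw [this]

theorem isOpen_eval_ne_zero (P : MvPolynomial σ K) : IsOpen {x : σ → K | eval x P ≠ 0} :=
  (isOpen_zariski_iff _).2 ⟨{P}, by simp⟩

theorem isClosed_zeroLocus (I : Ideal (MvPolynomial σ K)) : IsClosed (zeroLocus K I) :=
  (isClosed_zariski_iff _).2 ⟨I, rfl⟩

theorem zeroLocus_vanishingIdeal_of_isClosed {C : Set (σ → K)} (hC : IsClosed C) :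
    zeroLocus K (vanishingIdeal K C) = C := by
  refine subset_antisymm ?_ (zeroLocus_vanishingIdeal_le C)
  obtain ⟨S, rfl⟩ := (isClosed_zariski_iff _).1 hC
  intro x hx P hP
  exact hx P fun y hy => hy P hP

theorem isPrime_vanishingIdeal_iff {C : Set (σ → K)} :
    (vanishingIdeal K C).IsPrime ↔ IsIrreducible C := by
  constructor
  · intro h
    have hne : C.Nonempty := by
      by_contra h0
      rw [Set.not_nonempty_iff_eq_empty] at h0
      subst h0
      exact h.ne_top (Ideal.eq_top_of_isUnit_mem _ (x := 1) (fun x hx => hx.elim) isUnit_one)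
    refine ⟨hne, ?_⟩
    rintro U V hU hV ⟨x, hxC, hxU⟩ ⟨y, hyC, hyV⟩
    obtain ⟨S, rfl⟩ := (isOpen_zariski_iff _).1 hU
    obtain ⟨T, rfl⟩ := (isOpen_zariski_iff _).1 hV
    obtain ⟨P, hP, hPx⟩ := hxU
    obtain ⟨Q, hQ, hQy⟩ := hyV
    have hPQ : P * Q ∉ vanishingIdeal K C := fun h' =>
      (h.mem_or_mem h').elim (fun h1 => hPx (h1 x hxC)) (fun h1 => hQy (h1 y hyC))
    obtain ⟨z, hz, hz0⟩ := exists_eval_ne_zero hPQ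
    rw [map_mul] at hz0
    exact ⟨z, hz, ⟨P, hP, left_ne_zero_of_mul hz0⟩, ⟨Q, hQ, right_ne_zero_of_mul hz0⟩⟩
  · intro h
    constructor
    · intro htop
      obtain ⟨x, hx⟩ := h.1
      have h1 : (1 : MvPolynomial σ K) ∈ vanishingIdeal K C := by
        rw [htop]
        trivial
      have h2 : eval x (1 : MvPolynomial σ K) = 0 := h1 x hx
      simp at h2
    · intro P Q hPQ
      by_contra! hcon
      obtain ⟨x, hx, hx0⟩ := exists_eval_ne_zero hcon.1
      obtain ⟨y, hy, hy0⟩ := exists_eval_ne_zero hcon.2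
      obtain ⟨z, hz, hzP, hzQ⟩ := h.2 _ _ (isOpen_eval_ne_zero P) (isOpen_eval_ne_zero Q)
        ⟨x, hx, hx0⟩ ⟨y, hy, hy0⟩
      have : eval z (P * Q) = 0 := hPQ z hz
      rw [map_mul] at this
      exact (mul_ne_zero hzP hzQ) this

variable [IsAlgClosed K] [Finite σ]

/-- By the Nullstellensatz, vanishing ideals and zero loci are inverse order-reversing maps between
irreducible closed subsets of `C` and primes above its ideal. Strict monotonicity of each map into
the dual order gives one inequality. -/
theorem topologicalKrullDim_eq_ringKrullDim {C : Set (σ → K)} (hC : IsClosed C) :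
    topologicalKrullDim C = ringKrullDim (MvPolynomial σ K ⧸ vanishingIdeal K C) := by
  rw [ringKrullDim_quotient, ← Order.krullDim_orderDual]
  have himg : ∀ Z : TopologicalSpace.IrreducibleCloseds C,
      zeroLocus K (vanishingIdeal K ((↑) '' (Z : Set C) : Set (σ → K))) = (↑) '' (Z : Set C) :=
    fun Z => zeroLocus_vanishingIdeal_of_isClosed
      (hC.isClosedEmbedding_subtypeVal.isClosedMap _ Z.isClosed)
  have hprime : ∀ Z : TopologicalSpace.IrreducibleCloseds C,
      (vanishingIdeal K ((↑) '' (Z : Set C) : Set (σ → K))).IsPrime := fun Z =>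
    isPrime_vanishingIdeal_iff.2 (Z.isIrreducible.image _ continuous_subtype_val.continuousOn)
  apply le_antisymm
  · refine Order.krullDim_le_of_strictMono (fun Z => OrderDual.toDual
      ⟨⟨vanishingIdeal K ((↑) '' (Z : Set C) : Set (σ → K)), hprime Z⟩,
        vanishingIdeal_anti_mono (by simp)⟩) ?_
    refine Monotone.strictMono_of_injective (fun Z W hZW => ?_) fun Z W hZW => ?_
    · exact vanishingIdeal_anti_mono (Set.image_mono hZW)
    · have h1 : vanishingIdeal K ((↑) '' (Z : Set C) : Set (σ → K))
          = vanishingIdeal K ((↑) '' (W : Set C) : Set (σ → K)) :=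
        congrArg (fun q : (PrimeSpectrum.zeroLocus (vanishingIdeal K C :
          Set (MvPolynomial σ K)))ᵒᵈ => (OrderDual.ofDual q).1.asIdeal) hZW
      have h2 := congrArg (zeroLocus K) h1
      rw [himg, himg] at h2
      exact SetLike.coe_injective (Subtype.val_injective.image_injective h2)
  · have hsub : ∀ q : PrimeSpectrum.zeroLocus (vanishingIdeal K C : Set (MvPolynomial σ K)),
        zeroLocus K q.1.asIdeal ⊆ C := fun q =>
      (zeroLocus_anti_mono q.2).trans (zeroLocus_vanishingIdeal_of_isClosed hC).subset
    have hq : ∀ q : PrimeSpectrum.zeroLocus (vanishingIdeal K C : Set (MvPolynomial σ K)),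
        vanishingIdeal K (zeroLocus K q.1.asIdeal) = q.1.asIdeal := fun q =>
      IsPrime.vanishingIdeal_zeroLocus q.1.asIdeal
    have hirr : ∀ q : PrimeSpectrum.zeroLocus (vanishingIdeal K C : Set (MvPolynomial σ K)),
        IsIrreducible ((↑) ⁻¹' (zeroLocus K q.1.asIdeal) : Set C) := fun q => by
      have h1 : IsIrreducible (zeroLocus K q.1.asIdeal) := by
        rw [← isPrime_vanishingIdeal_iff, hq]
        exact q.1.2
      refine ⟨?_, ?_⟩
      · obtain ⟨x, hx⟩ := h1.1
        exact ⟨⟨x, hsub q hx⟩, hx⟩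
      · rintro _ _ ⟨U, hU, rfl⟩ ⟨V, hV, rfl⟩ ⟨x, hx, hxU⟩ ⟨y, hy, hyV⟩
        obtain ⟨z, hz, hzUV⟩ := h1.2 U V hU hV ⟨x, hx, hxU⟩ ⟨y, hy, hyV⟩
        exact ⟨⟨z, hsub q hz⟩, hz, hzUV⟩
    refine Order.krullDim_le_of_strictMono (fun q =>
      ⟨(↑) ⁻¹' (zeroLocus K (OrderDual.ofDual q).1.asIdeal), hirr (OrderDual.ofDual q),
        (isClosed_zeroLocus _).preimage continuous_subtype_val⟩) ?_
    refine Monotone.strictMono_of_injective (fun q r hqr => ?_) fun q r hqr => ?_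
    · have h1 : (OrderDual.ofDual r).1.asIdeal ≤ (OrderDual.ofDual q).1.asIdeal := hqr
      intro x hx
      exact zeroLocus_anti_mono h1 hx
    · have h1 : ((↑) ⁻¹' (zeroLocus K (OrderDual.ofDual q).1.asIdeal) : Set C)
          = (↑) ⁻¹' (zeroLocus K (OrderDual.ofDual r).1.asIdeal) := congrArg SetLike.coe hqr
      rw [Subtype.preimage_coe_eq_preimage_coe_iff, Set.inter_eq_right.2 (hsub _),
        Set.inter_eq_right.2 (hsub _)] at h1
      have h2 := congrArg (vanishingIdeal K) h1
      rw [hq, hq] at h2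
      exact OrderDual.ofDual.injective (Subtype.ext (PrimeSpectrum.ext h2))

end Zariski

/-- The Krull dimension of a space covered by open subspaces of the same dimension. -/
theorem topologicalKrullDim_eq_of_openCover {Y : Type*} [TopologicalSpace Y] [Nonempty Y]
    {ι : Type*} (C : ι → Type*) [∀ i, TopologicalSpace (C i)] (f : ∀ i, C i → Y)
    (hf : ∀ i, Topology.IsOpenEmbedding (f i)) (hsurj : ∀ y, ∃ i c, f i c = y) (d : WithBot ℕ∞)
    (hd : ∀ i, Nonempty (C i) → topologicalKrullDim (C i) = d) : topologicalKrullDim Y = d := by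
  apply le_antisymm
  · refine iSup_le fun l => ?_
    obtain ⟨y, hy⟩ := l.head.isIrreducible.nonempty
    obtain ⟨i, c, rfl⟩ := hsurj y
    rw [← hd i ⟨c⟩]
    let e := TopologicalSpace.IrreducibleCloseds.orderIsoOfIsOpenEmbedding (f i) (hf i)
    -- The smallest member of the chain has a point in the chart, hence all members meet the chart.
    have hmem : ∀ j, l j ∈ {V : TopologicalSpace.IrreducibleCloseds Y | (f i ⁻¹' V).Nonempty} :=
      fun j => ⟨c, l.monotone (Fin.zero_le j) hy⟩
    let l' : LTSeries (TopologicalSpace.IrreducibleCloseds (C i)) :=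
      { length := l.length
        toFun := fun j => e.symm ⟨l j, hmem j⟩
        step := fun j => e.symm.strictMono (l.step j) }
    exact Order.LTSeries.length_le_krullDim l'
  · obtain ⟨i, c, -⟩ := hsurj (Classical.arbitrary Y)
    rw [← hd i ⟨c⟩]
    exact (hf i).isInducing.topologicalKrullDim_le

/-! ### The action of square matrices on frames -/

section MatrixAction

variable {R ι κ : Type*} [CommRing R] [Fintype ι] [Fintype κ]

/-- A point of affine space indexed by `ι × κ` as a matrix. -/
def rows {R ι κ : Type*} (M : ι × κ → R) : Matrix ι κ R := Matrix.of fun i j => M (i, j)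

/-- Left multiplication by a square matrix. -/
def act (g : Matrix ι ι R) (M : ι × κ → R) : ι × κ → R := fun p => (g * rows M) p.1 p.2

omit [Fintype κ] in
theorem rows_act (g : Matrix ι ι R) (M : ι × κ → R) : rows (act g M) = g * rows M := rfl

theorem rows_injective {R ι κ : Type*} : Function.Injective (rows : (ι × κ → R) → Matrix ι κ R) :=
  fun _ _ h => funext fun p => congrFun (congrFun h p.1) p.2

omit [Fintype κ] in
theorem act_act (g h : Matrix ι ι R) (M : ι × κ → R) : act g (act h M) = act (g * h) M :=
  rows_injective (by rw [rows_act, rows_act, rows_act, Matrix.mul_assoc])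

omit [Fintype κ] in
theorem act_one [DecidableEq ι] (M : ι × κ → R) : act 1 M = M :=
  rows_injective (by rw [rows_act, Matrix.one_mul])

omit [Fintype κ] in
theorem act_add_right (g : Matrix ι ι R) (M M' : ι × κ → R) :
    act g (M + M') = act g M + act g M' :=
  rows_injective (Matrix.mul_add g (rows M) (rows M'))

omit [Fintype κ] in
theorem act_smul_left (c : R) (g : Matrix ι ι R) (M : ι × κ → R) :
    act (c • g) M = c • act g M :=
  rows_injective (Matrix.smul_mul _ _ _)

omit [Fintype κ] in
theorem act_smul_right (c : R) (g : Matrix ι ι R) (M : ι × κ → R) :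
    act g (c • M) = c • act g M :=
  rows_injective (Matrix.mul_smul g c (rows M))

variable {K : Type*} [Field K]

/-- The polynomials giving `act g`. -/
def actPoly (g : Matrix ι ι K) (p : ι × κ) : MvPolynomial (ι × κ) K :=
  ∑ i, C (g p.1 i) * X (i, p.2)

omit [Fintype κ] in
theorem eval_actPoly (g : Matrix ι ι K) (M : ι × κ → K) :
    (fun p => eval M (actPoly g p)) = act g M := by
  funext p
  simp [actPoly, act, Matrix.mul_apply, rows]

theorem diffMap_actPoly [DecidableEq ι] [DecidableEq κ] (g : Matrix ι ι K) (M w : ι × κ → K) :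
    diffMap (actPoly g) M w = act g w := by
  funext p
  simp only [diffMap_apply, dotProduct, grad, actPoly, map_sum, Derivation.leibniz, pderiv_C,
    smul_zero, add_zero, pderiv_X, act, Matrix.mul_apply, rows]
  simp only [smul_eq_mul, map_mul, MvPolynomial.aeval_C, Algebra.algebraMap_self, RingHom.id_apply,
    Finset.sum_mul]
  rw [Finset.sum_comm]
  refine Finset.sum_congr rfl fun i _ => ?_
  rw [Finset.sum_eq_single (i, p.2)]
  · simp
  · intro b _ hb
    simp [Ne.symm hb]
  · simp

/-- The polynomials giving `g ↦ act g M`. -/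
def orbitPoly (M : ι × κ → K) (p : ι × κ) : MvPolynomial (ι × ι) K :=
  ∑ i, C (M (i, p.2)) * X (p.1, i)

omit [Fintype κ] in
theorem eval_orbitPoly (M : ι × κ → K) (g : ι × ι → K) :
    (fun p => eval g (orbitPoly M p)) = act (rows g) M := by
  funext p
  simp [orbitPoly, act, Matrix.mul_apply, rows, mul_comm]

omit [Fintype κ] in
theorem diffMap_orbitPoly [DecidableEq ι] (M : ι × κ → K) (g w : ι × ι → K) :
    diffMap (orbitPoly M) g w = act (rows w) M := by
  funext p
  simp only [diffMap_apply, dotProduct, grad, orbitPoly, map_sum, Derivation.leibniz, pderiv_C,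
    smul_zero, add_zero, pderiv_X, act, Matrix.mul_apply, rows]
  simp only [smul_eq_mul, map_mul, MvPolynomial.aeval_C, Algebra.algebraMap_self, RingHom.id_apply,
    Finset.sum_mul]
  rw [Finset.sum_comm]
  refine Finset.sum_congr rfl fun i _ => ?_
  rw [Finset.sum_eq_single (p.1, i)]
  · simp [mul_comm]
  · intro b _ hb
    simp [Ne.symm hb]
  · simp

/-- The determinant of a square polynomial matrix. -/
def detPoly (K ι : Type*) [Field K] [Fintype ι] [DecidableEq ι] : MvPolynomial (ι × ι) K :=
  (rows (X : ι × ι → MvPolynomial (ι × ι) K)).det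

theorem eval_detPoly [DecidableEq ι] (g : ι × ι → K) : eval g (detPoly K ι) = (rows g).det := by
  rw [detPoly, RingHom.map_det]
  congr 1
  ext i j
  simp [rows]

/-- Invertible matrices are dense: `P` times the determinant vanishes everywhere, and the
determinant is not zero since it is `1` at the identity. -/
theorem vanishingIdeal_det_ne_zero [DecidableEq ι] [Infinite K] {P : MvPolynomial (ι × ι) K}
    (hP : ∀ g : ι × ι → K, (rows g).det ≠ 0 → eval g P = 0) : P = 0 := by
  have h : P * detPoly K ι = 0 := by
    apply MvPolynomial.funext
    intro g
    rw [map_mul, map_zero, eval_detPoly]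
    by_cases hg : (rows g).det = 0
    · rw [hg, mul_zero]
    · rw [hP g hg, zero_mul]
  refine (mul_eq_zero.1 h).resolve_right fun h0 => ?_
  have h1 := eval_detPoly (K := K) fun p : ι × ι => (1 : Matrix ι ι K) p.1 p.2
  rw [h0, map_zero] at h1
  have h2 : rows (fun p : ι × ι => (1 : Matrix ι ι K) p.1 p.2) = 1 := rfl
  rw [h2, det_one] at h1
  exact zero_ne_one h1

/-- The product of the generic matrix with the constant matrix `R`. -/
def genericMul (R : Matrix κ ι K) : Matrix ι ι (MvPolynomial (ι × κ) K) :=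
  Matrix.of fun i l => ∑ j, X (i, j) * C (R j l)

/-- The polynomial `det (M * R)`. -/
def chartDet [DecidableEq ι] (R : Matrix κ ι K) : MvPolynomial (ι × κ) K :=
  (genericMul R).det

omit [Fintype ι] in
theorem map_genericMul (R : Matrix κ ι K) (M : ι × κ → K) :
    (genericMul R).map (eval M) = rows M * R := by
  ext i l
  simp [genericMul, rows, Matrix.mul_apply]

theorem eval_chartDet [DecidableEq ι] (R : Matrix κ ι K) (M : ι × κ → K) :
    eval M (chartDet R) = (rows M * R).det := by
  rw [chartDet, RingHom.map_det, RingHom.mapMatrix_apply, map_genericMul]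

/-- Clearing denominators after normalising a matrix. -/
theorem exists_eval_eq_pow_mul_eval_act_inv [DecidableEq ι] (R : Matrix κ ι K)
    (P : MvPolynomial (ι × κ) K) :
    ∃ (d : ℕ) (Q : MvPolynomial (ι × κ) K), ∀ M : ι × κ → K, (rows M * R).det ≠ 0 →
      eval M Q = (rows M * R).det ^ d * eval (act (rows M * R)⁻¹ M) P := by
  induction P using MvPolynomial.induction_on with
  | C a => exact ⟨0, C a, fun M _ => by simp⟩
  | add P P' hP hP' =>
    obtain ⟨d, Q, h⟩ := hP
    obtain ⟨d', Q', h'⟩ := hP'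
    refine ⟨d + d', chartDet R ^ d' * Q + chartDet R ^ d * Q', fun M hM => ?_⟩
    rw [map_add, map_mul, map_mul, map_pow, map_pow, eval_chartDet, h M hM, h' M hM, map_add]
    ring
  | mul_X P p hP =>
    obtain ⟨d, Q, h⟩ := hP
    let G : Matrix ι κ (MvPolynomial (ι × κ) K) := Matrix.of fun i j => X (i, j)
    let A : Matrix ι κ (MvPolynomial (ι × κ) K) := (genericMul R).adjugate * G
    -- The inverse is the adjugate over the determinant, so each further variable costs one factor
    -- of the determinant.
    refine ⟨d + 1, Q * A p.1 p.2, fun M hM => ?_⟩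
    have hA : eval M (A p.1 p.2) = (rows M * R).det * act (rows M * R)⁻¹ M p := by
      have h1 : A.map (eval M) = (rows M * R).adjugate * rows M := by
        simp only [A]
        rw [Matrix.map_mul, ← RingHom.mapMatrix_apply, RingHom.map_adjugate,
          RingHom.mapMatrix_apply, map_genericMul]
        congr 1
        ext i j
        simp [rows, G]
      have h2 : act (rows M * R)⁻¹ M = (rows M * R).det⁻¹ • act (rows M * R).adjugate M := by
        rw [Matrix.inv_def, Ring.inverse_eq_inv', act_smul_left]
      rw [h2, Pi.smul_apply, smul_eq_mul, mul_inv_cancel_left₀ hM]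
      exact congrFun (congrFun h1 p.1) p.2
    rw [map_mul, map_mul, h M hM, hA, eval_X]
    ring

end MatrixAction

/-! ### Frames of the members of a family -/

section Frames

variable {K : Type*} [Field K] {N k : ℕ}

theorem mem_frames_iff {B : Set (Gr K N k)} {M : Fin (k + 1) × Fin (N + 1) → K} :
    M ∈ frames B ↔ ∃ h : LinearIndependent K (fun i j => M (i, j) : Fin (k + 1) → Vec K N),
      spanGr ⟨M, h⟩ ∈ B := by
  constructor
  · rintro ⟨L, hL, b, hb⟩
    have hM : (fun i j => M (i, j) : Fin (k + 1) → Vec K N) = fun i => (b i : Vec K N) := by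
      funext i j
      exact hb i j
    have hli : LinearIndependent K (fun i j => M (i, j) : Fin (k + 1) → Vec K N) := by
      rw [hM]
      exact b.linearIndependent.map' (Submodule.subtype _) (Submodule.ker_subtype _)
    refine ⟨hli, ?_⟩
    convert hL
    apply Subtype.ext
    change Submodule.span K (Set.range (fun i j => M (i, j) : Fin (k + 1) → Vec K N)) = L.1
    rw [hM]
    have h1 := congrArg (Submodule.map L.toSub.subtype) b.span_eq
    rw [Submodule.map_span, ← Set.range_comp, Submodule.map_top, Submodule.range_subtype] at h1
    exact h1
  · rintro ⟨h, hB⟩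
    have hb : ∀ i, (Module.Basis.span h i : Vec K N) = fun j => M (i, j) := fun i =>
      congrArg Subtype.val (Module.Basis.span_apply h i)
    exact ⟨_, hB, Module.Basis.span h, fun i j => (congrFun (hb i) j).symm⟩

theorem linearIndependent_of_mem_frames {B : Set (Gr K N k)} {M : Fin (k + 1) × Fin (N + 1) → K}
    (h : M ∈ frames B) : LinearIndependent K (fun i j => M (i, j) : Fin (k + 1) → Vec K N) :=
  (mem_frames_iff.1 h).1

theorem mem_frames_singleton {B : Set (Gr K N k)} {M : Fin (k + 1) × Fin (N + 1) → K} :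
    M ∈ frames B ↔ ∃ L ∈ B, M ∈ frames {L} := by
  constructor
  · rintro ⟨L, hL, hb⟩
    exact ⟨L, hL, L, rfl, hb⟩
  · rintro ⟨L, hL, _, rfl, hb⟩
    exact ⟨_, hL, hb⟩

theorem frames_singleton_nonempty (L : Gr K N k) : ∃ M, M ∈ frames {L} := by
  let b := Module.finBasisOfFinrankEq K L.toSub L.2
  exact ⟨fun p => (b p.1 : Vec K N) p.2, L, rfl, b, fun _ _ => rfl⟩

theorem frames_eq_of_mem {L L' : Gr K N k} {M : Fin (k + 1) × Fin (N + 1) → K}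
    (h : M ∈ frames {L}) (h' : M ∈ frames {L'}) : L = L' := by
  obtain ⟨hM, h1⟩ := mem_frames_iff.1 h
  obtain ⟨_, h2⟩ := mem_frames_iff.1 h'
  exact (Set.mem_singleton_iff.1 h1).symm.trans (Set.mem_singleton_iff.1 h2)

theorem act_mem_frames {B : Set (Gr K N k)} {M : Fin (k + 1) × Fin (N + 1) → K}
    (hM : M ∈ frames B) {g : Matrix (Fin (k + 1)) (Fin (k + 1)) K} (hg : g.det ≠ 0) :
    act g M ∈ frames B := by
  obtain ⟨hli, hB⟩ := mem_frames_iff.1 hM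
  have hrow : ∀ (h : Matrix (Fin (k + 1)) (Fin (k + 1)) K) (M : Fin (k + 1) × Fin (N + 1) → K),
      Submodule.span K (Set.range (fun i j => act h M (i, j) : Fin (k + 1) → Vec K N))
        ≤ Submodule.span K (Set.range (fun i j => M (i, j) : Fin (k + 1) → Vec K N)) := by
    intro h M
    rw [Submodule.span_le]
    rintro _ ⟨i, rfl⟩
    have : (fun j => act h M (i, j)) = ∑ l, h i l • (fun j => M (l, j)) := by
      funext j
      simp [act, Matrix.mul_apply, rows]
    change (fun j => act h M (i, j)) ∈ Submodule.span K _
    rw [this]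
    exact Submodule.sum_mem _ fun l _ => Submodule.smul_mem _ _ (Submodule.subset_span ⟨l, rfl⟩)
  have hli' : LinearIndependent K (fun i j => act g M (i, j) : Fin (k + 1) → Vec K N) := by
    have h1 : LinearIndependent K (rows (act g M)).row := by
      rw [← Matrix.vecMul_injective_iff, rows_act]
      have h2 : Function.Injective (rows M).vecMul := Matrix.vecMul_injective_iff.2 hli
      have h3 : Function.Injective g.vecMul :=
        Matrix.vecMul_injective_of_isUnit ((Matrix.isUnit_iff_isUnit_det _).2
          (isUnit_iff_ne_zero.2 hg))
      intro v w hvw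
      have hvw' : v ᵥ* (g * rows M) = w ᵥ* (g * rows M) := hvw
      rw [← Matrix.vecMul_vecMul, ← Matrix.vecMul_vecMul] at hvw'
      exact h3 (h2 hvw')
    exact h1
  refine mem_frames_iff.2 ⟨hli', ?_⟩
  convert hB using 1
  apply Subtype.ext
  refine le_antisymm (hrow g M) ?_
  have h1 := hrow g⁻¹ (act g M)
  rwa [act_act, Matrix.nonsing_inv_mul _ (isUnit_iff_ne_zero.2 hg), act_one] at h1

/-- Together with `act_mem_frames`: the frames of one member form a single orbit of the invertible
matrices. -/
theorem exists_act_eq {L : Gr K N k} {M M' : Fin (k + 1) × Fin (N + 1) → K}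
    (hM : M ∈ frames {L}) (hM' : M' ∈ frames {L}) :
    ∃ g : Matrix (Fin (k + 1)) (Fin (k + 1)) K, g.det ≠ 0 ∧ M' = act g M := by
  obtain ⟨hli, hL⟩ := mem_frames_iff.1 hM
  obtain ⟨hli', hL'⟩ := mem_frames_iff.1 hM'
  have hspan : Submodule.span K (Set.range (fun i j => M' (i, j) : Fin (k + 1) → Vec K N))
      = Submodule.span K (Set.range (fun i j => M (i, j) : Fin (k + 1) → Vec K N)) :=
    congrArg Subtype.val ((Set.mem_singleton_iff.1 hL').trans (Set.mem_singleton_iff.1 hL).symm)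
  have hmem : ∀ i, (fun j => M' (i, j)) ∈
      Submodule.span K (Set.range (fun i j => M (i, j) : Fin (k + 1) → Vec K N)) := by
    intro i
    rw [← hspan]
    exact Submodule.subset_span ⟨i, rfl⟩
  choose g hg using fun i => (Submodule.mem_span_range_iff_exists_fun K).1 (hmem i)
  have hact : M' = act (Matrix.of g) M := by
    funext p
    have := congrFun (hg p.1) p.2
    simp only [Finset.sum_apply, Pi.smul_apply, smul_eq_mul] at this
    rw [act, Matrix.mul_apply]
    exact this.symm
  refine ⟨Matrix.of g, fun h0 => ?_, hact⟩
  obtain ⟨v, hv0, hv⟩ := Matrix.exists_vecMul_eq_zero_iff.2 h0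
  have h1 : Function.Injective (rows M').vecMul := Matrix.vecMul_injective_iff.2 hli'
  apply hv0
  apply h1
  change v ᵥ* rows M' = 0 ᵥ* rows M'
  rw [hact, rows_act, ← Matrix.vecMul_vecMul, hv, Matrix.zero_vecMul, Matrix.zero_vecMul]

/-- The set of members having a frame at which `q` does not vanish is open. -/
theorem isOpen_exists_frame (q : MvPolynomial (Fin (k + 1) × Fin (N + 1)) K) :
    IsOpen {L : Gr K N k | ∃ M ∈ frames {L}, eval M q ≠ 0} := by
  rw [isOpen_coinduced]
  -- All frames of a member are translates of one of them, so the preimage is a union of translates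
  -- of the basic open set of `q`.
  have h : spanGr ⁻¹' {L : Gr K N k | ∃ M ∈ frames {L}, eval M q ≠ 0} =
      Subtype.val ⁻¹' ⋃ g : {g : Matrix (Fin (k + 1)) (Fin (k + 1)) K // g.det ≠ 0},
        {M | eval M (bind₁ (actPoly g.1) q) ≠ 0} := by
    ext ⟨M, hM⟩
    have he : ∀ g, eval M (bind₁ (actPoly g) q) = eval (act g M) q := by
      intro g
      rw [← eval_actPoly]
      exact aeval_bind₁ (R := K) (f := M) (actPoly g) q
    have hMf : M ∈ frames {spanGr ⟨M, hM⟩} := mem_frames_iff.2 ⟨hM, rfl⟩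
    simp only [Set.mem_preimage, Set.mem_ofPred_eq, Set.mem_iUnion]
    constructor
    · rintro ⟨M', hM', hq⟩
      obtain ⟨g, hg, rfl⟩ := exists_act_eq hMf hM'
      exact ⟨⟨g, hg⟩, by rwa [he]⟩
    · rintro ⟨⟨g, hg⟩, hq⟩
      exact ⟨_, act_mem_frames hMf hg, by rwa [he] at hq⟩
  rw [h]
  exact (isOpen_iUnion fun g => isOpen_eval_ne_zero _).preimage continuous_subtype_val

/-- The frames are irreducible because `B` is irreducible and so are the orbits. If neither factor
of a product vanishes on the frames, some member has a frame where `P` is nonzero and another where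
`Q` is. On its orbit the product vanishes, so one of the two pulled back polynomials is zero, a
contradiction. -/
theorem isPrime_vanishingIdeal_frames [Infinite K] {B : Set (Gr K N k)} (hB : IsIrreducible B) :
    (vanishingIdeal K (frames B)).IsPrime := by
  constructor
  · intro htop
    obtain ⟨L, hL⟩ := hB.1
    obtain ⟨M, hM⟩ := frames_singleton_nonempty L
    have h1 : (1 : MvPolynomial (Fin (k + 1) × Fin (N + 1)) K) ∈ vanishingIdeal K (frames B) := by
      rw [htop]
      trivial
    have h2 : eval M (1 : MvPolynomial (Fin (k + 1) × Fin (N + 1)) K) = 0 :=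
      h1 M (mem_frames_singleton.2 ⟨L, hL, hM⟩)
    simp at h2
  · intro P Q hPQ
    by_contra! hcon
    obtain ⟨x, hx, hx0⟩ := exists_eval_ne_zero hcon.1
    obtain ⟨y, hy, hy0⟩ := exists_eval_ne_zero hcon.2
    obtain ⟨L₁, hL₁, hx⟩ := mem_frames_singleton.1 hx
    obtain ⟨L₂, hL₂, hy⟩ := mem_frames_singleton.1 hy
    obtain ⟨L, hL, ⟨M, hM, hMP⟩, ⟨M', hM', hMQ⟩⟩ := hB.2 _ _ (isOpen_exists_frame P)
      (isOpen_exists_frame Q) ⟨L₁, hL₁, x, hx, hx0⟩ ⟨L₂, hL₂, y, hy, hy0⟩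
    obtain ⟨g, hg, rfl⟩ := exists_act_eq hM hM'
    have he : ∀ (h : Fin (k + 1) × Fin (k + 1) → K) (q : MvPolynomial (Fin (k + 1) × Fin (N + 1)) K),
        eval h (bind₁ (orbitPoly M) q) = eval (act (rows h) M) q := by
      intro h q
      rw [← eval_orbitPoly]
      exact aeval_bind₁ (R := K) (f := h) (orbitPoly M) q
    have h0 : bind₁ (orbitPoly M) P * bind₁ (orbitPoly M) Q = 0 := by
      apply vanishingIdeal_det_ne_zero
      intro h hdet
      rw [← map_mul, he]
      exact hPQ _ (mem_frames_singleton.2 ⟨L, hL, act_mem_frames hM hdet⟩)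
    rcases mul_eq_zero.1 h0 with h | h
    · have h1 := he (fun p => (1 : Matrix _ _ K) p.1 p.2) P
      have h2 : rows (fun p : Fin (k + 1) × Fin (k + 1) => (1 : Matrix _ _ K) p.1 p.2) = 1 := rfl
      rw [h, map_zero, h2, act_one] at h1
      exact hMP h1.symm
    · have h1 := he (fun p => g p.1 p.2) Q
      have h2 : rows (fun p : Fin (k + 1) × Fin (k + 1) => g p.1 p.2) = g := rfl
      rw [h, map_zero, h2] at h1
      exact hMQ h1.symm

end Frames

/-! ### Affine charts of the family as slices of the frames -/

section Charts

variable {K : Type*} [Field K] {N k : ℕ}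

/-- The frames `M` of the members of `B` normalised by `M * R = 1`. -/
def chart (B : Set (Gr K N k)) (R : Matrix (Fin (N + 1)) (Fin (k + 1)) K) :
    Set (Fin (k + 1) × Fin (N + 1) → K) :=
  {M | M ∈ frames B ∧ rows M * R = 1}

theorem chart_subset_frames (B : Set (Gr K N k)) (R : Matrix (Fin (N + 1)) (Fin (k + 1)) K) :
    chart B R ⊆ frames B := fun _ h => h.1

/-- The chart is a slice for the action on the open set where `rows M * R` is invertible, and this
normalisation is the retraction onto it. -/
theorem act_inv_mem_chart {B : Set (Gr K N k)} {R : Matrix (Fin (N + 1)) (Fin (k + 1)) K}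
    {M : Fin (k + 1) × Fin (N + 1) → K} (hM : M ∈ frames B) (h : (rows M * R).det ≠ 0) :
    act (rows M * R)⁻¹ M ∈ chart B R := by
  have hu := isUnit_iff_ne_zero.2 h
  refine ⟨act_mem_frames hM ?_, ?_⟩
  · exact (Matrix.isUnit_nonsing_inv_det _ hu).ne_zero
  · rw [rows_act, Matrix.mul_assoc, Matrix.nonsing_inv_mul _ hu]

theorem exists_det_mul_ne_zero {B : Set (Gr K N k)} {M : Fin (k + 1) × Fin (N + 1) → K}
    (hM : M ∈ frames B) : ∃ R : Matrix (Fin (N + 1)) (Fin (k + 1)) K, (rows M * R).det ≠ 0 := by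
  obtain ⟨R, hR⟩ := exists_mul_eq_one_of_linearIndependent_rows (rows M)
    (linearIndependent_of_mem_frames hM)
  exact ⟨R, by rw [hR, det_one]; exact one_ne_zero⟩

/-- The equation `rows M * R = 1` already forces rank `k + 1`. So the slice is closed among all
matrices, whereas the frames are closed only among matrices of full rank. This makes the affine
dimension theory available. -/
theorem isClosed_chart {B : Set (Gr K N k)} (hB : IsClosed B)
    (R : Matrix (Fin (N + 1)) (Fin (k + 1)) K) : IsClosed (chart B R) := by
  rw [isClosed_coinduced] at hB
  obtain ⟨Z, hZ, hZB⟩ := isClosed_induced_iff.1 hB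
  have h1 : chart B R = Z ∩ {M | ∀ P ∈ Set.range fun p : Fin (k + 1) × Fin (k + 1) =>
      genericMul R p.1 p.2 - C ((1 : Matrix _ _ K) p.1 p.2), eval M P = 0} := by
    ext M
    have h2 : rows M * R = 1 ↔ ∀ P ∈ Set.range fun p : Fin (k + 1) × Fin (k + 1) =>
        genericMul R p.1 p.2 - C ((1 : Matrix _ _ K) p.1 p.2), eval M P = 0 := by
      rw [Set.forall_mem_range, ← map_genericMul]
      constructor
      · intro h p
        rw [map_sub, eval_C, sub_eq_zero]
        exact congrFun (congrFun h p.1) p.2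
      · intro h
        ext i j
        have := h (i, j)
        rw [map_sub, eval_C, sub_eq_zero] at this
        exact this
    have h3 : ∀ h : LinearIndependent K (fun i j => M (i, j) : Fin (k + 1) → Vec K N),
        M ∈ Z ↔ spanGr ⟨M, h⟩ ∈ B := fun h =>
      (Set.ext_iff.1 hZB ⟨M, h⟩)
    rw [Set.mem_inter_iff]
    change M ∈ frames B ∧ rows M * R = 1 ↔ M ∈ Z ∧ _
    rw [Set.mem_ofPred_eq, ← h2, mem_frames_iff]
    constructor
    · rintro ⟨⟨h, hB⟩, hR⟩
      exact ⟨(h3 h).2 hB, hR⟩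
    · rintro ⟨hz, hR⟩
      have h : LinearIndependent K (rows M).row :=
        linearIndependent_rows_of_det_mul_ne_zero _ R (by rw [hR, det_one]; exact one_ne_zero)
      exact ⟨⟨h, (h3 h).1 hz⟩, hR⟩
  rw [h1]
  exact hZ.inter ((isClosed_zariski_iff _).2 ⟨_, rfl⟩)

/-- The chart of `B` given by `R`. -/
def chartMap (B : Set (Gr K N k)) (R : Matrix (Fin (N + 1)) (Fin (k + 1)) K) (M : chart B R) : B :=
  ⟨spanGr ⟨M.1, (mem_frames_iff.1 M.2.1).1⟩, (mem_frames_iff.1 M.2.1).2⟩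

theorem mem_frames_chartMap {B : Set (Gr K N k)} {R : Matrix (Fin (N + 1)) (Fin (k + 1)) K}
    (M : chart B R) : M.1 ∈ frames {(chartMap B R M).1} :=
  mem_frames_iff.2 ⟨(mem_frames_iff.1 M.2.1).1, rfl⟩

/-- The inverse on the image is the normalisation of frames. Its only denominators are powers of
`det (rows M * R)`, and clearing them shows that images of open sets are open. -/
theorem isOpenEmbedding_chartMap (B : Set (Gr K N k)) (R : Matrix (Fin (N + 1)) (Fin (k + 1)) K) :
    Topology.IsOpenEmbedding (chartMap B R) := by
  apply Topology.IsOpenEmbedding.of_continuous_injective_isOpenMap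
  · refine Continuous.subtype_mk ?_ _
    have h1 : Continuous (spanGr : _ → Gr K N k) := continuous_coinduced_rng
    have h2 : Continuous fun M : chart B R =>
        (⟨M.1, (mem_frames_iff.1 M.2.1).1⟩ : {M : Fin (k + 1) × Fin (N + 1) → K //
          LinearIndependent K (fun i j => M (i, j) : Fin (k + 1) → Vec K N)}) :=
      continuous_subtype_val.subtype_mk _
    exact h1.comp h2
  · intro M M' h
    have h1 := mem_frames_chartMap M
    have h2 := mem_frames_chartMap M'
    rw [← h] at h2
    obtain ⟨g, hg, hgM⟩ := exists_act_eq h1 h2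
    have h3 := M'.2.2
    rw [hgM, rows_act, Matrix.mul_assoc, M.2.2, Matrix.mul_one] at h3
    apply Subtype.ext
    rw [hgM, h3, act_one]
  · rintro _ ⟨W, hW, rfl⟩
    obtain ⟨S, rfl⟩ := (isOpen_zariski_iff _).1 hW
    choose d Q hQ using exists_eval_eq_pow_mul_eval_act_inv (ι := Fin (k + 1)) (κ := Fin (N + 1)) R
    have h1 : chartMap B R '' (Subtype.val ⁻¹' {x | ∃ P ∈ S, eval x P ≠ 0}) =
        Subtype.val ⁻¹' ⋃ P ∈ S, {L : Gr K N k | ∃ M ∈ frames {L}, eval M (chartDet R * Q P) ≠ 0} := by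
      ext L
      simp only [Set.mem_image, Set.mem_preimage, Set.mem_ofPred_eq, Set.mem_iUnion]
      constructor
      · rintro ⟨M, ⟨P, hP, hMP⟩, rfl⟩
        refine ⟨P, hP, M.1, mem_frames_chartMap M, ?_⟩
        have hdet : (rows M.1 * R).det ≠ 0 := by rw [M.2.2, det_one]; exact one_ne_zero
        rw [map_mul, eval_chartDet, hQ P _ hdet, M.2.2, inv_one, act_one]
        simpa using hMP
      · rintro ⟨P, hP, M, hM, hMP⟩
        rw [map_mul, eval_chartDet] at hMP
        have hdet := left_ne_zero_of_mul hMP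
        have hM' : act (rows M * R)⁻¹ M ∈ chart B R :=
          act_inv_mem_chart (mem_frames_singleton.2 ⟨L, L.2, hM⟩) hdet
        refine ⟨⟨_, hM'⟩, ⟨P, hP, ?_⟩, ?_⟩
        · have h2 := right_ne_zero_of_mul hMP
          rw [hQ P _ hdet] at h2
          exact right_ne_zero_of_mul h2
        · apply Subtype.ext
          exact frames_eq_of_mem (mem_frames_chartMap ⟨_, hM'⟩) (act_inv_mem_chart hM hdet).1
    rw [h1]
    exact (isOpen_biUnion fun P _ => isOpen_exists_frame _).preimage continuous_subtype_val

theorem isIrreducible_chart {B : Set (Gr K N k)} (hB : IsIrreducible B)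
    {R : Matrix (Fin (N + 1)) (Fin (k + 1)) K} (hne : (chart B R).Nonempty) :
    IsIrreducible (chart B R) := by
  have := Subtype.irreducibleSpace hB
  have : Nonempty (chart B R) := hne.to_subtype
  have := (isOpenEmbedding_chartMap B R).irreducibleSpace
  exact IsIrreducible.of_subtype

theorem topologicalKrullDim_eq_of_chart {B : Set (Gr K N k)} (hB : B.Nonempty) (d : WithBot ℕ∞)
    (hd : ∀ R, (chart B R).Nonempty → topologicalKrullDim (chart B R) = d) :
    topologicalKrullDim B = d := by
  have : Nonempty B := hB.to_subtype
  refine topologicalKrullDim_eq_of_openCover (fun R => chart B R) (chartMap B)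
    (isOpenEmbedding_chartMap B) (fun L => ?_) d fun R h => hd R (Set.nonempty_coe_sort.1 h)
  obtain ⟨M, hM⟩ := frames_singleton_nonempty L.1
  obtain ⟨R, hR⟩ := exists_det_mul_ne_zero hM
  have hM' : act (rows M * R)⁻¹ M ∈ chart B R :=
    act_inv_mem_chart (mem_frames_singleton.2 ⟨L, L.2, hM⟩) hR
  exact ⟨R, ⟨_, hM'⟩, Subtype.ext
    (frames_eq_of_mem (mem_frames_chartMap ⟨_, hM'⟩) (act_inv_mem_chart hM hR).1)⟩

variable (B : Set (Gr K N k))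

theorem act_mem_tangentSpace_act {M w : Fin (k + 1) × Fin (N + 1) → K}
    {g : Matrix (Fin (k + 1)) (Fin (k + 1)) K} (hg : g.det ≠ 0)
    (hw : w ∈ tangentSpace (frames B) M) :
    act g w ∈ tangentSpace (frames B) (act g M) := by
  have := diffMap_mem_tangentSpace (actPoly g) (D := frames B) (fun x hx => by
    rw [eval_actPoly]
    exact act_mem_frames hx hg) hw
  rwa [eval_actPoly, diffMap_actPoly] at this

theorem finrank_tangentSpace_act {M : Fin (k + 1) × Fin (N + 1) → K}
    {g : Matrix (Fin (k + 1)) (Fin (k + 1)) K} (hg : g.det ≠ 0) :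
    Module.finrank K (tangentSpace (frames B) (act g M))
      = Module.finrank K (tangentSpace (frames B) M) := by
  have key : ∀ (M : Fin (k + 1) × Fin (N + 1) → K) (g : Matrix (Fin (k + 1)) (Fin (k + 1)) K),
      g.det ≠ 0 → Module.finrank K (tangentSpace (frames B) M)
        ≤ Module.finrank K (tangentSpace (frames B) (act g M)) := by
    intro M g hg
    let T : (Fin (k + 1) × Fin (N + 1) → K) →ₗ[K] (Fin (k + 1) × Fin (N + 1) → K) :=
      { toFun := act g
        map_add' := act_add_right g
        map_smul' := fun c w => act_smul_right c g w }
    have hT : Function.Injective T := fun v w h => by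
      have h1 : act g⁻¹ (act g v) = act g⁻¹ (act g w) := congrArg (act g⁻¹) h
      rwa [act_act, act_act, Matrix.nonsing_inv_mul _ (isUnit_iff_ne_zero.2 hg), act_one,
        act_one] at h1
    rw [(Submodule.equivMapOfInjective T hT (tangentSpace (frames B) M)).finrank_eq]
    apply Submodule.finrank_mono
    rintro _ ⟨w, hw, rfl⟩
    exact act_mem_tangentSpace_act B hg hw
  refine le_antisymm ?_ (key M g hg)
  have h1 := key (act g M) g⁻¹ (Matrix.isUnit_nonsing_inv_det _ (isUnit_iff_ne_zero.2 hg)).ne_zero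
  rwa [act_act, Matrix.nonsing_inv_mul _ (isUnit_iff_ne_zero.2 hg), act_one] at h1

variable {B} [Infinite K]

theorem tangentSpace_det_ne_zero (x w : Fin (k + 1) × Fin (k + 1) → K) :
    w ∈ tangentSpace {g : Fin (k + 1) × Fin (k + 1) → K | (rows g).det ≠ 0} x := by
  rw [mem_tangentSpace]
  intro P hP
  rw [vanishingIdeal_det_ne_zero fun g hg => hP g hg]
  simp [grad, dotProduct]

/-- The tangent space to the frames contains the tangent space to the orbits. -/
theorem act_mem_tangentSpace {M : Fin (k + 1) × Fin (N + 1) → K} (hM : M ∈ frames B)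
    (g : Matrix (Fin (k + 1)) (Fin (k + 1)) K) :
    act g M ∈ tangentSpace (frames B) M := by
  have := diffMap_mem_tangentSpace (orbitPoly M) (D := frames B)
    (C := {g : Fin (k + 1) × Fin (k + 1) → K | (rows g).det ≠ 0}) (fun x hx => by
      rw [eval_orbitPoly]
      exact act_mem_frames hM hx)
    (tangentSpace_det_ne_zero (fun p => (1 : Matrix _ _ K) p.1 p.2) (fun p => g p.1 p.2))
  have h1 : rows (fun p : Fin (k + 1) × Fin (k + 1) => (1 : Matrix _ _ K) p.1 p.2) = 1 := rfl
  rw [eval_orbitPoly, diffMap_orbitPoly, h1, act_one] at this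
  exact this

/-- For the converse, an equation `P` of the chart, composed with the normalisation and cleared of
denominators, becomes an equation of the frames. If `rows w * R = 0`, the line `M + t • w` stays
where `rows · * R = 1`. There the two polynomials agree, so they have the same derivative along `w`.
-/
theorem mem_tangentSpace_chart_iff {R : Matrix (Fin (N + 1)) (Fin (k + 1)) K}
    {M : Fin (k + 1) × Fin (N + 1) → K} (hM : M ∈ chart B R)
    (w : Fin (k + 1) × Fin (N + 1) → K) :
    w ∈ tangentSpace (chart B R) M ↔ w ∈ tangentSpace (frames B) M ∧ rows w * R = 0 := by
  constructor
  · intro hw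
    refine ⟨?_, ?_⟩
    · rw [mem_tangentSpace] at hw ⊢
      exact fun P hP => hw P (vanishingIdeal_anti_mono (chart_subset_frames B R) hP)
    · rw [mem_tangentSpace] at hw
      ext i l
      have h1 : genericMul R i l - C ((1 : Matrix _ _ K) i l) ∈ vanishingIdeal K (chart B R) := by
        intro x hx
        have h2 : eval x (genericMul R i l) = (1 : Matrix _ _ K) i l := by
          have := congrFun (congrFun (map_genericMul R x) i) l
          rw [hx.2] at this
          exact this
        change eval x _ = 0
        rw [map_sub, h2, eval_C, sub_self]
      have h3 := hw _ h1
      refine Eq.trans ?_ h3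
      simp only [dotProduct, grad, genericMul, map_sub, pderiv_C, sub_zero, Matrix.of_apply,
        map_sum, Derivation.leibniz, pderiv_X, smul_eq_mul, Matrix.mul_apply, rows,
        Finset.sum_mul]
      rw [Finset.sum_comm]
      refine Finset.sum_congr rfl fun j _ => ?_
      rw [Finset.sum_eq_single (i, j)]
      · simp [mul_comm]
      · intro b _ hb
        simp [Ne.symm hb]
      · simp
  · rintro ⟨hw, hwR⟩
    rw [mem_tangentSpace] at hw ⊢
    intro P hP
    obtain ⟨d, Q, hQ⟩ := exists_eval_eq_pow_mul_eval_act_inv (ι := Fin (k + 1))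
      (κ := Fin (N + 1)) R P
    have h1 : chartDet R * Q ∈ vanishingIdeal K (frames B) := by
      intro x hx
      change eval x (chartDet R * Q) = 0
      rw [map_mul, eval_chartDet]
      by_cases hdet : (rows x * R).det = 0
      · rw [hdet, zero_mul]
      · have h2 : eval (act (rows x * R)⁻¹ x) P = 0 := hP _ (act_inv_mem_chart hx hdet)
        rw [hQ x hdet, h2, mul_zero, mul_zero]
    rw [← hw _ h1]
    refine (grad_dotProduct_congr fun t => ?_).symm
    have h3 : rows (M + t • w) * R = 1 := by
      have : rows (M + t • w) = rows M + t • rows w := rfl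
      rw [this, Matrix.add_mul, Matrix.smul_mul, hwR, hM.2, smul_zero, add_zero]
    rw [map_mul, eval_chartDet, hQ _ (by rw [h3, det_one]; exact one_ne_zero), h3, inv_one,
      act_one, det_one, one_pow, one_mul, one_mul]

/-- The map `w ↦ rows w * R` is onto, since it sends the orbit direction `act g M` to `g`, and its
kernel is the tangent space of the slice. -/
theorem finrank_tangentSpace_chart {R : Matrix (Fin (N + 1)) (Fin (k + 1)) K}
    {M : Fin (k + 1) × Fin (N + 1) → K} (hM : M ∈ chart B R) :
    Module.finrank K (tangentSpace (frames B) M)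
      = Module.finrank K (tangentSpace (chart B R) M) + (k + 1) * (k + 1) := by
  let T₀ : (Fin (k + 1) × Fin (N + 1) → K) →ₗ[K] Matrix (Fin (k + 1)) (Fin (k + 1)) K :=
    { toFun := fun w => rows w * R
      map_add' := fun v w => Matrix.add_mul (rows v) (rows w) R
      map_smul' := fun c w => Matrix.smul_mul c (rows w) R }
  let T := T₀.domRestrict (tangentSpace (frames B) M)
  have hsurj : LinearMap.range T = ⊤ := by
    rw [LinearMap.range_eq_top]
    intro g
    refine ⟨⟨act g M, act_mem_tangentSpace hM.1 g⟩, ?_⟩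
    change rows (act g M) * R = g
    rw [rows_act, Matrix.mul_assoc, hM.2, Matrix.mul_one]
  have hker : Module.finrank K (LinearMap.ker T)
      = Module.finrank K (tangentSpace (chart B R) M) := by
    rw [← Submodule.finrank_map_subtype_eq]
    have : (LinearMap.ker T).map (tangentSpace (frames B) M).subtype
        = tangentSpace (chart B R) M := by
      ext w
      rw [mem_tangentSpace_chart_iff hM]
      constructor
      · rintro ⟨⟨w, hw⟩, hw0, rfl⟩
        exact ⟨hw, hw0⟩
      · rintro ⟨hw, hw0⟩
        exact ⟨⟨w, hw⟩, hw0, rfl⟩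
    rw [this]
  have h := LinearMap.finrank_range_add_finrank_ker T
  rw [hsurj, finrank_top, hker, Module.finrank_matrix, Fintype.card_fin, Module.finrank_self,
    mul_one] at h
  omega

end Charts

/-- The frames of the members of a closed irreducible `B` form a variety of dimension
`dim B + (k + 1)²`. -/
theorem hasDim_frames {K : Type*} [Field K] [IsAlgClosed K] [CharZero K] {N k n : ℕ}
    {B : Set (Gr K N k)} (hBclosed : IsClosed B) (hBirr : IsIrreducible B)
    (hBdim : topologicalKrullDim B = (n : WithBot ℕ∞)) :
    HasDim (frames B) (n + (k + 1) * (k + 1)) := by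
  have hprime := isPrime_vanishingIdeal_frames hBirr
  obtain ⟨e, he⟩ := exists_hasDim hprime
  -- A general point of the chart bounds `e` from above. A general frame, moved into the chart,
  -- bounds it from below.
  have hchart : ∀ R, (chart B R).Nonempty →
      ∃ d, HasDim (chart B R) d ∧ e = d + (k + 1) * (k + 1) := by
    rintro R ⟨M₀, hM₀⟩
    obtain ⟨d, hd⟩ := exists_hasDim (isPrime_vanishingIdeal_iff.2 (isIrreducible_chart hBirr
      ⟨M₀, hM₀⟩))
    refine ⟨d, hd, le_antisymm ?_ ?_⟩
    · obtain ⟨Q, hQ, hQM⟩ := hd.exists_finrank_eq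
      obtain ⟨M, hM, hMQ⟩ := exists_eval_ne_zero hQ
      rw [← hQM M hM hMQ, ← finrank_tangentSpace_chart hM]
      exact he.le_finrank M hM.1
    · obtain ⟨Q, hQ, hQM⟩ := he.exists_finrank_eq
      have hdet : chartDet R ∉ vanishingIdeal K (frames B) := by
        intro h
        have h1 : eval M₀ (chartDet R) = 0 := h M₀ hM₀.1
        rw [eval_chartDet, hM₀.2, det_one] at h1
        exact one_ne_zero h1
      obtain ⟨M, hM, hM0⟩ := exists_eval_ne_zero fun h =>
        (hprime.mem_or_mem h).elim hQ hdet
      rw [map_mul, eval_chartDet] at hM0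
      have hdetM := right_ne_zero_of_mul hM0
      have hM' := act_inv_mem_chart hM hdetM
      have h1 := finrank_tangentSpace_chart hM'
      rw [finrank_tangentSpace_act B (Matrix.isUnit_nonsing_inv_det _
        (isUnit_iff_ne_zero.2 hdetM)).ne_zero, hQM M hM (left_ne_zero_of_mul hM0)] at h1
      rw [h1]
      exact Nat.add_le_add_right (hd.le_finrank _ hM') _
  obtain ⟨L, hL⟩ := hBirr.1
  obtain ⟨M, hM⟩ := frames_singleton_nonempty L
  obtain ⟨R, hR⟩ := exists_det_mul_ne_zero hM
  obtain ⟨d, hd, hed⟩ := hchart R ⟨_, act_inv_mem_chart (mem_frames_singleton.2 ⟨L, hL, hM⟩) hR⟩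
  -- All nonempty charts have the same dimension, since each is `e` minus the same constant, so it
  -- is the dimension of `B`.
  have hdim := topologicalKrullDim_eq_of_chart hBirr.1 (d : WithBot ℕ∞) fun R' hR' => by
    obtain ⟨d', hd', hed'⟩ := hchart R' hR'
    have : d' = d := by omega
    subst this
    rw [topologicalKrullDim_eq_ringKrullDim (isClosed_chart hBclosed R')]
    exact hd'.2
  rw [hBdim] at hdim
  have hnd : n = d := by exact_mod_cast hdim
  rw [hnd, ← hed]
  exact he

/-! ### Change of coordinates and linear maps -/

section Reindex

variable {K σ τ : Type*} [Field K]

theorem continuous_comp_right (f : σ → τ) : Continuous fun v : τ → K => v ∘ f := by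
  rw [continuous_iff_isClosed]
  intro Z hZ
  obtain ⟨S, rfl⟩ := (isClosed_zariski_iff _).1 hZ
  refine (isClosed_zariski_iff _).2 ⟨rename f '' S, ?_⟩
  ext v
  simp [eval_rename]

theorem HasDim.of_reindex (f : σ ≃ τ) {C : Set (σ → K)} {d : ℕ}
    (h : HasDim {y : τ → K | y ∘ f ∈ C} d) : HasDim C d := by
  have hmem : ∀ P : MvPolynomial σ K,
      rename f P ∈ vanishingIdeal K {y : τ → K | y ∘ f ∈ C} ↔ P ∈ vanishingIdeal K C := by
    intro P
    rw [mem_vanishingIdeal_iff_eval, mem_vanishingIdeal_iff_eval]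
    simp only [eval_rename, Set.mem_ofPred_eq]
    constructor
    · intro h x hx
      have h1 : (x ∘ f.symm) ∘ f = x := by
        funext i
        simp
      have := h (x ∘ f.symm) (by rwa [h1])
      rwa [h1] at this
    · exact fun h y hy => h _ hy
  have hmap : vanishingIdeal K C = (vanishingIdeal K {y : τ → K | y ∘ f ∈ C}).comap
      (renameEquiv K f).toRingEquiv := by
    ext P
    exact (hmem P).symm
  have hprime := h.1
  refine ⟨by rw [hmap]; exact Ideal.comap_isPrime _ _, ?_⟩
  rw [← h.2]
  refine ringKrullDim_eq_of_ringEquiv (Ideal.quotientEquiv _ _ (renameEquiv K f).toRingEquiv ?_)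
  rw [hmap]
  exact (Ideal.map_comap_of_surjective _ (renameEquiv K f).toRingEquiv.surjective _).symm

/-- A linear map which maps `C` to `D` preserves tangent vectors. -/
theorem map_mem_tangentSpace [Fintype σ] [Fintype τ] {C : Set (σ → K)} {D : Set (τ → K)}
    (f : (σ → K) →ₗ[K] (τ → K)) (hf : ∀ x ∈ C, f x ∈ D) {x w : σ → K}
    (hw : w ∈ tangentSpace C x) : f w ∈ tangentSpace D (f x) := by
  classical
  let φ : τ → MvPolynomial σ K := fun j => ∑ s, MvPolynomial.C (f (Pi.single s 1) j) * X s
  have hfx : ∀ x : σ → K, f x = fun j => ∑ s, f (Pi.single s 1) j * x s := by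
    intro x
    conv_lhs => rw [pi_eq_sum_univ' x]
    rw [map_sum]
    funext j
    rw [Finset.sum_apply]
    refine Finset.sum_congr rfl fun s _ => ?_
    rw [map_smul, Pi.smul_apply, smul_eq_mul, mul_comm]
  have heval : ∀ x : σ → K, (fun j => eval x (φ j)) = f x := by
    intro x
    rw [hfx]
    funext j
    simp [φ]
  have hdiff : diffMap φ x w = f w := by
    rw [hfx]
    funext j
    simp only [diffMap_apply, dotProduct]
    refine Finset.sum_congr rfl fun s _ => ?_
    congr 1
    simp only [grad, φ, map_sum, Derivation.leibniz, pderiv_C, pderiv_X, smul_eq_mul]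
    rw [Finset.sum_eq_single s]
    · simp
    · intro b _ hb
      simp [hb]
    · simp
  have h := diffMap_mem_tangentSpace φ (D := D) (fun x hx => by rw [heval]; exact hf x hx) hw
  rwa [heval, hdiff] at h

end Reindex

/-! ### Projective space as a Grassmannian and the dimension of cones -/

section ProjectiveSpace

variable {K : Type*} [Field K] {N : ℕ}

/-- Points of `ℙ^N` as members of the Grassmannian of lines in `V`. -/
def toGr (x : PSpace K N) : Gr K N 0 := ⟨x.submodule, by rw [Projectivization.finrank_submodule]⟩

theorem toGr_bijective : Function.Bijective (toGr : PSpace K N → Gr K N 0) := by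
  constructor
  · intro x y h
    exact Projectivization.submodule_injective (congrArg Subtype.val h)
  · rintro ⟨L, hL⟩
    obtain ⟨v, hv0, hv⟩ := finrank_eq_one_iff'.1 hL
    have hv0' : (v : Vec K N) ≠ 0 := fun h => hv0 (Subtype.ext h)
    refine ⟨Projectivization.mk K v hv0', Subtype.ext ?_⟩
    change (Projectivization.mk K (v : Vec K N) hv0').submodule = L
    rw [Projectivization.submodule_mk]
    apply le_antisymm
    · rw [Submodule.span_singleton_le_iff_mem]
      exact v.2
    · intro w hw
      obtain ⟨c, hc⟩ := hv ⟨w, hw⟩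
      exact Submodule.mem_span_singleton.2 ⟨c, congrArg Subtype.val hc⟩

theorem linearIndependent_row_iff (M : Fin (0 + 1) × Fin (N + 1) → K) :
    LinearIndependent K (fun i j => M (i, j) : Fin (0 + 1) → Vec K N) ↔ (fun j => M (0, j)) ≠ 0 :=
  linearIndependent_unique_iff (ι := Fin 1) (v := fun i j => M (i, j))

/-- Nonzero vectors as matrices of rank one with one row. -/
def vecHomeomorph : {v : Vec K N // v ≠ 0} ≃ₜ {M : Fin (0 + 1) × Fin (N + 1) → K //
    LinearIndependent K (fun i j => M (i, j) : Fin (0 + 1) → Vec K N)} where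
  toFun v := ⟨fun p => v.1 p.2, (linearIndependent_row_iff fun p => v.1 p.2).2 v.2⟩
  invFun M := ⟨fun j => M.1 (0, j), M.2.ne_zero 0⟩
  left_inv _ := rfl
  right_inv M := by
    apply Subtype.ext
    funext p
    exact congrArg M.1 (Prod.ext (Subsingleton.elim (α := Fin 1) _ _) rfl)
  continuous_toFun := ((continuous_comp_right (K := K)
    (Prod.snd : Fin (0 + 1) × Fin (N + 1) → Fin (N + 1))).comp continuous_subtype_val).subtype_mk _
  continuous_invFun := ((continuous_comp_right (K := K)
    fun j : Fin (N + 1) => ((0 : Fin (0 + 1)), j)).comp continuous_subtype_val).subtype_mk _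

theorem toGr_mk' (v : {v : Vec K N // v ≠ 0}) :
    toGr (Projectivization.mk' K v) = spanGr (vecHomeomorph v) := by
  apply Subtype.ext
  change (Projectivization.mk' K v).submodule = Submodule.span K (Set.range fun _ => v.1)
  rw [Projectivization.mk'_eq_mk, Projectivization.submodule_mk, Set.range_const]

/-- `ℙ^N` is the Grassmannian `𝔾(0, N)`. -/
def grHomeomorph : PSpace K N ≃ₜ Gr K N 0 where
  toEquiv := Equiv.ofBijective toGr toGr_bijective
  continuous_toFun := by
    rw [continuous_coinduced_dom]
    have h : (toGr : PSpace K N → Gr K N 0) ∘ Projectivization.mk' K = spanGr ∘ vecHomeomorph :=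
      funext toGr_mk'
    change Continuous (toGr ∘ Projectivization.mk' K)
    rw [h]
    exact continuous_coinduced_rng.comp vecHomeomorph.continuous
  continuous_invFun := by
    rw [continuous_coinduced_dom]
    have h : (Equiv.ofBijective toGr toGr_bijective).symm ∘ spanGr
        = (Projectivization.mk' K : {v : Vec K N // v ≠ 0} → PSpace K N) ∘ vecHomeomorph.symm := by
      funext M
      rw [Function.comp_apply, Equiv.symm_apply_eq]
      change _ = toGr (Projectivization.mk' K (vecHomeomorph.symm M))
      rw [toGr_mk', Homeomorph.apply_symm_apply]
    change Continuous ((Equiv.ofBijective toGr toGr_bijective).symm ∘ spanGr)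
    rw [h]
    exact continuous_coinduced_rng.comp vecHomeomorph.symm.continuous

theorem mem_cone_iff_mem_frames (X : Set (PSpace K N)) (M : Fin (0 + 1) × Fin (N + 1) → K) :
    M ∈ frames (toGr '' X) ↔ (fun j => M (0, j)) ∈ cone X := by
  rw [mem_frames_iff]
  constructor
  · rintro ⟨h, x, hx, hxM⟩
    refine ⟨h.ne_zero 0, ?_⟩
    have h1 := toGr_mk' (vecHomeomorph.symm ⟨M, h⟩)
    rw [Homeomorph.apply_symm_apply, ← hxM] at h1
    have h2 := toGr_bijective.1 h1
    rw [Projectivization.mk'_eq_mk] at h2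
    rw [← h2] at hx
    exact hx
  · rintro ⟨h, hx⟩
    have hM : (vecHomeomorph ⟨fun j => M (0, j), h⟩).1 = M := by
      have := vecHomeomorph.apply_symm_apply
        (⟨M, (linearIndependent_row_iff M).2 h⟩ : {M : Fin (0 + 1) × Fin (N + 1) → K //
            LinearIndependent K (fun i j => M (i, j) : Fin (0 + 1) → Vec K N)})
      exact congrArg Subtype.val this
    have h1 := toGr_mk' ⟨fun j => M (0, j), h⟩
    refine ⟨hM ▸ (vecHomeomorph ⟨fun j => M (0, j), h⟩).2, _, hx, ?_⟩
    rw [Projectivization.mk'_eq_mk] at h1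
    rw [h1]
    congr 1
    exact Subtype.ext hM

/-- The cone over a closed irreducible `X` is a variety of dimension `dim X + 1`. -/
theorem hasDim_cone [IsAlgClosed K] [CharZero K] {X : Set (PSpace K N)} {m : ℕ}
    (hXclosed : IsClosed X) (hXirr : IsIrreducible X)
    (hXdim : topologicalKrullDim X = (m : WithBot ℕ∞)) : HasDim (cone X) (m + 1) := by
  -- The cone is the set of frames for `k = 0`, where the group of invertible matrices has dimension
  -- `1`.
  have h1 : HasDim (frames (toGr '' X)) (m + (0 + 1) * (0 + 1)) := by
    refine hasDim_frames (grHomeomorph.isClosedMap X hXclosed)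
      (hXirr.image _ grHomeomorph.continuous.continuousOn) ?_
    rw [← hXdim]
    exact ((grHomeomorph.image X).isHomeomorph.topologicalKrullDim_eq _).symm
  refine HasDim.of_reindex (Equiv.uniqueProd (Fin (N + 1)) (Fin 1)).symm ?_
  convert h1 using 1
  ext M
  exact (mem_cone_iff_mem_frames X M).symm

end ProjectiveSpace

/-! ### Persistence of independent tangent vectors -/

section LocalExtension

variable {K σ τ : Type*} [Field K] [CharZero K] [Fintype σ] [Fintype τ]

/-- Linear independence of linear images of tangent vectors at a nonsingular point persists on
a neighbourhood, and so does nonsingularity. -/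
theorem HasDim.exists_linearIndependent_near {C : Set (σ → K)} {e m : ℕ} (hC : HasDim C e)
    {x₀ : σ → K} (hfin : Module.finrank K (tangentSpace C x₀) = e)
    (f : Fin m → (σ → K) →ₗ[K] (τ → K)) (w : Fin m → σ → K) (hw : ∀ a, w a ∈ tangentSpace C x₀)
    (hli : LinearIndependent K fun a => f a (w a)) :
    ∃ q : MvPolynomial σ K, eval x₀ q ≠ 0 ∧ ∀ x ∈ C, eval x q ≠ 0 →
      Module.finrank K (tangentSpace C x) = e ∧
        ∃ w' : Fin m → σ → K, (∀ a, w' a ∈ tangentSpace C x) ∧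
          LinearIndependent K fun a => f a (w' a) := by
  classical
  obtain ⟨D, hD, hle, hext⟩ := exists_local_extension C x₀
  choose W hW₀ hW using fun a => hext (w a) (hw a)
  obtain ⟨R, hR⟩ := exists_mul_eq_one_of_linearIndependent_rows
    (Matrix.of fun a => f a (w a) : Matrix (Fin m) τ K) hli
  let J : Matrix (Fin m) (Fin m) (MvPolynomial σ K) :=
    Matrix.of fun a b => ∑ j, ∑ s, MvPolynomial.C (f a (Pi.single s 1) j * R j b) * W a s
  have hJ : ∀ x, J.map (eval x) = (Matrix.of fun a => f a fun s => eval x (W a s) :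
      Matrix (Fin m) τ K) * R := by
    intro x
    ext a b
    simp only [J, Matrix.map_apply, Matrix.of_apply, map_sum, map_mul, eval_C, Matrix.mul_apply]
    refine Finset.sum_congr rfl fun j _ => ?_
    have h1 : f a (fun s => eval x (W a s)) j = ∑ s, f a (Pi.single s 1) j * eval x (W a s) := by
      conv_lhs => rw [pi_eq_sum_univ' fun s => eval x (W a s)]
      rw [map_sum, Finset.sum_apply]
      refine Finset.sum_congr rfl fun s _ => ?_
      rw [map_smul, Pi.smul_apply, smul_eq_mul, mul_comm]
    rw [h1, Finset.sum_mul]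
    exact Finset.sum_congr rfl fun s _ => by ring
  have hdet : ∀ x, eval x J.det = ((Matrix.of fun a => f a fun s => eval x (W a s) :
      Matrix (Fin m) τ K) * R).det := by
    intro x
    rw [RingHom.map_det, RingHom.mapMatrix_apply, hJ]
  refine ⟨D * J.det, ?_, fun x hx hq => ?_⟩
  · rw [map_mul, hdet]
    have h0 : (fun a => f a fun s => eval x₀ (W a s)) = fun a => f a (w a) := by
      funext a
      congr 1
      funext s
      exact hW₀ a s
    rw [h0, hR, det_one, mul_one]
    exact hD
  · rw [map_mul] at hq
    have hDx := left_ne_zero_of_mul hq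
    -- The bound `le_finrank` at every point of `C` excludes a drop of the tangent dimension, so the
    -- extended vector fields stay tangent.
    have hfx : Module.finrank K (tangentSpace C x) = e :=
      le_antisymm ((hle x hDx).trans hfin.le) (hC.le_finrank x hx)
    refine ⟨hfx, fun a s => eval x (W a s), fun a => hW a x hDx (by rw [hfin, hfx]), ?_⟩
    have h1 := right_ne_zero_of_mul hq
    rw [hdet] at h1
    exact linearIndependent_rows_of_det_mul_ne_zero _ _ h1

end LocalExtension

/-! ### Density of open sets in linear spaces -/

section Density

variable {K ι Y : Type*} [Field K] [Infinite K] [AddCommGroup Y] [Module K Y]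

/-- A subspace containing a nonempty Zariski open set is everything. -/
theorem submodule_eq_top_of_eval_ne_zero {P : MvPolynomial ι K} (hP : P ≠ 0)
    (S : Submodule K (ι → K)) (hS : ∀ t, eval t P ≠ 0 → t ∈ S) : S = ⊤ := by
  obtain ⟨t₀, ht₀⟩ : ∃ t₀, eval t₀ P ≠ 0 := by
    by_contra! h
    exact hP (MvPolynomial.funext fun t => by rw [h t, map_zero])
  rw [eq_top_iff]
  intro t _
  let p : Polynomial K := aeval (fun i => Polynomial.C (t₀ i) + Polynomial.C (t i) * .X) P
  have hp : ∀ s, p.eval s = eval (t₀ + s • t) P := by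
    intro s
    have h1 : (Polynomial.aeval s).comp
        (aeval fun i => Polynomial.C (t₀ i) + Polynomial.C (t i) * Polynomial.X)
        = (aeval (t₀ + s • t) : MvPolynomial ι K →ₐ[K] K) := by
      ext i
      rw [AlgHom.comp_apply, aeval_X, aeval_X, map_add, map_mul, Polynomial.aeval_C,
        Polynomial.aeval_C, Polynomial.aeval_X, Pi.add_apply, Pi.smul_apply, smul_eq_mul, mul_comm]
      rfl
    have h2 := DFunLike.congr_fun h1 P
    rwa [AlgHom.comp_apply, Polynomial.coe_aeval_eq_eval, MvPolynomial.aeval_eq_eval] at h2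
  -- The factor `X` makes the parameter `s` nonzero, so that `t` is recovered from `t₀ + s • t` and
  -- `t₀`.
  have hp0 : p * Polynomial.X ≠ 0 := by
    refine mul_ne_zero (fun h => ht₀ ?_) Polynomial.X_ne_zero
    have := hp 0
    rwa [h, Polynomial.eval_zero, zero_smul, add_zero, eq_comm] at this
  obtain ⟨s, hs⟩ : ∃ s, (p * Polynomial.X).eval s ≠ 0 := by
    by_contra! h
    exact hp0 (Polynomial.funext fun s => by rw [h s, Polynomial.eval_zero])
  rw [Polynomial.eval_mul, Polynomial.eval_X, hp] at hs
  have h1 := S.sub_mem (hS _ (left_ne_zero_of_mul hs)) (hS t₀ ht₀)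
  rw [add_sub_cancel_left] at h1
  exact (S.smul_mem_iff (right_ne_zero_of_mul hs)).1 h1

end Density

/-! ### The cone over the union and its tangent spaces -/

section Cone

variable {K : Type*} [Field K] {N : ℕ}

theorem smul_mem_cone {X : Set (PSpace K N)} {v : Vec K N} (hv : v ∈ cone X) {c : K} (hc : c ≠ 0) :
    c • v ∈ cone X := by
  obtain ⟨h, hX⟩ := hv
  refine ⟨smul_ne_zero hc h, ?_⟩
  rwa [(Projectivization.mk_eq_mk_iff' K (c • v) v (smul_ne_zero hc h) h).2 ⟨c, rfl⟩]

/-- Homotheties preserve the cone. Hence the representative chosen in `embeddedTangentSpace` does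
not matter. -/
theorem tangentSpace_cone_smul (X : Set (PSpace K N)) (v : Vec K N) {c : K} (hc : c ≠ 0) :
    tangentSpace (cone X) (c • v) = tangentSpace (cone X) v := by
  have key : ∀ (v : Vec K N) {c : K}, c ≠ 0 →
      tangentSpace (cone X) v ≤ tangentSpace (cone X) (c • v) := by
    intro v c hc w hw
    have := map_mem_tangentSpace (D := cone X) (c • LinearMap.id : Vec K N →ₗ[K] Vec K N)
      (fun x hx => smul_mem_cone hx hc) hw
    exact ((tangentSpace (cone X) (c • v)).smul_mem_iff hc).1 this
  refine le_antisymm ?_ (key v hc)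
  have := key (c • v) (inv_ne_zero hc)
  rwa [smul_smul, inv_mul_cancel₀ hc, one_smul] at this

theorem embeddedTangentSpace_mk (X : Set (PSpace K N)) (v : Vec K N) (hv : v ≠ 0) :
    embeddedTangentSpace X (Projectivization.mk K v hv) = tangentSpace (cone X) v := by
  obtain ⟨a, ha⟩ := Projectivization.exists_smul_eq_mk_rep K v hv
  rw [embeddedTangentSpace, ← ha]
  exact tangentSpace_cone_smul X v a.ne_zero

variable {k : ℕ}

theorem mem_cone_unionOf {B : Set (Gr K N k)} {v : Vec K N} :
    v ∈ cone (unionOf B) ↔ v ≠ 0 ∧ ∃ L ∈ B, v ∈ L.toSub := by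
  constructor
  · rintro ⟨h, L, hL, hv⟩
    rw [Projectivization.submodule_mk, Submodule.span_singleton_le_iff_mem] at hv
    exact ⟨h, L, hL, hv⟩
  · rintro ⟨h, L, hL, hv⟩
    refine ⟨h, L, hL, ?_⟩
    rwa [Projectivization.submodule_mk, Submodule.span_singleton_le_iff_mem]

end Cone

/-- The combination of the rows of a matrix with given coefficients. -/
def rowComb {K ι κ : Type*} [Field K] [Fintype ι] (t : ι → K) : (ι × κ → K) →ₗ[K] (κ → K) where
  toFun w := t ᵥ* rows w
  map_add' w w' := Matrix.vecMul_add (rows w) (rows w') t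
  map_smul' c w := by
    funext j
    simp [Matrix.vecMul, dotProduct, rows, Finset.mul_sum, mul_left_comm]

theorem rowComb_act {K ι κ : Type*} [Field K] [Fintype ι] (t : ι → K) (g : Matrix ι ι K)
    (w : ι × κ → K) : rowComb t (act g w) = rowComb (t ᵥ* g) w :=
  (Matrix.vecMul_vecMul t g (rows w)).symm

theorem rowComb_apply {K ι κ : Type*} [Field K] [Fintype ι] (t : ι → K) (w : ι × κ → K) :
    rowComb t w = ∑ i, t i • fun j => w (i, j) := by
  funext j
  simp [rowComb, Matrix.vecMul, dotProduct, rows]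

theorem rowComb_single {K ι κ : Type*} [Field K] [Fintype ι] [DecidableEq ι] (i : ι)
    (w : ι × κ → K) : rowComb (Pi.single i 1) w = fun j => w (i, j) :=
  Matrix.single_one_vecMul i (rows w)

/-- A rank one matrix does it. In terms of frames: an infinitesimal change of basis moves a nonzero
vector of `Λ̂` in any prescribed direction of `Λ̂`. -/
theorem exists_vecMul_eq {K ι : Type*} [Field K] [Fintype ι] {t : ι → K} (ht : t ≠ 0)
    (s : ι → K) : ∃ g : Matrix ι ι K, t ᵥ* g = s := by
  classical
  obtain ⟨i, hi⟩ := Function.ne_iff.1 ht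
  refine ⟨Matrix.vecMulVec (Pi.single i (t i)⁻¹) s, ?_⟩
  rw [Matrix.vecMul_vecMulVec, dotProduct_single, mul_inv_cancel₀ hi, one_smul]

theorem finrank_comap_mkQ {K V : Type*} [Field K] [AddCommGroup V] [Module K V]
    [FiniteDimensional K V] (L : Submodule K V) (S : Submodule K (V ⧸ L)) :
    Module.finrank K (S.comap L.mkQ) = Module.finrank K S + Module.finrank K L := by
  have h1 := LinearMap.finrank_range_add_finrank_ker (L.mkQ.domRestrict (S.comap L.mkQ))
  rw [LinearMap.range_domRestrict, Submodule.map_comap_eq_of_surjective L.mkQ_surjective] at h1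
  rw [← h1, LinearMap.ker_domRestrict, Submodule.ker_mkQ,
    (Submodule.comapSubtypeEquivOfLe (Submodule.le_comap_mkQ L S)).finrank_eq]

/-! ### Tangent vectors of the family in terms of frames -/

section TangentGr

variable {K : Type*} [Field K] {N k : ℕ} {L : Gr K N k}

/-- The frame given by a basis. -/
def basisFrame (b : Module.Basis (Fin (k + 1)) K L.toSub) : Fin (k + 1) × Fin (N + 1) → K :=
  fun p => (b p.1 : Vec K N) p.2

theorem basisFrame_mem_singleton (b : Module.Basis (Fin (k + 1)) K L.toSub) :
    basisFrame b ∈ frames {L} :=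
  ⟨L, rfl, b, fun _ _ => rfl⟩

theorem basisFrame_mem {B : Set (Gr K N k)} (hL : L ∈ B)
    (b : Module.Basis (Fin (k + 1)) K L.toSub) : basisFrame b ∈ frames B :=
  ⟨L, hL, b, fun _ _ => rfl⟩

theorem exists_eq_basisFrame {M : Fin (k + 1) × Fin (N + 1) → K} (hM : M ∈ frames {L}) :
    ∃ b : Module.Basis (Fin (k + 1)) K L.toSub, M = basisFrame b := by
  obtain ⟨_, rfl, b, hb⟩ := hM
  exact ⟨b, funext fun p => hb p.1 p.2⟩

theorem rowComb_basisFrame (b : Module.Basis (Fin (k + 1)) K L.toSub) (t : Fin (k + 1) → K) :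
    rowComb t (basisFrame b) = (b.equivFun.symm t : Vec K N) := by
  rw [rowComb_apply, Module.Basis.equivFun_symm_apply, Submodule.coe_sum]
  rfl

theorem rowComb_equivFun_basisFrame (b : Module.Basis (Fin (k + 1)) K L.toSub) (v : L.toSub) :
    rowComb (b.equivFun v) (basisFrame b) = (v : Vec K N) := by
  rw [rowComb_basisFrame, LinearEquiv.symm_apply_apply]

/-- The differential at a frame of the quotient map from frames to the Grassmannian. -/
def frameHom (b : Module.Basis (Fin (k + 1)) K L.toSub) :
    (Fin (k + 1) × Fin (N + 1) → K) →ₗ[K] (L.toSub →ₗ[K] (Vec K N ⧸ L.toSub)) where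
  toFun w := b.constr K fun i => Submodule.Quotient.mk fun j => w (i, j)
  map_add' w w' := b.ext fun i => by
    simp only [LinearMap.add_apply, Module.Basis.constr_basis]
    rfl
  map_smul' c w := b.ext fun i => by
    simp only [LinearMap.smul_apply, Module.Basis.constr_basis, RingHom.id_apply]
    rfl

theorem frameHom_basis (b : Module.Basis (Fin (k + 1)) K L.toSub)
    (w : Fin (k + 1) × Fin (N + 1) → K) (i : Fin (k + 1)) :
    frameHom b w (b i) = Submodule.Quotient.mk fun j => w (i, j) :=
  Module.Basis.constr_basis b K _ i

theorem frameHom_apply (b : Module.Basis (Fin (k + 1)) K L.toSub)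
    (w : Fin (k + 1) × Fin (N + 1) → K) (v : L.toSub) :
    frameHom b w v = L.toSub.mkQ (rowComb (b.equivFun v) w) := by
  conv_lhs => rw [← b.sum_equivFun v]
  rw [map_sum, rowComb_apply, map_sum]
  refine Finset.sum_congr rfl fun i _ => ?_
  rw [map_smul, map_smul, frameHom_basis]
  rfl

/-- The kernel consists of the directions tangent to the orbit of the frame. -/
theorem frameHom_eq_zero_iff (b : Module.Basis (Fin (k + 1)) K L.toSub)
    (w : Fin (k + 1) × Fin (N + 1) → K) :
    frameHom b w = 0 ↔ ∃ g : Matrix (Fin (k + 1)) (Fin (k + 1)) K, w = act g (basisFrame b) := by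
  constructor
  · intro h
    have h1 : ∀ i, (fun j => w (i, j)) ∈ L.toSub := by
      intro i
      rw [← Submodule.Quotient.mk_eq_zero, ← frameHom_basis b, h, LinearMap.zero_apply]
    refine ⟨Matrix.of fun i => b.equivFun ⟨_, h1 i⟩, funext fun p => ?_⟩
    exact (congrFun (rowComb_equivFun_basisFrame b ⟨_, h1 p.1⟩) p.2).symm
  · rintro ⟨g, rfl⟩
    ext v
    rw [frameHom_apply, rowComb_act, rowComb_basisFrame, LinearMap.zero_apply,
      Submodule.mkQ_apply, Submodule.Quotient.mk_eq_zero]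
    exact Subtype.coe_prop _

theorem frameHom_act {b b' : Module.Basis (Fin (k + 1)) K L.toSub}
    {g : Matrix (Fin (k + 1)) (Fin (k + 1)) K} (hg : basisFrame b' = act g (basisFrame b))
    (w : Fin (k + 1) × Fin (N + 1) → K) : frameHom b' (act g w) = frameHom b w := by
  ext v
  rw [frameHom_apply, frameHom_apply, rowComb_act]
  congr 3
  apply b.equivFun.symm.injective
  apply Subtype.ext
  rw [← rowComb_basisFrame, ← rowComb_act, ← hg, rowComb_equivFun_basisFrame,
    LinearEquiv.symm_apply_apply]

variable {B : Set (Gr K N k)}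

/-- The definition quantifies over all frames of `Λ`. Two of them differ by an invertible matrix,
which carries tangent vectors along, so one frame suffices. -/
theorem mem_tangentSpaceGr_iff (b : Module.Basis (Fin (k + 1)) K L.toSub)
    (η : L.toSub →ₗ[K] (Vec K N ⧸ L.toSub)) :
    η ∈ tangentSpaceGr B L ↔ ∃ w ∈ tangentSpace (frames B) (basisFrame b), frameHom b w = η := by
  constructor
  · intro h
    obtain ⟨w, hw, h1⟩ := h b
    exact ⟨w, hw, b.ext fun i => by rw [frameHom_basis, h1]⟩
  · rintro ⟨w, hw, rfl⟩ b'
    obtain ⟨g, hg, hb'⟩ := exists_act_eq (basisFrame_mem_singleton b) (basisFrame_mem_singleton b')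
    refine ⟨act g w, ?_, fun i => ?_⟩
    · change act g w ∈ tangentSpace (frames B) (basisFrame b')
      rw [hb']
      exact act_mem_tangentSpace_act B hg hw
    · rw [← frameHom_act hb', frameHom_basis]

theorem tangentSpaceGr_eq_map (b : Module.Basis (Fin (k + 1)) K L.toSub) :
    tangentSpaceGr B L = (tangentSpace (frames B) (basisFrame b)).map (frameHom b) := by
  ext η
  rw [mem_tangentSpaceGr_iff b, Submodule.mem_map]

theorem finrank_ker_frameHom (b : Module.Basis (Fin (k + 1)) K L.toSub) :
    Module.finrank K (LinearMap.ker (frameHom b)) = (k + 1) * (k + 1) := by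
  let T : Matrix (Fin (k + 1)) (Fin (k + 1)) K →ₗ[K] (Fin (k + 1) × Fin (N + 1) → K) :=
    { toFun := fun g => act g (basisFrame b)
      map_add' := fun g g' => rows_injective (Matrix.add_mul g g' (rows (basisFrame b)))
      map_smul' := fun c g => act_smul_left c g _ }
  have hT : Function.Injective T := by
    intro g g' h
    have hinj : Function.Injective (rows (basisFrame b)).vecMul :=
      Matrix.vecMul_injective_iff.2
        (linearIndependent_of_mem_frames (basisFrame_mem_singleton b))
    funext i
    apply hinj
    exact congrFun (congrArg rows h) i
  have hker : LinearMap.ker (frameHom b) = LinearMap.range T := by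
    ext w
    rw [LinearMap.mem_ker, frameHom_eq_zero_iff, LinearMap.mem_range]
    exact exists_congr fun g => eq_comm
  rw [hker, LinearMap.finrank_range_of_inj hT, Module.finrank_matrix, Module.finrank_self,
    Fintype.card_fin, mul_one]

/-- The orbit directions are tangent to the frames and form the kernel of `frameHom b`. So
nonsingularity of a member can be read off at any of its frames. -/
theorem finrank_tangentSpace_basisFrame [Infinite K] (hL : L ∈ B)
    (b : Module.Basis (Fin (k + 1)) K L.toSub) :
    Module.finrank K (tangentSpace (frames B) (basisFrame b))
      = Module.finrank K (tangentSpaceGr B L) + (k + 1) * (k + 1) := by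
  have hle : LinearMap.ker (frameHom b) ≤ tangentSpace (frames B) (basisFrame b) := by
    intro w hw
    obtain ⟨g, rfl⟩ := (frameHom_eq_zero_iff b w).1 hw
    exact act_mem_tangentSpace (basisFrame_mem hL b) g
  have h1 := LinearMap.finrank_range_add_finrank_ker
    ((frameHom b).domRestrict (tangentSpace (frames B) (basisFrame b)))
  rw [LinearMap.range_domRestrict, ← tangentSpaceGr_eq_map, LinearMap.ker_domRestrict,
    (Submodule.comapSubtypeEquivOfLe hle).finrank_eq, finrank_ker_frameHom] at h1
  exact h1.symm

/-- The preimage in `V` of the image of the characteristic map at `v`: the span of `Λ` and of the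
infinitely near members of the family along `v`. -/
def tangentHull (B : Set (Gr K N k)) (L : Gr K N k) (v : L.toSub) : Submodule K (Vec K N) :=
  (LinearMap.range (characteristicMap B L v)).comap L.toSub.mkQ

theorem finrank_tangentHull (v : L.toSub) : Module.finrank K (tangentHull B L v)
    = Module.finrank K (LinearMap.range (characteristicMap B L v)) + (k + 1) := by
  rw [tangentHull, finrank_comap_mkQ]
  congr 1
  exact L.2

/-- Replaces the quotient `V / Λ̂` by actual vectors. The ambiguity by a vector of `Λ̂` is absorbed
by an orbit direction, which needs `v ≠ 0`. -/
theorem mem_tangentHull_iff [Infinite K] (hL : L ∈ B) (b : Module.Basis (Fin (k + 1)) K L.toSub)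
    {v : L.toSub} (hv : v ≠ 0) (x : Vec K N) :
    x ∈ tangentHull B L v ↔
      ∃ w ∈ tangentSpace (frames B) (basisFrame b), rowComb (b.equivFun v) w = x := by
  constructor
  · rintro ⟨⟨η, hη⟩, hx⟩
    obtain ⟨w, hw, rfl⟩ := (mem_tangentSpaceGr_iff b η).1 hη
    change frameHom b w v = L.toSub.mkQ x at hx
    rw [frameHom_apply, eq_comm, ← sub_eq_zero, ← map_sub, Submodule.mkQ_apply,
      Submodule.Quotient.mk_eq_zero] at hx
    obtain ⟨g, hg⟩ := exists_vecMul_eq (t := b.equivFun v)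
      (fun h => hv (b.equivFun.map_eq_zero_iff.1 h)) (b.equivFun ⟨_, hx⟩)
    refine ⟨w + act g (basisFrame b),
      Submodule.add_mem _ hw (act_mem_tangentSpace (basisFrame_mem hL b) g), ?_⟩
    rw [map_add, rowComb_act, hg, rowComb_equivFun_basisFrame, add_sub_cancel]
  · rintro ⟨w, hw, rfl⟩
    refine ⟨⟨frameHom b w, (mem_tangentSpaceGr_iff b _).2 ⟨w, hw, rfl⟩⟩, ?_⟩
    change frameHom b w v = _
    rw [frameHom_apply]

theorem rowComb_mem_cone {t : Fin (k + 1) → K} (ht : t ≠ 0) {M : Fin (k + 1) × Fin (N + 1) → K}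
    (hM : M ∈ frames B) : rowComb t M ∈ cone (unionOf B) := by
  obtain ⟨L, hL, hM⟩ := mem_frames_singleton.1 hM
  obtain ⟨b, rfl⟩ := exists_eq_basisFrame hM
  rw [rowComb_basisFrame, mem_cone_unionOf]
  refine ⟨fun h => ht ?_, L, hL, Subtype.coe_prop _⟩
  exact b.equivFun.symm.map_eq_zero_iff.1 (Subtype.ext h)

/-- For fixed coordinates `t` of `v`, the linear map `rowComb t` sends frames into the cone, hence
tangent vectors to tangent vectors. -/
theorem tangentHull_le [Infinite K] (hL : L ∈ B) {v : L.toSub} (hv : v ≠ 0) :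
    tangentHull B L v ≤ tangentSpace (cone (unionOf B)) (v : Vec K N) := by
  let b := Module.finBasisOfFinrankEq K L.toSub L.2
  intro x hx
  obtain ⟨w, hw, rfl⟩ := (mem_tangentHull_iff hL b hv x).1 hx
  have ht : b.equivFun v ≠ 0 := fun h => hv (b.equivFun.map_eq_zero_iff.1 h)
  have := map_mem_tangentSpace (rowComb (b.equivFun v)) (D := cone (unionOf B))
    (fun M hM => rowComb_mem_cone ht hM) hw
  rwa [rowComb_equivFun_basisFrame] at this

end TangentGr

/-- The polynomials giving `t ↦ rowComb t M`. -/
def rowCombPoly {K ι κ : Type*} [Field K] [Fintype ι] (M : ι × κ → K) (j : κ) :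
    MvPolynomial ι K :=
  ∑ i, C (M (i, j)) * X i

theorem eval_bind₁_rowCombPoly {K ι κ : Type*} [Field K] [Fintype ι] (M : ι × κ → K)
    (P : MvPolynomial κ K) (t : ι → K) :
    eval t (bind₁ (rowCombPoly M) P) = eval (rowComb t M) P := by
  rw [← aeval_eq_eval, aeval_bind₁, ← aeval_eq_eval]
  congr 2
  funext j
  rw [rowComb_apply]
  simp [rowCombPoly, mul_comm, aeval_eq_eval]

/-! ### Families whose union has the expected dimension -/

section RuledFamily

variable {K : Type*} [Field K] {N k n : ℕ} {B : Set (Gr K N k)} {L : Gr K N k}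

/-- The standing assumptions on a family whose union has the expected dimension. -/
structure IsRuledFamily (B : Set (Gr K N k)) (n : ℕ) : Prop where
  dim_eq : topologicalKrullDim B = (n : WithBot ℕ∞)
  dim_union : topologicalKrullDim (unionOf B) = ((n + k : ℕ) : WithBot ℕ∞)
  irreducible : IsIrreducible B
  hasDim_frames : HasDim (frames B) (n + (k + 1) * (k + 1))
  hasDim_cone : HasDim (cone (unionOf B)) (n + k + 1)
  lt : n + k < N

namespace IsRuledFamily

variable (h : IsRuledFamily B n)
include h

theorem isSmoothMember_iff : IsSmoothMember B L ↔
    L ∈ B ∧ Module.finrank K (tangentSpaceGr B L) = n := by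
  rw [IsSmoothMember, h.dim_eq]
  norm_cast

theorem isSmoothMember_iff_frame [Infinite K] (hL : L ∈ B)
    (b : Module.Basis (Fin (k + 1)) K L.toSub) : IsSmoothMember B L ↔
      Module.finrank K (tangentSpace (frames B) (basisFrame b)) = n + (k + 1) * (k + 1) := by
  rw [h.isSmoothMember_iff, finrank_tangentSpace_basisFrame hL, add_left_inj]
  exact and_iff_right hL

/-- The codimension `N - k` of `Λ̂` exceeds `n`, so maximal rank means injectivity of the
characteristic map. -/
theorem maxRank_eq (hL : IsSmoothMember B L) : maxRank B L = n := by
  have h1 := Submodule.finrank_quotient_add_finrank L.toSub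
  rw [show Module.finrank K L.toSub = k + 1 from L.2, Module.finrank_fin_fun] at h1
  rw [maxRank, (h.isSmoothMember_iff.1 hL).2]
  have := h.lt
  omega

theorem finrank_tangentHull_le (hL : IsSmoothMember B L) (v : L.toSub) :
    Module.finrank K (tangentHull B L v) ≤ n + k + 1 := by
  rw [finrank_tangentHull, ← (h.isSmoothMember_iff.1 hL).2, add_assoc]
  exact Nat.add_le_add_right (LinearMap.finrank_range_le _) _

theorem not_isFocalAt_iff_le (hL : IsSmoothMember B L) (v : L.toSub) :
    ¬ IsFocalAt B L v ↔ n + k + 1 ≤ Module.finrank K (tangentHull B L v) := by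
  rw [IsFocalAt, h.maxRank_eq hL, finrank_tangentHull]
  omega

theorem not_isFocalAt_iff (hL : IsSmoothMember B L) (v : L.toSub) :
    ¬ IsFocalAt B L v ↔ Module.finrank K (tangentHull B L v) = n + k + 1 := by
  rw [h.not_isFocalAt_iff_le hL]
  exact ⟨(h.finrank_tangentHull_le hL v).antisymm, fun h => h.ge⟩

theorem isSmoothPoint_mk_iff (v : Vec K N) (hv : v ≠ 0) :
    IsSmoothPoint (unionOf B) (Projectivization.mk K v hv) ↔ v ∈ cone (unionOf B) ∧
      Module.finrank K (tangentSpace (cone (unionOf B)) v) = n + k + 1 := by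
  have h1 : v ∈ cone (unionOf B) ↔ Projectivization.mk K v hv ∈ unionOf B :=
    ⟨fun h => h.2, fun h => ⟨hv, h⟩⟩
  rw [IsSmoothPoint, embeddedTangentSpace_mk, h.dim_union, h1]
  norm_cast

variable [CharZero K]

/-- A general member is nonsingular and has points which are not focal. -/
theorem exists_not_allFocal : ∃ L, IsSmoothMember B L ∧ ¬ AllFocal B L := by
  have := h.hasDim_frames.1
  obtain ⟨Q₁, hQ₁, hQ₁'⟩ := h.hasDim_frames.exists_finrank_eq
  -- Generic smoothness of the map taking a frame to its first row, from the frames to the cone over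
  -- `X`.
  obtain ⟨Q₂, hQ₂, hQ₂'⟩ := HasDim.exists_linearIndependent_diffMap
    h.hasDim_frames.1 h.hasDim_cone (fun j => X ((0 : Fin (k + 1)), j)) (by
      intro Q
      have heval : ∀ M : Fin (k + 1) × Fin (N + 1) → K,
          eval M (bind₁ (fun j => X ((0 : Fin (k + 1)), j)) Q) =
            eval (rowComb (Pi.single 0 1) M) Q := by
        intro M
        rw [rowComb_single, ← aeval_eq_eval, aeval_bind₁, ← aeval_eq_eval]
        simp
      rw [mem_vanishingIdeal_iff_eval, mem_vanishingIdeal_iff_eval]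
      constructor
      · intro hQ M hM
        rw [heval]
        exact hQ _ (rowComb_mem_cone (by simp) hM)
      · intro hQ v hv
        obtain ⟨-, L, hL, hv⟩ := mem_cone_unionOf.1 hv
        let b := Module.finBasisOfFinrankEq K L.toSub L.2
        -- Dominance without completing `v` to a basis: the polynomial in `g` vanishes for
        -- invertible `g`, hence for all `g`, in particular for the matrix all of whose rows are the
        -- coordinates of `v`.
        have h0 : bind₁ (fun j => orbitPoly (basisFrame b) (0, j)) Q = 0 := by
          apply vanishingIdeal_det_ne_zero
          intro g hg
          have h1 := hQ _ (act_mem_frames (basisFrame_mem hL b) hg)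
          rw [heval, rowComb_single, ← eval_orbitPoly] at h1
          rw [← aeval_eq_eval, aeval_bind₁, aeval_eq_eval]
          exact h1
        have h2 := congrArg (eval fun p : Fin (k + 1) × Fin (k + 1) => b.equivFun ⟨v, hv⟩ p.2) h0
        rw [← aeval_eq_eval, aeval_bind₁, map_zero, aeval_eq_eval] at h2
        have h3 : (fun j => eval (fun p : Fin (k + 1) × Fin (k + 1) => b.equivFun ⟨v, hv⟩ p.2)
            (orbitPoly (basisFrame b) (0, j))) = v := by
          refine Eq.trans (funext fun j => ?_) (rowComb_equivFun_basisFrame b ⟨v, hv⟩)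
          exact congrFun (eval_orbitPoly (basisFrame b) _) (0, j)
        rw [aeval_eq_eval] at h2
        exact (congrArg (fun x => eval x Q) h3.symm).trans h2)
  obtain ⟨M, hM, hQ⟩ := exists_eval_ne_zero (C := frames B) (P := Q₁ * Q₂)
    (fun hmem => (Ideal.IsPrime.mem_or_mem this hmem).elim hQ₁ hQ₂)
  rw [map_mul] at hQ
  have hfin := hQ₁' M hM (left_ne_zero_of_mul hQ)
  obtain ⟨W, hW, hli⟩ := hQ₂' M hM (right_ne_zero_of_mul hQ)
  obtain ⟨L, hL, hM⟩ := mem_frames_singleton.1 hM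
  obtain ⟨b, rfl⟩ := exists_eq_basisFrame hM
  have hsm := (h.isSmoothMember_iff_frame hL b).2 hfin
  refine ⟨L, hsm, fun hall => ?_⟩
  have hb0 := b.ne_zero 0
  refine (h.not_isFocalAt_iff_le hsm (b 0)).2 ?_ (hall (b 0) hb0)
  have hmem : ∀ i, diffMap (fun j => X (0, j) :
      Fin (N + 1) → MvPolynomial (Fin (k + 1) × Fin (N + 1)) K) (basisFrame b) (W i)
      ∈ tangentHull B L (b 0) := by
    intro i
    refine (mem_tangentHull_iff hL b hb0 _).2 ⟨W i, hW i, ?_⟩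
    have h1 : b.equivFun (b 0) = Pi.single 0 1 := by
      funext i
      rw [Module.Basis.equivFun_self, Pi.single_apply]
      simp only [eq_comm]
    funext j
    rw [diffMap_apply]
    have h2 : grad (basisFrame b) (X ((0 : Fin (k + 1)), j) :
        MvPolynomial (Fin (k + 1) × Fin (N + 1)) K) = Pi.single ((0 : Fin (k + 1)), j) 1 := by
      funext p
      rw [grad, pderiv_X, Pi.single_apply, Pi.single_apply]
      simp only [eq_comm, apply_ite (aeval (basisFrame b)), map_one, map_zero]
    rw [h1, rowComb_single, h2, single_one_dotProduct]
  have hli' : LinearIndependent K fun i => (⟨_, hmem i⟩ : tangentHull B L (b 0)) :=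
    LinearIndependent.of_comp (Submodule.subtype _) hli
  simpa using hli'.fintype_card_le_finrank

/-- Nonsingularity of a member and independence of tangent directions are open conditions. -/
theorem exists_isOpen_linearIndependent (hL : IsSmoothMember B L)
    (b : Module.Basis (Fin (k + 1)) K L.toSub) {m : ℕ} (t : Fin m → Fin (k + 1) → K)
    (w : Fin m → Fin (k + 1) × Fin (N + 1) → K)
    (hw : ∀ a, w a ∈ tangentSpace (frames B) (basisFrame b))
    (hli : LinearIndependent K fun a => rowComb (t a) (w a)) :
    ∃ O : Set (Gr K N k), IsOpen O ∧ L ∈ O ∧ ∀ L' ∈ O, L' ∈ B → IsSmoothMember B L' ∧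
      ∃ (b' : Module.Basis (Fin (k + 1)) K L'.toSub)
        (w' : Fin m → Fin (k + 1) × Fin (N + 1) → K),
        (∀ a, w' a ∈ tangentSpace (frames B) (basisFrame b')) ∧
        LinearIndependent K fun a => rowComb (t a) (w' a) := by
  obtain ⟨q, hq, hq'⟩ := h.hasDim_frames.exists_linearIndependent_near
    ((h.isSmoothMember_iff_frame hL.1 b).1 hL) (fun a => rowComb (t a)) w hw hli
  refine ⟨_, isOpen_exists_frame q, ⟨_, basisFrame_mem_singleton b, hq⟩, ?_⟩
  rintro L' ⟨M, hM, hqM⟩ hL'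
  obtain ⟨b', rfl⟩ := exists_eq_basisFrame hM
  obtain ⟨h1, h2⟩ := hq' _ (basisFrame_mem hL' b') hqM
  exact ⟨(h.isSmoothMember_iff_frame hL' b').2 h1, b', h2⟩

/-- The nonsingular members with a point that is not focal form an open set. -/
theorem exists_isOpen_not_allFocal (hL : IsSmoothMember B L) (hf : ¬ AllFocal B L) :
    ∃ O : Set (Gr K N k), IsOpen O ∧ L ∈ O ∧ ∀ L' ∈ O, L' ∈ B →
      IsSmoothMember B L' ∧ ¬ AllFocal B L' := by
  rw [AllFocal] at hf
  push Not at hf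
  obtain ⟨v, hv, hf⟩ := hf
  rw [h.not_isFocalAt_iff hL] at hf
  let b := Module.finBasisOfFinrankEq K L.toSub L.2
  -- A nonfocal point is witnessed by `n + k + 1` independent vectors of its hull. They persist on
  -- nearby members, at the point with the same coordinates.
  let e := Module.finBasisOfFinrankEq K (tangentHull B L v) hf
  choose w hw hwe using fun a => (mem_tangentHull_iff hL.1 b hv _).1 (e a).2
  obtain ⟨O, hO, hLO, hO'⟩ := h.exists_isOpen_linearIndependent hL b (fun _ => b.equivFun v) w hw
    (by
      simp only [hwe]
      exact e.linearIndependent.map' (Submodule.subtype _) (Submodule.ker_subtype _))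
  refine ⟨O, hO, hLO, fun L' hL'O hL' => ?_⟩
  obtain ⟨hsm, b', w', hw', hli⟩ := hO' L' hL'O hL'
  refine ⟨hsm, fun hall => ?_⟩
  have hv' : b'.equivFun.symm (b.equivFun v) ≠ 0 := fun h0 =>
    hv (b.equivFun.map_eq_zero_iff.1 (b'.equivFun.symm.map_eq_zero_iff.1 h0))
  refine (h.not_isFocalAt_iff_le hsm _).2 ?_ (hall _ hv')
  have hmem : ∀ a, rowComb (b.equivFun v) (w' a)
      ∈ tangentHull B L' (b'.equivFun.symm (b.equivFun v)) := fun a =>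
    (mem_tangentHull_iff hL' b' hv' _).2 ⟨w' a, hw' a, by rw [LinearEquiv.apply_symm_apply]⟩
  have hli' : LinearIndependent K fun a =>
      (⟨_, hmem a⟩ : tangentHull B L' (b'.equivFun.symm (b.equivFun v))) :=
    LinearIndependent.of_comp (Submodule.subtype _) hli
  simpa using hli'.fintype_card_le_finrank

/-- Smoothness is an open condition on the points of the cone. -/
theorem exists_eval_ne_zero_of_smooth {v : Vec K N}
    (hfin : Module.finrank K (tangentSpace (cone (unionOf B)) v) = n + k + 1) :
    ∃ q : MvPolynomial (Fin (N + 1)) K, eval v q ≠ 0 ∧ ∀ x ∈ cone (unionOf B), eval x q ≠ 0 →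
      Module.finrank K (tangentSpace (cone (unionOf B)) x) = n + k + 1 := by
  -- With an empty family of vectors only the constancy of the tangent dimension remains.
  obtain ⟨q, hq, hq'⟩ := h.hasDim_cone.exists_linearIndependent_near hfin
    (m := 0) (τ := Fin 0) (fun _ => 0) (fun _ => 0) (fun a => a.elim0)
    linearIndependent_empty_type
  exact ⟨q, hq, fun x hx hx0 => (hq' x hx hx0).1⟩

/-- The general member contains smooth points of the union. -/
theorem exists_isOpen_exists_smooth : ∃ O : Set (Gr K N k), IsOpen O ∧ (B ∩ O).Nonempty ∧
    ∀ L ∈ O, L ∈ B → ∃ v ∈ L.toSub, ∃ hv : v ≠ 0,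
      IsSmoothPoint (unionOf B) (Projectivization.mk K v hv) := by
  obtain ⟨Q, hQ, hQ'⟩ := h.hasDim_cone.exists_finrank_eq
  obtain ⟨v, hv, hv0⟩ := exists_eval_ne_zero hQ
  obtain ⟨hvne, L, hL, hvL⟩ := mem_cone_unionOf.1 hv
  let b := Module.finBasisOfFinrankEq K L.toSub L.2
  let t := b.equivFun ⟨v, hvL⟩
  have ht : t ≠ 0 := fun h0 =>
    hvne (congrArg Subtype.val (b.equivFun.map_eq_zero_iff.1 h0))
  -- The coordinates `t` of one smooth point are kept fixed while the frame varies.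
  let q : MvPolynomial (Fin (k + 1) × Fin (N + 1)) K := bind₁ (fun j => ∑ i, C (t i) * X (i, j)) Q
  have hq : ∀ M, eval M q = eval (rowComb t M) Q := by
    intro M
    rw [← aeval_eq_eval, aeval_bind₁, ← aeval_eq_eval]
    congr 2
    funext j
    rw [rowComb_apply]
    simp
  refine ⟨_, isOpen_exists_frame q, ⟨L, hL, _, basisFrame_mem_singleton b, ?_⟩, ?_⟩
  · rw [hq, rowComb_equivFun_basisFrame]
    exact hv0
  · rintro L' ⟨M, hM, hqM⟩ hL'
    have hc := rowComb_mem_cone (B := B) ht (mem_frames_singleton.2 ⟨L', hL', hM⟩)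
    obtain ⟨b', rfl⟩ := exists_eq_basisFrame hM
    rw [hq] at hqM
    have hmem : rowComb t (basisFrame b') ∈ L'.toSub := by
      rw [rowComb_basisFrame]
      exact Subtype.coe_prop _
    exact ⟨_, hmem, hc.1, (h.isSmoothPoint_mk_iff _ _).2 ⟨hc, hQ' _ hc hqM⟩⟩

end IsRuledFamily

end RuledFamily

/-- Linearly independent vectors have a dual family of functionals. -/
theorem _root_.LinearIndependent.exists_dual {K Y ι : Type*} [Field K] [AddCommGroup Y]
    [Module K Y] [Fintype ι] [DecidableEq ι] {y : ι → Y} (hy : LinearIndependent K y) :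
    ∃ φ : ι → Module.Dual K Y, ∀ i j, φ j (y i) = (1 : Matrix ι ι K) i j := by
  obtain ⟨g, hg⟩ := LinearMap.exists_leftInverse_of_injective (Fintype.linearCombination K y)
    (LinearMap.ker_eq_bot.2 (hy.fintypeLinearCombination_injective))
  refine ⟨fun j => (LinearMap.proj j).comp g, fun i j => ?_⟩
  have h1 := LinearMap.congr_fun hg (Pi.single i 1)
  rw [LinearMap.comp_apply, Fintype.linearCombination_apply_single, one_smul] at h1
  rw [LinearMap.comp_apply, h1, LinearMap.id_apply, LinearMap.proj_apply, Pi.single_apply,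
    Matrix.one_apply]
  simp only [eq_comm]

/-- An injective linear map from a space of dimension `n` has a dual family of functionals. -/
theorem exists_basis_dual_of_finrank_range {K W Y : Type*} [Field K] [AddCommGroup W] [Module K W]
    [FiniteDimensional K W] [AddCommGroup Y] [Module K Y] {n : ℕ} (f : W →ₗ[K] Y)
    (hW : Module.finrank K W = n) (hf : Module.finrank K (LinearMap.range f) = n) :
    ∃ (η : Module.Basis (Fin n) K W) (φ : Fin n → Module.Dual K Y),
      ∀ i j, φ j (f (η i)) = (1 : Matrix (Fin n) (Fin n) K) i j := by
  let η := Module.finBasisOfFinrankEq K W hW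
  have hker : LinearMap.ker f = ⊥ := by
    have h1 := LinearMap.finrank_range_add_finrank_ker f
    rw [← Submodule.finrank_eq_zero (R := K)]
    omega
  obtain ⟨φ, hφ⟩ := (η.linearIndependent.map' f hker).exists_dual
  exact ⟨η, φ, hφ⟩

theorem linearIndependent_of_det_dual_ne_zero {K Y ι : Type*} [Field K] [AddCommGroup Y]
    [Module K Y] [Fintype ι] [DecidableEq ι] (y : ι → Y) (φ : ι → Module.Dual K Y)
    (h : (Matrix.of fun i j => φ j (y i) : Matrix ι ι K).det ≠ 0) : LinearIndependent K y := by
  have h1 : LinearIndependent K (Matrix.of fun i j => φ j (y i) : Matrix ι ι K).row :=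
    Matrix.linearIndependent_rows_of_isUnit
      ((Matrix.isUnit_iff_isUnit_det _).2 (isUnit_iff_ne_zero.2 h))
  exact LinearIndependent.of_comp (LinearMap.pi φ) h1

/-! ### Constant tangent space and fixed image of the characteristic map -/

section CharEntry

variable {K : Type*} [Field K] {N k n : ℕ} {B : Set (Gr K N k)} {L : Gr K N k}

theorem eval_charEntry (b : Module.Basis (Fin (k + 1)) K L.toSub)
    (η : L.toSub →ₗ[K] (Vec K N ⧸ L.toSub)) (φ : Module.Dual K (Vec K N ⧸ L.toSub))
    (t : Fin (k + 1) → K) :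
    eval t (charEntry L b η φ) = φ (η (b.equivFun.symm t)) := by
  rw [Module.Basis.equivFun_symm_apply, map_sum, map_sum, charEntry, map_sum]
  refine Finset.sum_congr rfl fun l _ => ?_
  rw [map_mul, eval_C, eval_X, map_smul, map_smul, smul_eq_mul, mul_comm]

theorem eval_det_charEntry {ι : Type*} [Fintype ι] [DecidableEq ι]
    (b : Module.Basis (Fin (k + 1)) K L.toSub)
    (η : ι → L.toSub →ₗ[K] (Vec K N ⧸ L.toSub)) (φ : ι → Module.Dual K (Vec K N ⧸ L.toSub))
    (t : Fin (k + 1) → K) :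
    eval t (Matrix.of fun i j => charEntry L b (η i) (φ j) :
      Matrix ι ι (MvPolynomial (Fin (k + 1)) K)).det =
      (Matrix.of fun i j => φ j (η i (b.equivFun.symm t)) : Matrix ι ι K).det := by
  rw [RingHom.map_det]
  congr 1
  ext i j
  exact eval_charEntry b (η i) (φ j) t

namespace IsRuledFamily

variable (h : IsRuledFamily B n)
include h

theorem not_isFocalAt_of_linearIndependent (hL : IsSmoothMember B L) (v : L.toSub)
    (η : Fin n → tangentSpaceGr B L) (hli : LinearIndependent K fun i => (η i).1 v) :
    ¬ IsFocalAt B L v := by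
  rw [h.not_isFocalAt_iff_le hL, finrank_tangentHull]
  have hli' : LinearIndependent K fun i =>
      (⟨_, η i, rfl⟩ : LinearMap.range (characteristicMap B L v)) :=
    LinearIndependent.of_comp (Submodule.subtype _) hli
  have := hli'.fintype_card_le_finrank
  rw [Fintype.card_fin] at this
  omega

/-- At a point which is not focal the characteristic map is injective. -/
theorem exists_basis_dual (hL : IsSmoothMember B L) {v : L.toSub} (hv : ¬ IsFocalAt B L v) :
    ∃ (η : Module.Basis (Fin n) K (tangentSpaceGr B L))
      (φ : Fin n → Module.Dual K (Vec K N ⧸ L.toSub)),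
      ∀ i j, φ j ((η i).1 v) = (1 : Matrix (Fin n) (Fin n) K) i j := by
  have h2 := (h.not_isFocalAt_iff hL v).1 hv
  rw [finrank_tangentHull] at h2
  exact exists_basis_dual_of_finrank_range (W := tangentSpaceGr B L) (Y := Vec K N ⧸ L.toSub)
    (characteristicMap B L v) (h.isSmoothMember_iff.1 hL).2 (by omega)

variable [CharZero K]

/-- If the tangent space is constant along a member then it contains all its infinitely near
members. -/
theorem rowComb_mem_of_tangentConstantAlong (hL : L ∈ B)
    (hT : TangentConstantAlong (unionOf B) L) : ∃ T : Submodule K (Vec K N),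
      Module.finrank K T = n + k + 1 ∧ ∀ b : Module.Basis (Fin (k + 1)) K L.toSub,
        ∀ w ∈ tangentSpace (frames B) (basisFrame b), ∀ t, rowComb t w ∈ T := by
  obtain ⟨⟨x, hxL, hx⟩, T, hT⟩ := hT
  have hTx := hT x hxL hx
  induction x using Projectivization.ind with | h v hv
  rw [Projectivization.submodule_mk, Submodule.span_singleton_le_iff_mem] at hxL
  rw [embeddedTangentSpace_mk] at hTx
  obtain ⟨hvc, hfin⟩ := (h.isSmoothPoint_mk_iff v hv).1 hx
  refine ⟨T, hTx ▸ hfin, fun b w hw => ?_⟩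
  obtain ⟨q, hq, hq'⟩ := h.exists_eval_ne_zero_of_smooth hfin
  -- Where `rowComb t` of the frame is a smooth point, `rowComb t w` lies in the hull there, hence
  -- in `T`. Such `t` contain a nonempty open set, so the linear condition on `t` holds for all `t`.
  have htop : T.comap (rows w).vecMulLinear = ⊤ := by
    refine submodule_eq_top_of_eval_ne_zero (P := bind₁ (rowCombPoly (basisFrame b)) q) ?_ _ ?_
    · intro h0
      have := eval_bind₁_rowCombPoly (basisFrame b) q (b.equivFun ⟨v, hxL⟩)
      rw [h0, map_zero, rowComb_equivFun_basisFrame] at this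
      exact hq this.symm
    · intro t ht
      rw [eval_bind₁_rowCombPoly] at ht
      change rowComb t w ∈ T
      rcases eq_or_ne t 0 with rfl | ht0
      · convert T.zero_mem using 1
        exact Matrix.zero_vecMul (rows w)
      · have hc := rowComb_mem_cone ht0 (basisFrame_mem hL b)
        have hv' : b.equivFun.symm t ≠ 0 := fun h0 => ht0 (b.equivFun.symm.map_eq_zero_iff.1 h0)
        have hT' := hT (Projectivization.mk K _ hc.1) (by
          rw [Projectivization.submodule_mk, Submodule.span_singleton_le_iff_mem,
            rowComb_basisFrame]
          exact Subtype.coe_prop _) ((h.isSmoothPoint_mk_iff _ _).2 ⟨hc, hq' _ hc ht⟩)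
        rw [embeddedTangentSpace_mk, rowComb_basisFrame] at hT'
        rw [← hT']
        refine tangentHull_le hL hv' ((mem_tangentHull_iff hL b hv' _).2 ⟨w, hw, ?_⟩)
        rw [LinearEquiv.apply_symm_apply]
  exact fun t => (htop ▸ Submodule.mem_top : t ∈ T.comap (rows w).vecMulLinear)

/-- If the tangent space is constant along general members then, along every nonsingular member,
the images of the characteristic map lie in a fixed space. -/
theorem range_le_of_tangentConstantAlong {U : Set (Gr K N k)} (hU : IsOpen U)
    (hUB : (U ∩ B).Nonempty) (hUT : ∀ L ∈ U ∩ B, TangentConstantAlong (unionOf B) L)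
    (hL : IsSmoothMember B L) {v₀ : L.toSub} (hv₀ : v₀ ≠ 0) (hf : ¬ IsFocalAt B L v₀)
    (v : L.toSub) :
    LinearMap.range (characteristicMap B L v) ≤ LinearMap.range (characteristicMap B L v₀) := by
  by_contra hle
  obtain ⟨_, ⟨η, rfl⟩, hη⟩ := SetLike.not_le_iff_exists.1 hle
  let b := Module.finBasisOfFinrankEq K L.toSub L.2
  let e := Module.finBasisOfFinrankEq K (tangentHull B L v₀) ((h.not_isFocalAt_iff hL v₀).1 hf)
  choose w hw hwe using fun a => (mem_tangentHull_iff hL.1 b hv₀ _).1 (e a).2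
  obtain ⟨w₁, hw₁, hw₁η⟩ := (mem_tangentSpaceGr_iff b η.1).1 η.2
  have hspan : Submodule.span K (Set.range fun a => (e a : Vec K N)) = tangentHull B L v₀ := by
    have h1 := congrArg (Submodule.map (tangentHull B L v₀).subtype) e.span_eq
    rw [Submodule.map_span, ← Set.range_comp, Submodule.map_top, Submodule.range_subtype] at h1
    exact h1
  -- A basis of the hull at `v₀` with one more vector from the hull at `v`: `n + k + 2` vectors, too
  -- many for the tangent space of a general member.
  have hli : LinearIndependent K
      (Fin.cons (rowComb (b.equivFun v) w₁) fun a => (e a : Vec K N) :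
        Fin (n + k + 1 + 1) → Vec K N) := by
    rw [linearIndependent_finCons]
    refine ⟨e.linearIndependent.map' (Submodule.subtype _) (Submodule.ker_subtype _), fun hmem =>
      hη ?_⟩
    rw [hspan] at hmem
    change L.toSub.mkQ _ ∈ LinearMap.range (characteristicMap B L v₀) at hmem
    rwa [← frameHom_apply, hw₁η] at hmem
  obtain ⟨O, hO, hLO, hO'⟩ := h.exists_isOpen_linearIndependent hL b
    (Fin.cons (b.equivFun v) fun _ : Fin (n + k + 1) => b.equivFun v₀)
    (Fin.cons w₁ w : Fin (n + k + 1 + 1) → _)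
    (fun a => by
      refine Fin.cases ?_ (fun a => ?_) a
      · exact hw₁
      · exact hw a)
    (by
      convert hli using 1
      funext a
      refine Fin.cases ?_ (fun a => ?_) a
      · rfl
      · exact hwe a)
  -- `B` is irreducible, so some member near `L` has constant tangent space.
  obtain ⟨L', hL'B, hL'U, hL'O⟩ := h.irreducible.2 U O hU hO (by rwa [Set.inter_comm])
    ⟨L, hL.1, hLO⟩
  obtain ⟨-, b', w', hw', hli'⟩ := hO' L' hL'O hL'B
  obtain ⟨T, hT, hT'⟩ := h.rowComb_mem_of_tangentConstantAlong hL'B (hUT L' ⟨hL'U, hL'B⟩)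
  have hli'' : LinearIndependent K fun a => (⟨_, hT' b' (w' a) (hw' a) _⟩ : T) :=
    LinearIndependent.of_comp (Submodule.subtype _) hli'
  have := hli''.fintype_card_le_finrank
  rw [Fintype.card_fin, hT] at this
  omega

/-- If the images of the characteristic map along a member lie in a fixed space then the tangent
space is constant along that member. -/
theorem tangentConstantAlong_of_range_le (hL : IsSmoothMember B L) {v₀ : L.toSub}
    (hf : ¬ IsFocalAt B L v₀)
    (hle : ∀ v, LinearMap.range (characteristicMap B L v)
      ≤ LinearMap.range (characteristicMap B L v₀))
    (hs : ∃ x : PSpace K N, x.submodule ≤ L.toSub ∧ IsSmoothPoint (unionOf B) x) :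
    TangentConstantAlong (unionOf B) L := by
  refine ⟨hs, tangentHull B L v₀, fun x hxL hx => ?_⟩
  induction x using Projectivization.ind with | h v hv
  rw [Projectivization.submodule_mk, Submodule.span_singleton_le_iff_mem] at hxL
  rw [embeddedTangentSpace_mk]
  obtain ⟨hvc, hfin⟩ := (h.isSmoothPoint_mk_iff v hv).1 hx
  symm
  -- The smooth point `v` may be focal. The inclusion therefore comes from the nonfocal points of
  -- `Λ`, by density, and not from the hull at `v`.
  refine Submodule.eq_of_le_of_finrank_eq ?_ (by rw [hfin, (h.not_isFocalAt_iff hL v₀).1 hf])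
  intro u hu
  rw [mem_tangentSpace]
  intro P hP
  let b := Module.finBasisOfFinrankEq K L.toSub L.2
  obtain ⟨η, φ, hηφ⟩ := h.exists_basis_dual hL hf
  let Δ := (Matrix.of fun i j => charEntry L b (η i).1 (φ j) :
    Matrix (Fin n) (Fin n) (MvPolynomial (Fin (k + 1)) K)).det
  have hΔ : Δ ≠ 0 := by
    intro h0
    have h1 := eval_det_charEntry b (fun i => (η i).1) φ (b.equivFun v₀)
    rw [LinearEquiv.symm_apply_apply] at h1
    simp only [hηφ] at h1
    change eval _ Δ = (1 : Matrix (Fin n) (Fin n) K).det at h1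
    rw [h0, map_zero, det_one] at h1
    exact zero_ne_one h1
  -- The condition that `u` is killed by the differential of `P`, as a polynomial in the coordinates
  -- of the point of `Λ`.
  let G := bind₁ (rowCombPoly (basisFrame b)) (∑ j, C (u j) * pderiv j P)
  have hG : ∀ t, eval t G = grad (rowComb t (basisFrame b)) P ⬝ᵥ u := by
    intro t
    rw [eval_bind₁_rowCombPoly, map_sum]
    refine Finset.sum_congr rfl fun j _ => ?_
    rw [map_mul, eval_C, mul_comm]
    rfl
  -- `Δ` is nonzero only at nonfocal points, and `X 0` only away from the origin.
  have h0 : G * (Δ * X 0) = 0 := by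
    apply MvPolynomial.funext
    intro t
    rw [map_zero, map_mul]
    by_contra hne
    have hne' := right_ne_zero_of_mul hne
    rw [map_mul, eval_X] at hne'
    have ht0 : t ≠ 0 := fun h0 => right_ne_zero_of_mul hne' (congrFun h0 0)
    have hv' : b.equivFun.symm t ≠ 0 := fun h0 => ht0 (b.equivFun.symm.map_eq_zero_iff.1 h0)
    have hdet : (Matrix.of fun i j => φ j ((η i).1 (b.equivFun.symm t)) :
        Matrix (Fin n) (Fin n) K).det ≠ 0 := by
      rw [← eval_det_charEntry]
      exact left_ne_zero_of_mul hne'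
    have hf' := h.not_isFocalAt_of_linearIndependent hL (b.equivFun.symm t) η
      (linearIndependent_of_det_dual_ne_zero _ φ hdet)
    have heq : tangentHull B L (b.equivFun.symm t) = tangentHull B L v₀ :=
      Submodule.eq_of_le_of_finrank_eq (Submodule.comap_mono (hle _))
        (by rw [(h.not_isFocalAt_iff hL _).1 hf, (h.not_isFocalAt_iff hL _).1 hf'])
    rw [← heq] at hu
    have hu' := tangentHull_le hL.1 hv' hu
    rw [mem_tangentSpace] at hu'
    refine left_ne_zero_of_mul hne ?_
    rw [hG, rowComb_basisFrame]
    exact hu' P hP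
  have hG0 : G = 0 := (mul_eq_zero.1 h0).resolve_right (mul_ne_zero hΔ (X_ne_zero 0))
  have h1 := hG (b.equivFun ⟨v, hxL⟩)
  rw [hG0, map_zero, rowComb_equivFun_basisFrame] at h1
  exact h1.symm

end IsRuledFamily

end CharEntry

/-! ### Divisibility of forms and saturation -/

section Forms

variable {K : Type*} [Field K]

/-- In at least two variables a hypersurface has no other equations than the multiples of its form,
even up to saturation. -/
theorem dvd_of_irrelevant_pow_mul_mem {σ : Type*} {i j : σ} (hij : i ≠ j) {F P : MvPolynomial σ K}
    (hF : F ≠ 0) {m : ℕ} (h : ∀ Q ∈ Ideal.span (Set.range (X (R := K) (σ := σ))) ^ m,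
      Q * P ∈ Ideal.span {F}) : F ∣ P := by
  have hX : ∀ l, F ∣ X l ^ m * P := fun l => Ideal.mem_span_singleton.1
    (h _ (Ideal.pow_mem_pow (Ideal.subset_span (Set.mem_range_self l)) m))
  obtain ⟨u, hu⟩ := hX i
  obtain ⟨w, hw⟩ := hX j
  -- The two quotients satisfy this relation. As `X i` is a prime not dividing `X j ^ m`, the power
  -- `X i ^ m` divides `u` and cancels.
  have h1 : u * X j ^ m = X i ^ m * w := by
    apply mul_left_cancel₀ hF
    linear_combination (-X j ^ m) * hu + X i ^ m * hw
  have h2 : ¬ (X i : MvPolynomial σ K) ∣ X j ^ m := fun hd =>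
    hij (X_dvd_X.1 (X_prime.dvd_of_dvd_pow hd))
  obtain ⟨u', hu'⟩ := X_prime.pow_dvd_of_dvd_mul_right m h2 ⟨w, h1⟩
  refine ⟨u', mul_left_cancel₀ (pow_ne_zero m (X_ne_zero i)) ?_⟩
  rw [hu, hu']
  ring

theorem _root_.MvPolynomial.IsHomogeneous.eq_C_mul_of_dvd {σ : Type*} {F P : MvPolynomial σ K}
    {n : ℕ} (hF : F.IsHomogeneous n) (hP : P.IsHomogeneous n) (h : F ∣ P) :
    ∃ c, P = C c * F := by
  obtain ⟨q, rfl⟩ := h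
  rcases eq_or_ne (F * q) 0 with h0 | h0
  · exact ⟨0, by rw [h0, map_zero, zero_mul]⟩
  · have h1 := totalDegree_mul_of_isDomain (left_ne_zero_of_mul h0) (right_ne_zero_of_mul h0)
    rw [hP.totalDegree h0, hF.totalDegree (left_ne_zero_of_mul h0)] at h1
    refine ⟨q.coeff 0, ?_⟩
    rw [mul_comm, ← totalDegree_eq_zero_iff_eq_C.1 (by omega : q.totalDegree = 0)]

theorem isHomogeneous_det {σ ι : Type*} [Fintype ι] [DecidableEq ι]
    (A : Matrix ι ι (MvPolynomial σ K)) (hA : ∀ i j, (A i j).IsHomogeneous 1) :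
    A.det.IsHomogeneous (Fintype.card ι) := by
  rw [det_apply]
  refine IsHomogeneous.sum _ _ _ fun s _ => ?_
  have h1 : (∏ i, A (s i) i).IsHomogeneous (∑ _i : ι, 1) :=
    IsHomogeneous.prod _ _ _ fun i _ => hA _ _
  rw [Finset.sum_const, smul_eq_mul, mul_one, Finset.card_univ] at h1
  rcases Int.units_eq_one_or (Equiv.Perm.sign s) with hs | hs
  · rwa [hs, one_smul]
  · rw [hs, Units.neg_smul, one_smul]
    exact h1.neg

end Forms

/-! ### Fixed image of the characteristic map and focal hypersurfaces -/

section FocalIdeal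

variable {K : Type*} [Field K] {N k n : ℕ} {B : Set (Gr K N k)} {L : Gr K N k}

theorem isHomogeneous_charEntry (b : Module.Basis (Fin (k + 1)) K L.toSub)
    (η : L.toSub →ₗ[K] (Vec K N ⧸ L.toSub)) (φ : Module.Dual K (Vec K N ⧸ L.toSub)) :
    (charEntry L b η φ).IsHomogeneous 1 :=
  IsHomogeneous.sum _ _ _ fun _ _ => isHomogeneous_C_mul_X _ _

theorem isHomogeneous_det_charEntry (b : Module.Basis (Fin (k + 1)) K L.toSub)
    (η : Fin n → L.toSub →ₗ[K] (Vec K N ⧸ L.toSub))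
    (φ : Fin n → Module.Dual K (Vec K N ⧸ L.toSub)) :
    (Matrix.of fun i j => charEntry L b (η i) (φ j) :
      Matrix (Fin n) (Fin n) (MvPolynomial (Fin (k + 1)) K)).det.IsHomogeneous n := by
  have := isHomogeneous_det (Matrix.of fun i j => charEntry L b (η i) (φ j) :
    Matrix (Fin n) (Fin n) (MvPolynomial (Fin (k + 1)) K))
    fun i j => isHomogeneous_charEntry b (η i) (φ j)
  rwa [Fintype.card_fin] at this

namespace IsRuledFamily

variable (h : IsRuledFamily B n)
include h

theorem focalIdeal_eq (hL : IsSmoothMember B L) (b : Module.Basis (Fin (k + 1)) K L.toSub) :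
    focalIdeal B L b = Ideal.span {P | ∃ (η : Fin n → tangentSpaceGr B L)
      (φ : Fin n → Module.Dual K (Vec K N ⧸ L.toSub)),
      P = (Matrix.of fun i j => charEntry L b (η i).1 (φ j)).det} := by
  rw [focalIdeal, h.maxRank_eq hL]

variable [CharZero K]

/-- If the images of the characteristic map along a member lie in a fixed space then the focal
subscheme is a hypersurface. -/
theorem focalHypersurface_of_range_le (hL : IsSmoothMember B L) {v₀ : L.toSub}
    (hf : ¬ IsFocalAt B L v₀)
    (hle : ∀ v, LinearMap.range (characteristicMap B L v)
      ≤ LinearMap.range (characteristicMap B L v₀)) :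
    FocalHypersurface B L n := by
  intro b
  obtain ⟨η, φ, hηφ⟩ := h.exists_basis_dual hL hf
  let A : Matrix (Fin n) (Fin n) (MvPolynomial (Fin (k + 1)) K) :=
    Matrix.of fun i j => charEntry L b (η i).1 (φ j)
  refine ⟨A.det, ?_, isHomogeneous_det_charEntry b (fun i => (η i).1) φ, ?_⟩
  · intro h0
    have h1 := eval_det_charEntry b (fun i => (η i).1) φ (b.equivFun v₀)
    rw [LinearEquiv.symm_apply_apply] at h1
    simp only [hηφ] at h1
    change eval _ A.det = (1 : Matrix (Fin n) (Fin n) K).det at h1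
    rw [h0, map_zero, det_one] at h1
    exact zero_ne_one h1
  -- The `φ m` are coordinates on the image at `v₀`, which contains all the images.
  have hexp : ∀ z ∈ LinearMap.range (characteristicMap B L v₀),
      z = ∑ m, φ m z • (η m).1 v₀ := by
    rintro _ ⟨ξ, rfl⟩
    have h1 : characteristicMap B L v₀ ξ = ∑ m, η.repr ξ m • (η m).1 v₀ := by
      conv_lhs => rw [← η.sum_repr ξ]
      rw [map_sum]
      exact Finset.sum_congr rfl fun m _ => map_smul _ _ _
    have h2 : ∀ m, φ m (characteristicMap B L v₀ ξ) = η.repr ξ m := by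
      intro m
      rw [h1, map_sum, Finset.sum_eq_single m]
      · rw [map_smul, hηφ, Matrix.one_apply_eq, smul_eq_mul, mul_one]
      · intro l _ hl
        rw [map_smul, hηφ, Matrix.one_apply_ne hl, smul_zero]
      · simp
    simp only [h2]
    exact h1
  have hI : focalIdeal B L b = Ideal.span {A.det} := by
    rw [h.focalIdeal_eq hL]
    apply le_antisymm
    · rw [Ideal.span_le]
      rintro _ ⟨η', φ', rfl⟩
      let S : Matrix (Fin n) (Fin n) K := Matrix.of fun i l => η.repr (η' i) l
      let D : Matrix (Fin n) (Fin n) K := Matrix.of fun m j => φ' j ((η m).1 v₀)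
      -- Any other square matrix of entries differs from `A` by constant factors: `S` changes the
      -- tangent vectors, and `D` expresses the functionals on the fixed image in terms of the `φ
      -- m`.
      have hprod : (Matrix.of fun i j => charEntry L b (η' i).1 (φ' j) :
          Matrix (Fin n) (Fin n) (MvPolynomial (Fin (k + 1)) K))
          = S.map C * A * D.map C := by
        ext1 i j
        apply MvPolynomial.funext
        intro t
        rw [Matrix.of_apply, eval_charEntry]
        have h1 : (η' i).1 (b.equivFun.symm t)
            = ∑ l, S i l • (η l).1 (b.equivFun.symm t) := by
          have h2 := congrArg (characteristicMap B L (b.equivFun.symm t)) (η.sum_repr (η' i))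
          rw [map_sum] at h2
          rw [eq_comm]
          refine Eq.trans (Finset.sum_congr rfl fun l _ => ?_) h2
          rw [map_smul]
          rfl
        have h2 : ∀ l, φ' j ((η l).1 (b.equivFun.symm t))
            = ∑ m, φ m ((η l).1 (b.equivFun.symm t)) * D m j := by
          intro l
          refine (congrArg (φ' j) (hexp _ (hle (b.equivFun.symm t) ⟨η l, rfl⟩))).trans ?_
          rw [map_sum]
          exact Finset.sum_congr rfl fun m _ => by rw [map_smul, smul_eq_mul]; rfl
        rw [h1, map_sum, Matrix.mul_apply, map_sum]
        simp only [map_smul, h2, Matrix.mul_apply, map_sum, map_mul, Matrix.map_apply, eval_C,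
          smul_eq_mul, Finset.mul_sum, Finset.sum_mul]
        rw [Finset.sum_comm]
        refine Finset.sum_congr rfl fun m _ => Finset.sum_congr rfl fun l _ => ?_
        rw [← mul_assoc]
        congr 2
        exact (eval_charEntry b (η l).1 (φ m) t).symm
      rw [hprod, det_mul, det_mul]
      exact Ideal.mul_mem_right _ _ (Ideal.mul_mem_left _ _ (Ideal.mem_span_singleton_self _))
    · rw [Ideal.span_le, Set.singleton_subset_iff]
      exact Ideal.subset_span ⟨η, φ, rfl⟩
  rw [hI]
  exact fun P => Iff.rfl

/-- If the focal subscheme is a hypersurface of positive dimensional `Λ` then the images of the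
characteristic map lie in a fixed space. -/
theorem range_le_of_focalHypersurface (hk : 0 < k) (hL : IsSmoothMember B L) {v₀ : L.toSub}
    (hf : ¬ IsFocalAt B L v₀) (hH : FocalHypersurface B L n) (v : L.toSub) :
    LinearMap.range (characteristicMap B L v) ≤ LinearMap.range (characteristicMap B L v₀) := by
  let b := Module.finBasisOfFinrankEq K L.toSub L.2
  obtain ⟨F, hF0, hFn, hF⟩ := hH b
  rw [h.focalIdeal_eq hL] at hF
  have hminor : ∀ (η : Fin n → tangentSpaceGr B L)
      (φ : Fin n → Module.Dual K (Vec K N ⧸ L.toSub)),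
      ∃ c, ∀ v, (Matrix.of fun i j => φ j ((η i).1 v) : Matrix (Fin n) (Fin n) K).det
        = c * eval (b.equivFun v) F := by
    intro η φ
    -- A minor lies in the focal ideal, so some power of the irrelevant ideal multiplies it into
    -- `(F)`. Since `k > 0` there are two distinct variables, hence `F` divides the minor. Both have
    -- degree `n`, so the quotient is a constant.
    obtain ⟨m, hm⟩ := (hF _).1 ⟨0, fun Q _ => Ideal.mul_mem_left _ Q
      (Ideal.subset_span ⟨η, φ, rfl⟩)⟩
    have hne : (0 : Fin (k + 1)) ≠ Fin.last k := by
      rw [Ne, Fin.ext_iff]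
      simp only [Fin.val_zero, Fin.val_last]
      omega
    obtain ⟨c, hc⟩ := hFn.eq_C_mul_of_dvd
      (isHomogeneous_det_charEntry b (fun i => (η i).1) φ)
      (dvd_of_irrelevant_pow_mul_mem hne hF0 hm)
    refine ⟨c, fun v => ?_⟩
    have h1 := eval_det_charEntry b (fun i => (η i).1) φ (b.equivFun v)
    rw [LinearEquiv.symm_apply_apply] at h1
    rw [← h1, hc, map_mul, eval_C]
  obtain ⟨η, φ, hηφ⟩ := h.exists_basis_dual hL hf
  have hFv₀ : eval (b.equivFun v₀) F ≠ 0 := by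
    obtain ⟨c, hc⟩ := hminor η φ
    have h1 := hc v₀
    simp only [hηφ] at h1
    change (1 : Matrix (Fin n) (Fin n) K).det = _ at h1
    rw [det_one] at h1
    exact fun h0 => one_ne_zero (h1.trans (by rw [h0, mul_zero]))
  rintro _ ⟨ξ, rfl⟩
  by_contra hξ
  obtain ⟨ψ, hψ1, hψ⟩ := Submodule.exists_le_ker_of_notMem hξ
  -- With `φ j` replaced by `ψ`, the minor has a zero column at `v₀`. As `F` does not vanish there,
  -- its constant is zero.
  have hzero : ∀ j v, (Matrix.of fun i l => Function.update φ j ψ l ((η i).1 v) :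
      Matrix (Fin n) (Fin n) K).det = 0 := by
    intro j v
    obtain ⟨c, hc⟩ := hminor η (Function.update φ j ψ)
    have h1 := hc v₀
    rw [det_eq_zero_of_column_eq_zero j fun i => by
      rw [Matrix.of_apply, Function.update_self]
      exact hψ ⟨η i, rfl⟩] at h1
    rw [hc v, (mul_eq_zero.1 h1.symm).resolve_right hFv₀, zero_mul]
  have hker : (LinearMap.ker (ψ ∘ₗ ξ.1)).comap b.equivFun.symm.toLinearMap = ⊤ := by
    let Δ := (Matrix.of fun i j => charEntry L b (η i).1 (φ j) :
      Matrix (Fin n) (Fin n) (MvPolynomial (Fin (k + 1)) K)).det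
    have hΔ : ∀ t, eval t Δ = (Matrix.of fun i j => φ j ((η i).1 (b.equivFun.symm t)) :
        Matrix (Fin n) (Fin n) K).det := eval_det_charEntry b (fun i => (η i).1) φ
    refine submodule_eq_top_of_eval_ne_zero (P := Δ) ?_ _ ?_
    · intro h0
      have h1 := hΔ (b.equivFun v₀)
      rw [LinearEquiv.symm_apply_apply, h0, map_zero] at h1
      simp only [hηφ] at h1
      change 0 = (1 : Matrix (Fin n) (Fin n) K).det at h1
      rw [det_one] at h1
      exact zero_ne_one h1
    · intro t ht
      rw [hΔ] at ht
      -- By Cramer's rule the vanishing of all these minors means that `ψ` kills the values of the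
      -- `η i` wherever `Δ` is nonzero. This is an open set, and the condition is linear in `t`.
      have hcr : cramer (Matrix.of fun i j => φ j ((η i).1 (b.equivFun.symm t)) :
          Matrix (Fin n) (Fin n) K) (fun i => ψ ((η i).1 (b.equivFun.symm t))) = 0 := by
        funext j
        rw [cramer_apply, Pi.zero_apply, ← hzero j (b.equivFun.symm t)]
        congr 1
        ext i l
        rcases eq_or_ne l j with rfl | hl
        · rw [updateCol_self, Matrix.of_apply, Function.update_self]
        · rw [updateCol_ne hl, Matrix.of_apply, Matrix.of_apply, Function.update_of_ne hl]
      have h1 := mulVec_cramer (Matrix.of fun i j => φ j ((η i).1 (b.equivFun.symm t)) :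
          Matrix (Fin n) (Fin n) K) (fun i => ψ ((η i).1 (b.equivFun.symm t)))
      rw [hcr, mulVec_zero, eq_comm] at h1
      have h2 := (smul_eq_zero.1 h1).resolve_left ht
      change ψ (ξ.1 (b.equivFun.symm t)) = 0
      have h3 : ψ ∘ₗ characteristicMap B L (b.equivFun.symm t) = 0 :=
        η.ext fun i => congrFun h2 i
      exact LinearMap.congr_fun h3 ξ
  have h1 : b.equivFun v ∈ (LinearMap.ker (ψ ∘ₗ ξ.1)).comap b.equivFun.symm.toLinearMap :=
    hker ▸ Submodule.mem_top
  change ψ (ξ.1 (b.equivFun.symm (b.equivFun v))) = 0 at h1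
  rw [LinearEquiv.symm_apply_apply] at h1
  exact hψ1 h1

end IsRuledFamily

end FocalIdeal

/-! ### The equivalence of the two properties -/

theorem isRuledFamily {K : Type*} [Field K] [IsAlgClosed K] [CharZero K] {N k n : ℕ}
    {B : Set (Gr K N k)} (hBclosed : IsClosed B) (hBirr : IsIrreducible B)
    (hBdim : topologicalKrullDim B = (n : WithBot ℕ∞))
    (hXclosed : IsClosed (unionOf B)) (hXirr : IsIrreducible (unionOf B))
    (hXdim : topologicalKrullDim (unionOf B) = ((n + k : ℕ) : WithBot ℕ∞))
    (hN : n + k < N) : IsRuledFamily B n where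
  dim_eq := hBdim
  dim_union := hXdim
  irreducible := hBirr
  hasDim_frames := RuledVariety.hasDim_frames hBclosed hBirr hBdim
  hasDim_cone := RuledVariety.hasDim_cone hXclosed hXirr hXdim
  lt := hN

theorem exists_ne_zero_not_isFocalAt {K : Type*} [Field K] {N k : ℕ} {B : Set (Gr K N k)}
    {L : Gr K N k} (h : ¬ AllFocal B L) : ∃ v : L.toSub, v ≠ 0 ∧ ¬ IsFocalAt B L v := by
  rw [AllFocal] at h
  push Not at h
  exact h

theorem projectivization_eq_of_le {K : Type*} [Field K] {N : ℕ} {L : Gr K N 0} {x y : PSpace K N}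
    (hx : x.submodule ≤ L.toSub) (hy : y.submodule ≤ L.toSub) : x = y := by
  have key : ∀ x : PSpace K N, x.submodule ≤ L.toSub → x.submodule = L.toSub := fun x hx =>
    Submodule.eq_of_le_of_finrank_eq hx (by
      rw [Projectivization.finrank_submodule]
      exact L.2.symm)
  exact Projectivization.submodule_injective ((key x hx).trans (key y hy).symm)

end RuledVariety

end

open RuledVariety in
theorem theorem0p2 {K : Type*} [Field K] [IsAlgClosed K] [CharZero K] (N k n : ℕ)
    (B : Set (Gr K N k)) (hBclosed : IsClosed B) (hBirr : IsIrreducible B)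
    (hBdim : topologicalKrullDim B = (n : WithBot ℕ∞))
    (hXclosed : IsClosed (unionOf B)) (hXirr : IsIrreducible (unionOf B))
    (hXdim : topologicalKrullDim (unionOf B) = ((n + k : ℕ) : WithBot ℕ∞))
    (hN : n + k < N) :
    (∃ U : Set (Gr K N k), IsOpen U ∧ (U ∩ B).Nonempty ∧
      ∀ L ∈ U ∩ B, TangentConstantAlong (unionOf B) L) ↔
    (∃ U : Set (Gr K N k), IsOpen U ∧ (∃ L ∈ U, IsSmoothMember B L) ∧
      ∀ L, IsSmoothMember B L →
        (L ∈ U → FocalHypersurface B L n) ∧ (L ∉ U → AllFocal B L)) := by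
  have h := isRuledFamily hBclosed hBirr hBdim hXclosed hXirr hXdim hN
  obtain ⟨L₀, hL₀, hf₀⟩ := h.exists_not_allFocal
  constructor
  · rintro ⟨U, hU, hUB, hUT⟩
    -- The largest open set whose members in `B` are nonsingular and have a nonfocal point. By
    -- openness of this condition, it omits only those nonsingular members all of whose points are
    -- focal.
    refine ⟨⋃₀ {O | IsOpen O ∧ ∀ L ∈ O, L ∈ B → IsSmoothMember B L ∧ ¬ AllFocal B L},
      isOpen_sUnion fun O hO => hO.1, ⟨L₀, ?_, hL₀⟩, fun L hL => ⟨?_, fun hLU => ?_⟩⟩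
    · obtain ⟨O, hO, hLO, hO'⟩ := h.exists_isOpen_not_allFocal hL₀ hf₀
      exact ⟨O, ⟨hO, hO'⟩, hLO⟩
    · rintro ⟨O, ⟨-, hO⟩, hLO⟩
      obtain ⟨v, hv, hf⟩ := exists_ne_zero_not_isFocalAt (hO L hLO hL.1).2
      exact h.focalHypersurface_of_range_le hL hf
        (h.range_le_of_tangentConstantAlong hU hUB hUT hL hv hf)
    · by_contra hf
      obtain ⟨O, hO, hLO, hO'⟩ := h.exists_isOpen_not_allFocal hL hf
      exact hLU ⟨O, ⟨hO, hO'⟩, hLO⟩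
  · rintro ⟨U, hU, ⟨L₁, hL₁U, hL₁⟩, hUF⟩
    obtain ⟨O, hO, hLO, hO'⟩ := h.exists_isOpen_not_allFocal hL₀ hf₀
    obtain ⟨S, hS, hSB, hS'⟩ := h.exists_isOpen_exists_smooth
    refine ⟨U ∩ (O ∩ S), hU.inter (hO.inter hS), ?_, ?_⟩
    · rw [Set.inter_comm]
      exact hBirr.2 U (O ∩ S) hU (hO.inter hS) ⟨L₁, hL₁.1, hL₁U⟩
        (hBirr.2 O S hO hS ⟨L₀, hL₀.1, hLO⟩ hSB)
    · rintro L ⟨⟨hLU, hLO, hLS⟩, hLB⟩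
      obtain ⟨hL, hf⟩ := hO' L hLO hLB
      obtain ⟨v, hvL, hv0, hv⟩ := hS' L hLS hLB
      have hs : ∃ x : PSpace K N, x.submodule ≤ L.toSub ∧ IsSmoothPoint (unionOf B) x :=
        ⟨_, by rwa [Projectivization.submodule_mk, Submodule.span_singleton_le_iff_mem], hv⟩
      -- For `k = 0` the member is a single point. Saturation destroys the information in the focal
      -- ideal there, but only the existence of a smooth point on `Λ` is needed.
      rcases Nat.eq_zero_or_pos k with rfl | hk
      · obtain ⟨x, hx, hxs⟩ := hs
        refine ⟨⟨x, hx, hxs⟩, embeddedTangentSpace (unionOf B) x, fun y hy _ => ?_⟩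
        rw [projectivization_eq_of_le hx hy]
      · obtain ⟨v, -, hf⟩ := exists_ne_zero_not_isFocalAt hf
        exact h.tangentConstantAlong_of_range_le hL hf
          (h.range_le_of_focalHypersurface hk hL hf ((hUF L hL).1 hLU)) hs
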